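/- **Setting.** Let $p\le q$ be coprime positive integers with $n=p+q>2$, and put $\hat I=\{1,\dots,n\}$, $I=\{1,\dots,n-1\}$. Let $\varepsilon_1,\dots,\varepsilon_n$ be the standard basis of $\mathbb R^n$, $\Delta=\{\varepsilon_i-\varepsilon_j: i\ne j\}$ the roots of $\mathfrak{sl}(n)$, $\alpha_i=\varepsilon_i-\varepsilon_{i+1}$ and $\pi=\{\alpha_i\}_{i\in I}$. A simple root system is a linearly independent set $S\subset\Delta$ such that every root or its negative lies in $\mathbb N S$. **The meander.** Define involutions of $\hat I$ by $\sigma(i)=n+1-i$, and $\tau(i)=p+1-i$ for $i\le p$, $\tau(i)=n+p+1-i$ for $i>p$. Let $a=(p+1)/2$ if $p$ is odd and $a=p+(q+1)/2$ if $p$ is even. Let $\varphi:\hat I\to\hat I$ be the bijection $\varphi(1)=a$, $\varphi(2)=\sigma(a)$, $\varphi(3)=\tau\sigma(a),\dots$ (applying $\sigma$ and $\tau$ alternately). Put $\beta_{i,j}=\varepsilon_{\varphi(i)}-\varepsilon_{\varphi(j)}$ and $\beta_i=\beta_{i,i+1}$ for $i\in I$. Call $\varphi(t)$ a turning point if $(\varphi(t)-\sigma\varphi(t))(\varphi(t)-\tau\varphi(t))\le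 0$, and an internal one if moreover $1<t<n$. There are $p+1$ turning points; write the corresponding $t$ in increasing order as $t_1<\dots<t_{p+1}$ if $p$ is odd and as $t_0<\dots<t_p$ if $p$ is even. Let $A$ (resp. $B$) be the set of turning points $\varphi(t_k)$ with $k$ odd (resp. even). Put $\epsilon_i=(-1)^{k-1}$ for $t_k\le i<t_{k+1}$. If $\varphi(r),\varphi(s)$ are turning points, $r<s$, write $\iota_{r,s}=\beta_{r,s}$ (an interval value, simple if the turning points are consecutive). The boundary values of a turning point $\varphi(t)$ are $\beta_{t-1}$ (above it) and $\beta_t$ (below it), as far as defined. Call $\beta_i$ (or $i$) nil if $\alpha_p$ has non-zero coefficient in $\beta_i$, and isolated if $\varphi(i)$ and $\varphi(i+1)$ are both turning points. An index $e\in I$ is exceptional if $\beta_e\in\pm\pi$. **Signature.** Let $J=\{1,\dots,M\}$, $M=[(p+1)/2]$. For $j\in J$ let $\mathrm{sg}(j)=1$ if $\beta_{t_{2j-1}}$ is nil, and $\mathrm{sg}(j)=-1$ otherwise (then $\beta_{t_{2j-1}-1}$ is nil). A run is a maximal interval of $J$ on which $\mathrm{sg}$ is constant. **The values $\beta'_i$.**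 Set $\beta'_i=\beta_i$ except in the following cases, which concern boundary values of internal turning points; nil values are never changed. *Case $\mathrm{sg}(1)=1$.* - At $\varphi(t_{2v-1})\in A$ with $\mathrm{sg}(v)=1$, the value above, $\beta_{t_{2v-1}-1}$, is changed. If $v=k-1$ ends its run and $k\in J$ starts a negative run, add $\iota_{t_{2k-3},t_{2\ell-2}}$, where $\ell$ starts the run following that of $k$ (and $\ell=M+1$ if there is none). Otherwise add $\iota_{t_{2v-1},t_{2v}}$. - At $\varphi(t_{2v-1})\in A$ with $\mathrm{sg}(v)=-1$, add $\iota_{t_{2v-2},t_{2v-1}}$ to the value below, $\beta_{t_{2v-1}}$. - At an internal $\varphi(t_{2v})\in B$ with $\mathrm{sg}(v+1)=-1$: add $\iota_{t_{2v},t_{2v+1}}$ to the value above if that value is not nil; if it is nil, add instead $\iota_{t_{2v-1},t_{2v}}$ to the value below. - At an internal $\varphi(t_{2v})\in B$ with $\mathrm{sg}(v)=\mathrm{sg}(v+1)=1$: add $\iota_{t_{2v-1},t_{2v}}$ to the value below. - At an internal $\varphi(t_{2v})\in B$ with $\mathrm{sg}(v)=-1$, $\mathrm{sg}(v+1)=1$: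 let $k$ be the first element of the run of $v$. Add to the value below $\iota_{t_{2k-3},t_{2v}}$ if $t_{2k-3}$ is not isolated, and $\iota_{t_{2k-1},t_{2v}}$ if it is. *Case $\mathrm{sg}(1)=-1$* (possible only for $p$ even). - At $\varphi(t_{2v-1})\in A$ with $\mathrm{sg}(v)=-1$, the value below is changed. If $v\ge 2$ and $\mathrm{sg}(v-1)=1$, add $\iota_{t_{2k-2},t_{2v-1}}$, where $k$ is the first element of the run of $v-1$. Otherwise add $\iota_{t_{2v-2},t_{2v-1}}$. - At $\varphi(t_{2v-1})\in A$ with $\mathrm{sg}(v)=1$, add $\iota_{t_{2v-1},t_{2v}}$ to the value above. - At an internal $\varphi(t_{2v})\in B$ with $\mathrm{sg}(v)=1$: add $\iota_{t_{2v-1},t_{2v}}$ to the value below if that value is not nil; if it is nil, add instead $\iota_{t_{2v},t_{2v+1}}$ to the value above. - At an internal $\varphi(t_{2v})\in B$ with $\mathrm{sg}(v)=\mathrm{sg}(v+1)=-1$: add $\iota_{t_{2v},t_{2v+1}}$ to the value above. - At an internal $\varphi(t_{2v})\in B$ with $\mathrm{sg}(v)=-1$, $\mathrm{sg}(v+1)=1$: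 if a run follows that of $v+1$, let $\ell$ be its first element and add to the value above $\iota_{t_{2v},t_{2\ell-1}}$ if $t_{2\ell-2}$ is not isolated, and $\iota_{t_{2v},t_{2\ell-3}}$ if it is. If no run follows, add $\iota_{t_{2v},t_{2M-1}}$ to the value above. **The values $\beta''_i$.** Let $e$ be the exceptional index. If $\beta'_e\ne\beta_e$, put $\beta''_i=\beta'_i$ for all $i$. Suppose $\beta'_e=\beta_e$. Then $\beta_e$ is a boundary value of a turning point $\varphi(t)$, $t\in\{e,e+1\}$. If $\varphi(t)$ is internal, let $\beta_f$ be its second boundary value and $\iota_1=\beta'_f-\beta_f$, and put $\beta''_f=\beta_f$. If $t\in\{1,n\}$, let $\iota_1$ be the simple interval value between $\varphi(t)$ and the closest turning point (there is no $f$). Put $\beta''_e=-\iota_1$. For the index $i\neq e,f$, if there is one, such that $\beta'_i\ne\beta_i$ and $\beta'_i-\beta_e$ is a root, put $\beta''_i=\beta'_i-\beta_e$. For all other $i$ put $\beta''_i=\beta'_i$. **Theorem.** There is exactly one exceptional index $e$. Put $\beta^{**}_i=\epsilon_i\beta''_i$ and $\Pi^{**}=\{\beta^{**}_i\}_{i\in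 I}$. Then a) $\Pi^{**}$ is a simple root system; b) if $\beta^{**}_i\ne\epsilon_i\beta_i$, then $\alpha_p$ has coefficient $-1$ in $\beta^{**}_i$ (expressed through $\pi$); c) $\beta^{**}_e\neq\epsilon_e\beta_e$; d) $\epsilon_i\beta_i\in\mathbb N\,\Pi^{**}$ for all $i\in I\setminus\{e\}$, that is, these roots are positive with respect to $\Pi^{**}$. -/

import Mathlib

/-!
Throughout `n = p + q`.  Indices are one-based, as in `{1, …, n}` and `I = {1, …, n - 1}`.
-/

namespace Meander

/-! ### The root system of type `A_{n-1}` in `ℝⁿ` -/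

/-- The standard basis vector `ε_k` of `ℝⁿ`, for `k ∈ {1, …, n}`. -/
noncomputable def eps (n k : ℕ) : Fin n → ℝ := fun j => if j.val + 1 = k then 1 else 0

/-- The simple root `α_k = ε_k - ε_{k+1}`, for `k ∈ {1, …, n - 1}`. -/
noncomputable def alpha (n k : ℕ) : Fin n → ℝ := eps n k - eps n (k + 1)

/-- The set of roots `ε_i - ε_j`, `i ≠ j`. -/
def roots (n : ℕ) : Set (Fin n → ℝ) :=
  {v | ∃ i j : ℕ, 1 ≤ i ∧ i ≤ n ∧ 1 ≤ j ∧ j ≤ n ∧ i ≠ j ∧ v = eps n i - eps n j}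

/-- The set `ℕ S` of combinations of elements of `S` with natural number coefficients. -/
def natSpan {n : ℕ} (S : Set (Fin n → ℝ)) : Set (Fin n → ℝ) := AddSubmonoid.closure S

/-- `S` is a simple root system (a base of the root system): it is a linearly independent set of
roots, and every root or its negative is a combination of `S` with natural number coefficients. -/
def IsSimpleSystem {n : ℕ} (S : Set (Fin n → ℝ)) : Prop :=
  S ⊆ roots n ∧ LinearIndepOn ℝ id S ∧ ∀ v ∈ roots n, v ∈ natSpan S ∨ -v ∈ natSpan S

/-- The coefficient of `α_p` in a vector of the span of the simple roots `α_k`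
(see `coeff_sum_alpha`). -/
noncomputable def coeff (n p : ℕ) (v : Fin n → ℝ) : ℝ :=
  ∑ j : Fin n, if j.val + 1 ≤ p then v j else 0

theorem coeff_eps (n p k : ℕ) (hk : 1 ≤ k) (hkn : k ≤ n) :
    coeff n p (eps n k) = if k ≤ p then 1 else 0 := by
  unfold coeff eps
  rw [Finset.sum_eq_single (⟨k - 1, by omega⟩ : Fin n)]
  · simp [Nat.sub_add_cancel hk]
  · intro b _ hb
    have : ¬ (b.val + 1 = k) := fun h => hb (Fin.ext (by simp; omega))
    simp [this]
  · simp

theorem coeff_sum_alpha (n p : ℕ) (hp : 1 ≤ p) (hpn : p < n) (c : ℕ → ℝ) :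
    coeff n p (∑ k ∈ Finset.Ico 1 n, c k • alpha n k) = c p := by
  have h1 : coeff n p (∑ k ∈ Finset.Ico 1 n, c k • alpha n k) =
      ∑ k ∈ Finset.Ico 1 n, c k * (coeff n p (eps n k) - coeff n p (eps n (k + 1))) := by
    unfold coeff alpha
    simp only [← Finset.sum_sub_distrib, Finset.mul_sum]
    rw [Finset.sum_comm]
    refine Finset.sum_congr rfl fun j _ => ?_
    split_ifs <;> simp [Finset.sum_apply]
  rw [h1, Finset.sum_eq_single p]
  · rw [coeff_eps n p p hp hpn.le, coeff_eps n p (p + 1) (by omega) (by omega)]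
    simp
  · intro k hk hkp
    rw [Finset.mem_Ico] at hk
    rw [coeff_eps n p k hk.1 hk.2.le, coeff_eps n p (k + 1) (by omega) (by omega)]
    by_cases h : k ≤ p
    · have h' : k + 1 ≤ p := by omega
      simp [h, h']
    · have h' : ¬ (k + 1 ≤ p) := by omega
      simp [h, h']
  · intro h
    exact absurd (Finset.mem_Ico.2 ⟨hp, hpn⟩) h

/-! ### The meander -/

/-- The involution `σ` of `{1, …, n}`. -/
def sigma (p q i : ℕ) : ℕ := p + q + 1 - i

/-- The involution `τ` of `{1, …, n}`. -/
def tau (p q i : ℕ) : ℕ := if i ≤ p then p + 1 - i else p + q + p + 1 - i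

/-- The starting point `a`, which is fixed by `τ`. -/
def start (p q : ℕ) : ℕ := if Odd p then (p + 1) / 2 else p + (q + 1) / 2

/-- The enumeration `φ(1) = a`, `φ(2) = σ(a)`, `φ(3) = τσ(a)`, … of the meander
(the value `φ(0) = 0` is not used). -/
def phi (p q : ℕ) : ℕ → ℕ
  | 0 => 0
  | 1 => start p q
  | k + 2 => if Even k then sigma p q (phi p q (k + 1)) else tau p q (phi p q (k + 1))

/-- `β_{i,j} = ε_{φ(i)} - ε_{φ(j)}`.  When `i < j` and `φ(i)`, `φ(j)` are turning points this is
the interval value `ι_{i,j}`. -/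
noncomputable def betaI (p q i j : ℕ) : Fin (p + q) → ℝ :=
  eps (p + q) (phi p q i) - eps (p + q) (phi p q j)

/-- `β_i = ε_{φ(i)} - ε_{φ(i+1)}`, for `i ∈ I`. -/
noncomputable def beta (p q i : ℕ) : Fin (p + q) → ℝ := betaI p q i (i + 1)

/-- `φ(t)` is a turning point: `φ(t) - σ(φ(t))` and `φ(t) - τ(φ(t))` have opposite signs, or one of
them vanishes (the two end points). -/
def IsTurning (p q t : ℕ) : Prop :=
  1 ≤ t ∧ t ≤ p + q ∧
    ((phi p q t : ℤ) - sigma p q (phi p q t)) * ((phi p q t : ℤ) - tau p q (phi p q t)) ≤ 0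

instance (p q t : ℕ) : Decidable (IsTurning p q t) := by
  unfold IsTurning
  infer_instance

/-- `φ(t)` is an internal turning point. -/
def IsInternal (p q t : ℕ) : Prop := IsTurning p q t ∧ 1 < t ∧ t < p + q

instance (p q t : ℕ) : Decidable (IsInternal p q t) := by
  unfold IsInternal
  infer_instance

/-- The increasing enumeration of the `t` for which `φ(t)` is a turning point, labelled as
`t_1 < ⋯ < t_{p+1}` if `p` is odd and as `t_0 < ⋯ < t_p` if `p` is even.  The turning points
`φ(t_k)` with `k` odd form the set `A`, those with `k` even form the set `B`. -/
noncomputable def turn (p q k : ℕ) : ℕ := Nat.nth (IsTurning p q) (if Odd p then k - 1 else k)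

/-- The index `k` with `t_k ≤ i < t_{k+1}`; in particular the label `k` of `i` if `i = t_k`. -/
def label (p q i : ℕ) : ℕ :=
  ((Finset.Icc 1 i).filter (fun t => IsTurning p q t)).card - (if Odd p then 0 else 1)

/-- The sign `ϵ_i = (-1)^{k-1}`, where `t_k ≤ i < t_{k+1}`. -/
def sign (p q i : ℕ) : ℝ := (-1) ^ (label p q i + 1)

/-- `i` is a nil point: the coefficient of `α_p` in `β_i` is non-zero. -/
def IsNil (p q i : ℕ) : Prop := coeff (p + q) p (beta p q i) ≠ 0

/-- `i` is an isolated point: both `φ(i)` and `φ(i+1)` are turning points. -/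
def IsIsolated (p q i : ℕ) : Prop := IsTurning p q i ∧ IsTurning p q (i + 1)

instance (p q i : ℕ) : Decidable (IsIsolated p q i) := by
  unfold IsIsolated
  infer_instance

/-- `i` is an exceptional index: `i ∈ I` and `β_i ∈ ±π`. -/
def IsExceptional (p q i : ℕ) : Prop :=
  1 ≤ i ∧ i < p + q ∧ ∃ k : ℕ, 1 ≤ k ∧ k < p + q ∧
    (beta p q i = alpha (p + q) k ∨ beta p q i = -alpha (p + q) k)

/-! ### The signature -/

/-- The number of elements of `J = {1, …, [(p+1)/2]}`, which labels the elements `φ(t_{2j-1})`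
of `A`. -/
def numJ (p : ℕ) : ℕ := (p + 1) / 2

open Classical in
/-- `sg(j)`, for `j ∈ J`: it is `1` if the nil boundary value at `φ(t_{2j-1})` is the one below it,
namely `β_t` with `t = t_{2j-1}`, and `-1` if it is the one above it, namely `β_{t-1}`. -/
noncomputable def sg (p q j : ℕ) : ℤ := if IsNil p q (turn p q (2 * j - 1)) then 1 else -1

/-- The first element of the maximal run of constant signature that contains `j ∈ J`:
it is `j_u` if `j_u ≤ j < j_{u+1}`. -/
noncomputable def runStart (p q j : ℕ) : ℕ :=
  sInf {w | 1 ≤ w ∧ w ≤ j ∧ ∀ x, w ≤ x → x ≤ j → sg p q x = sg p q j}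

/-- The first element after the maximal run of constant signature that contains `j ∈ J`:
it is `j_{u+1}` if `j_u ≤ j < j_{u+1}`.  If the run is the last one, so that `j_{u+1}` is not
defined, it is `|J| + 1`. -/
noncomputable def runEnd (p q j : ℕ) : ℕ :=
  sInf {w | j < w ∧ (numJ p < w ∨ sg p q w ≠ sg p q j)}

/-! ### The changed values

For each internal turning point `φ(t_κ)` the next four definitions give the interval value that is
added to the non-nil boundary value just above it (that is `β_{t_κ - 1}`) or just below it (that is
`β_{t_κ}`); the value `0` means that this boundary value is left unchanged.  The first two concern
an initially positive signature, `sg(1) = 1`, and the last two an initially negative one.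

If `κ = 2v - 1` is odd, then `φ(t_κ)` is the `v`-th element of `A`; if `κ = 2v` is even, then it is
the element of `B` between the `v`-th and the `(v+1)`-st element of `A`. -/

/-- Initially positive signature, boundary value above `φ(t_κ)`.  For `κ = 2v - 1` (then
`sg(v) = 1`): at the last element `v = k - 1` of a positive run the compound value
`ι_{t_{2k-3}, t_{2ℓ-2}}` is added, where `k` starts the next (negative) run and `ℓ` the run after
that, `ℓ = |J| + 1` if there is none; otherwise the simple value `ι_{t_κ, t_{κ+1}}` is added. -/
noncomputable def addAbovePos (p q κ : ℕ) : Fin (p + q) → ℝ :=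
  if Odd κ then
    let v := (κ + 1) / 2
    if v < numJ p ∧ sg p q (v + 1) = -1 then
      betaI p q (turn p q κ) (turn p q (2 * runEnd p q (v + 1) - 2))
    else betaI p q (turn p q κ) (turn p q (κ + 1))
  else
    let v := κ / 2
    if sg p q (v + 1) = -1 then betaI p q (turn p q κ) (turn p q (κ + 1)) else 0

open Classical in
/-- Initially positive signature, boundary value below `φ(t_κ)`.  Let `κ = 2v`.
If `sg(v+1) = -1`, the value above `φ(t_κ)` is the one to be changed, unless it is nil (this is the
case in which `ι_1` is an isolated value), when `ι_1` is added to the value below.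
If `sg(v) = sg(v+1) = 1` a simple interval value is added.
If `sg(v) = -1`, `sg(v+1) = 1`, then `κ = 2ℓ - 2` with `ℓ = v + 1`; let `k` be the start of the
negative run of `v`. One adds `ι_{t_{2k-3}, t_{2ℓ-2}}`, or `ι_{t_{2k-1}, t_{2ℓ-2}}` if
`ι_1 = ι_{t_{2k-3}, t_{2k-2}}` is an isolated value. -/
noncomputable def addBelowPos (p q κ : ℕ) : Fin (p + q) → ℝ :=
  if Odd κ then betaI p q (turn p q (κ - 1)) (turn p q κ)
  else
    let v := κ / 2
    if sg p q (v + 1) = -1 then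
      if IsNil p q (turn p q κ - 1) then betaI p q (turn p q (κ - 1)) (turn p q κ) else 0
    else if sg p q v = 1 then betaI p q (turn p q (κ - 1)) (turn p q κ)
    else
      let k := runStart p q v
      if IsIsolated p q (turn p q (2 * k - 3)) then
        betaI p q (turn p q (2 * k - 1)) (turn p q κ)
      else betaI p q (turn p q (2 * k - 3)) (turn p q κ)

/-- Initially negative signature, boundary value below `φ(t_κ)`; mirror image of `addAbovePos`.
For `κ = 2v - 1` (then `sg(v) = -1`): if `v` is the first element of a negative run that follows a
positive run starting at `k`, the compound value `ι_{t_{2k-2}, t_κ}` is added; otherwise the simple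
value `ι_{t_{κ-1}, t_κ}` is added. -/
noncomputable def addBelowNeg (p q κ : ℕ) : Fin (p + q) → ℝ :=
  if Odd κ then
    let v := (κ + 1) / 2
    if 2 ≤ v ∧ sg p q (v - 1) = 1 then
      betaI p q (turn p q (2 * runStart p q (v - 1) - 2)) (turn p q κ)
    else betaI p q (turn p q (κ - 1)) (turn p q κ)
  else
    let v := κ / 2
    if sg p q v = 1 then betaI p q (turn p q (κ - 1)) (turn p q κ) else 0

open Classical in
/-- Initially negative signature, boundary value above `φ(t_κ)`; mirror image of `addBelowPos`,
except when a positive run is not followed by a negative one.  Let `κ = 2v`.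
If `sg(v) = -1`, `sg(v+1) = 1`, let `ℓ` be the start of the negative run following that of `v + 1`.
If `ℓ` is defined one adds `ι_{t_{2v}, t_{2ℓ-1}}`, or `ι_{t_{2v}, t_{2ℓ-3}}` if
`ι_{t_{2ℓ-2}, t_{2ℓ-1}}` is an isolated value.  If `ℓ` is not defined one adds `ι_{t_{2v}, s}`, where
`φ(s)` is the last turning point in `A`. -/
noncomputable def addAboveNeg (p q κ : ℕ) : Fin (p + q) → ℝ :=
  if Odd κ then betaI p q (turn p q κ) (turn p q (κ + 1))
  else
    let v := κ / 2
    if sg p q v = 1 then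
      if IsNil p q (turn p q κ) then betaI p q (turn p q κ) (turn p q (κ + 1)) else 0
    else if sg p q (v + 1) = -1 then betaI p q (turn p q κ) (turn p q (κ + 1))
    else
      let ℓ := runEnd p q (v + 1)
      if numJ p < ℓ then betaI p q (turn p q κ) (turn p q (2 * numJ p - 1))
      else if IsIsolated p q (turn p q (2 * ℓ - 2)) then
        betaI p q (turn p q κ) (turn p q (2 * ℓ - 3))
      else betaI p q (turn p q κ) (turn p q (2 * ℓ - 1))

open Classical in
/-- The values `β'_i`, `i ∈ I`.  Only non-nil boundary values of internal turning points are
changed. -/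
noncomputable def beta' (p q i : ℕ) : Fin (p + q) → ℝ :=
  if IsNil p q i then beta p q i
  else if IsInternal p q (i + 1) then
    beta p q i + if sg p q 1 = 1 then addAbovePos p q (label p q (i + 1))
      else addAboveNeg p q (label p q (i + 1))
  else if IsInternal p q i then
    beta p q i + if sg p q 1 = 1 then addBelowPos p q (label p q i)
      else addBelowNeg p q (label p q i)
  else beta p q i

/-! ### The correction at the exceptional value -/

/-- The index `t ∈ {e, e + 1}` of the turning point `φ(t)` of which `β_e` is a boundary value. -/
def excTurn (p q e : ℕ) : ℕ := if IsTurning p q e then e else e + 1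

/-- The index `f` of the second boundary value of that turning point (it lies in `I` exactly if the
turning point is internal). -/
def excOther (p q e : ℕ) : ℕ := if IsTurning p q e then e - 1 else e + 1

/-- The interval value `ι_1`.  At an internal turning point it is defined by
`β'_f = β_f + ι_1`; at an end point it is the simple interval value between this end point and the
closest turning point. -/
noncomputable def excIota (p q e : ℕ) : Fin (p + q) → ℝ :=
  let t := excTurn p q e
  if IsInternal p q t then beta' p q (excOther p q e) - beta p q (excOther p q e)
  else if t = 1 then betaI p q t (turn p q (label p q t + 1))
  else betaI p q (turn p q (label p q t - 1)) t

open Classical in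
/-- The values `β''_i`, `i ∈ I`, where `e` is the exceptional index.  If `β'_e ≠ β_e` nothing is
modified.  If `β'_e = β_e`, then `β''_e = -ι_1`, `β''_f = β_f`, and `β''_i = β'_i - β_e` for the
index `i = i(e)`, if there is one, such that `β'_i ≠ β_i` and `β'_i - β_e` is a root. -/
noncomputable def beta'' (p q e i : ℕ) : Fin (p + q) → ℝ :=
  if beta' p q e ≠ beta p q e then beta' p q i
  else if i = e then -excIota p q e
  else if i = excOther p q e then beta p q i
  else if beta' p q i ≠ beta p q i ∧ beta' p q i - beta p q e ∈ roots (p + q) then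
    beta' p q i - beta p q e
  else beta' p q i

/-- The elements `ϵ_i β_i`. -/
noncomputable def signedBeta (p q i : ℕ) : Fin (p + q) → ℝ := sign p q i • beta p q i

/-- The elements `β**_i = ϵ_i β''_i`. -/
noncomputable def betaStar2 (p q e i : ℕ) : Fin (p + q) → ℝ := sign p q i • beta'' p q e i

/-- The modified system `Π** = {β**_i : i ∈ I}`. -/
def PiStar2 (p q e : ℕ) : Set (Fin (p + q) → ℝ) :=
  {v | ∃ i : ℕ, 1 ≤ i ∧ i < p + q ∧ v = betaStar2 p q e i}

end Meander

/-! Number the vertices along the meander by `t = 1, …, n` and orient each edge `{i, i+1}` so that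
`ϵ_i β_i` is "tail minus head". The sign changes exactly at the turning points, so the points of `A`
become sources, those of `B` become sinks, and the path becomes a zigzag. Adding an interval value
telescopes: it moves one end of one edge, either a tail from a source to a sink or a head from a
sink to a source.

In type `A` a base amounts to a linear order of the basis vectors, that is, to `n - 1` edges forming
one directed path through all vertices. Here this is certified locally: every vertex has at most one
outgoing and one incoming edge (explicit functions recover the edge from its tail and from its
head), and a lexicographic key increases along every edge, which excludes cycles. The same key
increases along the original edges, so the roots `ϵ_i β_i` are positive. This is the content of
`edge_pos` and `edge_neg`, fed into `IsChain.isSimpleSystem` and `IsChain.natSpan_of_lt`.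

The new path runs through blocks. If the signature starts positively, a block is a positive source
with the negative sources after it, and the blocks are traversed backwards. If it starts negatively,
a block is a negative source with the positive run before it (a final positive run also counts), and
the blocks are traversed forwards.

Sources have coordinate at most `p` and sinks have coordinate greater than `p`. A changed edge is
not nil, so its old ends lie on one side of `p`; moving one end makes it run from above `p` to at
most `p`, whence the coefficient `-1` of `α_p`.

Exactly one of `p`, `q`, `p + q` is even, and the middle pair of the corresponding interval is the
exceptional edge `e`. If `e` is unchanged, then `p` is odd and the head of `e` is a sink `t`. At an
internal sink, `t` is cut out of the chain and inserted into the edge `f`, the other original edge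
at `t`, just before the new head of `f` (`IsChain.move`). Only the original edge `e` may thereby
lose positivity. If `t` is the end of the path, then `p = 1`, and the chain `1, …, n` is rotated to
`n, 1, …, n - 1`. -/

namespace Meander

/-! ### Zigzags -/

/-- A lexicographic key. -/
def lexKey (a b c : ℤ) : ℤ ×ₗ ℤ ×ₗ ℤ := toLex (a, toLex (b, c))

theorem lexKey_lt (a b c a' b' c' : ℤ) :
    lexKey a b c < lexKey a' b' c' ↔ a < a' ∨ a = a' ∧ (b < b' ∨ b = b' ∧ c < c') := by
  simp [lexKey, Prod.Lex.toLex_lt_toLex]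

/-- The path `1, …, n` with turning points `T k` (`k ≤ 2 * M`), where `L t` is the label of the last
turning point before `t`.  Sources have odd labels, and `s w` says that the source with label
`2 * w + 1` has positive signature. -/
structure Zigzag (n M : ℕ) (L T : ℕ → ℕ) (trn s : ℕ → Prop) : Prop where
  range : ∀ t, trn t → 1 ≤ t ∧ t ≤ n
  T_L : ∀ t, trn t → T (L t) = t
  trn_T : ∀ k, L 1 ≤ k → k ≤ 2 * M → trn (T k)
  L_T : ∀ k, L 1 ≤ k → k ≤ 2 * M → L (T k) = k
  L_succ_trn : ∀ t, 1 ≤ t → t < n → trn (t + 1) → L (t + 1) = L t + 1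
  L_succ_not : ∀ t, 1 ≤ t → t < n → ¬ trn (t + 1) → L (t + 1) = L t
  trn_one : trn 1
  trn_n : trn n
  L_one : L 1 ≤ 1
  L_n : L n = 2 * M
  iso_below : ∀ t w, trn t → L t = 2 * w + 1 → trn (t + 1) → s w
  iso_above : ∀ t w, trn (t + 1) → L (t + 1) = 2 * w + 1 → trn t → ¬ s w
  iso_B : ∀ t w, trn t → L t = 2 * w → trn (t + 1) → ¬ trn (t - 1)
  s_zero : L 1 = 1 → s 0

namespace Zigzag

variable {n M : ℕ} {L T : ℕ → ℕ} {trn s : ℕ → Prop}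

theorem L_mono (Z : Zigzag n M L T trn s) {t u : ℕ} (h1 : 1 ≤ t) (h : t ≤ u) (hu : u ≤ n) :
    L t ≤ L u := by
  induction u, h using Nat.le_induction with
  | base => exact le_rfl
  | succ u h ih =>
    have := ih (by omega)
    by_cases ht : trn (u + 1)
    · have := Z.L_succ_trn u (by omega) (by omega) ht; omega
    · have := Z.L_succ_not u (by omega) (by omega) ht; omega

/-- The last vertex is itself a turning point, so the top label is reached only there. -/
theorem L_lt (Z : Zigzag n M L T trn s) {t : ℕ} (h1 : 1 ≤ t) (h : t < n) : L t < 2 * M := by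
  have h2 := Z.L_mono h1 (show t ≤ n - 1 by omega) (by omega)
  have h3 := Z.L_succ_trn (n - 1) (by omega) (by omega)
    (by rw [Nat.sub_add_cancel (by omega)]; exact Z.trn_n)
  rw [Nat.sub_add_cancel (by omega), Z.L_n] at h3
  omega

theorem T_range (Z : Zigzag n M L T trn s) {k : ℕ} (h1 : L 1 ≤ k) (h : k ≤ 2 * M) :
    1 ≤ T k ∧ T k ≤ n := Z.range _ (Z.trn_T k h1 h)

theorem T_lt (Z : Zigzag n M L T trn s) {k l : ℕ} (h1 : L 1 ≤ k) (h : k < l) (hl : l ≤ 2 * M) :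
    T k < T l := by
  by_contra hc
  have h2 := Z.T_range (k := k) h1 (by omega)
  have h3 := Z.T_range (k := l) (by omega) hl
  have := Z.L_mono h3.1 (not_lt.1 hc) h2.2
  rw [Z.L_T k h1 (by omega), Z.L_T l (by omega) hl] at this
  omega

theorem L_one_le (Z : Zigzag n M L T trn s) {t : ℕ} (h1 : 1 ≤ t) (h : t ≤ n) : L 1 ≤ L t :=
  Z.L_mono le_rfl h1 h

theorem T_n (Z : Zigzag n M L T trn s) : T (2 * M) = n := by
  have := Z.T_L n Z.trn_n; rwa [Z.L_n] at this

/-- The index of the last positive source up to a given one, and `0` if there is none. -/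
structure LastPos (M : ℕ) (s : ℕ → Prop) (c eo : ℕ → ℕ) : Prop where
  zero : c 0 = 0
  pos : ∀ w, s w → c (w + 1) = w + 1
  neg : ∀ w, ¬ s w → c (w + 1) = c w
  eo_spec : ∀ w, w < M → s w → w + 1 ≤ eo w ∧ eo w ≤ M ∧ c (eo w) = w + 1 ∧ (eo w < M → s (eo w))

namespace LastPos
variable {c eo : ℕ → ℕ}

theorem le (C : LastPos M s c eo) (w : ℕ) : c w ≤ w := by
  induction w with
  | zero => simp [C.zero]
  | succ w ih =>
    by_cases h : s w
    · rw [C.pos w h]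
    · rw [C.neg w h]; omega

theorem mono (C : LastPos M s c eo) {u w : ℕ} (h : u ≤ w) : c u ≤ c w := by
  induction w, h using Nat.le_induction with
  | base => exact le_rfl
  | succ w _ ih =>
    by_cases hs : s w
    · rw [C.pos w hs]; have := C.le w; omega
    · rw [C.neg w hs]; omega

theorem s_pred (C : LastPos M s c eo) {w : ℕ} (h : 0 < c w) : s (c w - 1) := by
  induction w with
  | zero => simp [C.zero] at h
  | succ w ih =>
    by_cases hs : s w
    · rw [C.pos w hs]; simpa using hs
    · rw [C.neg w hs] at h ⊢; exact ih h

theorem c_c (C : LastPos M s c eo) (w : ℕ) : c (c w) = c w := by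
  rcases Nat.eq_zero_or_pos (c w) with h | h
  · rw [h, C.zero]
  · have := C.pos _ (C.s_pred h)
    rwa [Nat.sub_add_cancel h] at this

theorem not_s (C : LastPos M s c eo) {u w : ℕ} (h1 : c w ≤ u) (h2 : u < w) : ¬ s u := fun h => by
  have := C.mono (show u + 1 ≤ w by omega)
  rw [C.pos u h] at this
  omega

/-- The value of `c` tells in which block one is: `c u = w + 1` places `u` between the positive
source `w` and the next positive one. The block stops where a positive source or the end follows;
two different stopping places would leave a positive source strictly inside the block. -/
theorem eo_unique (C : LastPos M s c eo) {u w : ℕ} (hw : w < M) (hs : s w) (hu : c u = w + 1)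
    (huM : u ≤ M) (hu' : u < M → s u) : eo w = u := by
  obtain ⟨h1, h2, h3, h4⟩ := C.eo_spec w hw hs
  rcases lt_trichotomy (eo w) u with h | h | h
  · exact absurd (h4 (by omega)) (C.not_s (by rw [hu]; exact h1) h)
  · exact h
  · have := C.le u
    exact absurd (hu' (by omega)) (C.not_s (by omega) h)

end LastPos
end Zigzag
end Meander

/-! ### The new chain for an initially positive signature. -/

namespace Meander
set_option linter.unusedSimpArgs false
namespace Zigzag
variable {n M : ℕ} {L T : ℕ → ℕ} {trn s : ℕ → Prop}

/-- The tail of the edge `{i, i + 1}` of a zigzag. -/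
def tail (L : ℕ → ℕ) (i : ℕ) : ℕ := if L i % 2 = 1 then i else i + 1

/-- The head of the edge `{i, i + 1}` of a zigzag. -/
def head (L : ℕ → ℕ) (i : ℕ) : ℕ := if L i % 2 = 1 then i + 1 else i

section
variable (M : ℕ) (L T : ℕ → ℕ) (trn s : ℕ → Prop) (c eo : ℕ → ℕ)

open Classical in
/-- The tail of the changed edge, initially positive signature. -/
noncomputable def tailPos (i : ℕ) : ℕ :=
  if L i % 2 = 1 then (if trn i ∧ ¬ s (L i / 2) then T (L i - 1) else i)
  else if trn (i + 1) ∧ s (L i / 2) then T (2 * eo (L i / 2)) else i + 1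

open Classical in
/-- The index of the source that is the head of a changed edge below the sink with label `2 * w`. -/
noncomputable def below (w : ℕ) : ℕ :=
  if s (w - 1) then w else if trn (T (2 * c w - 1) + 1) then c w + 1 else c w

open Classical in
/-- The head of the changed edge, initially positive signature. -/
noncomputable def headPos (i : ℕ) : ℕ :=
  if L i % 2 = 1 then
    (if trn (i + 1) ∧ ¬ trn i ∧ L i / 2 + 1 < M ∧ ¬ s (L i / 2 + 1) then T (L i + 2) else i + 1)
  else if trn i ∧ 0 < L i / 2 ∧ (s (L i / 2) ∨ trn (i - 1)) then
    T (2 * below T trn s c (L i / 2) - 1) else i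

open Classical in
/-- The edge leaving a vertex. -/
noncomputable def outPos (t : ℕ) : ℕ :=
  if L t % 2 = 1 then (if trn t ∧ ¬ s (L t / 2) then t - 1 else t)
  else if trn t then
    (if L t / 2 < M ∧ ¬ s (L t / 2) then T (L t + 1) else T (2 * c (L t / 2) - 1) - 1)
  else t - 1

open Classical in
/-- The edge entering a vertex. -/
noncomputable def inPos (t : ℕ) : ℕ :=
  if L t % 2 = 1 then
    if trn t then
      if s (L t / 2) then (if trn (t + 1) then T (L t + 1) else T (2 * eo (L t / 2)))
      else if trn (T (L t - 1) - 1) then T (2 * eo (L t / 2 - 1)) else T (L t - 1) - 1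
    else t - 1
  else if trn t then
    (if L t / 2 = M ∨ 0 < L t / 2 ∧ (s (L t / 2) ∨ trn (t - 1)) then t - 1 else t)
  else t

open Classical in
/-- A function that increases along all edges. -/
noncomputable def keyPos (t : ℕ) : ℤ ×ₗ ℤ ×ₗ ℤ :=
  if L t % 2 = 1 then
    if trn t then
      if s (L t / 2) then
        -- A positive source joined to its sink `t + 1` by an isolated edge is visited immediately
        -- before that sink, whose last coordinate is `-2 * (t + 1)`.
        if L t / 2 + 1 < M ∧ ¬ s (L t / 2 + 1) ∧ trn (t + 1) then
          lexKey (-((L t / 2 : ℕ) + 1)) ((L t / 2 : ℕ) + 2) (-2 * (t + 1) - 1)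
        else lexKey (-((L t / 2 : ℕ) + 1)) ((L t / 2 : ℕ) + 1) t
      else lexKey (-c (L t / 2 + 1)) ((L t / 2 : ℕ) + 1) (-2 * t)
    else lexKey (-c (L t / 2 + 1)) ((L t / 2 : ℕ) + 1) (2 * t)
  else if trn t then lexKey (-c (L t / 2)) ((L t / 2 : ℕ) + 1) (-2 * t)
  -- The arm above a positive source closes its block; `M + 2` exceeds every other second
  -- coordinate.
  else if s (L t / 2) then lexKey (-((L t / 2 : ℕ) + 1)) (M + 2) (-2 * t)
  else lexKey (-c (L t / 2 + 1)) ((L t / 2 : ℕ) + 1) (-2 * t)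

end

/-- The edge with the given tail and head, and the original one, increase `key`; `out` and `inn`
recover the edge. -/
def EdgeOK {K : Type*} [LT K] (n : ℕ) (L : ℕ → ℕ) (out inn : ℕ → ℕ) (key : ℕ → K)
    (i a b : ℕ) : Prop :=
  (1 ≤ a ∧ a ≤ n) ∧ (1 ≤ b ∧ b ≤ n) ∧ out a = i ∧ inn b = i ∧ key a < key b ∧
    key (tail L i) < key (head L i)

/-- The chain within a block: from its positive source down the arm below; across to the next
negative source, up the arm above that source into the preceding sink, then down the arm below the
source, and so on through the negative run; from the last sink of the block to the arm above the
positive source; and from there into the previous block. The first coordinate `-c` of the key orders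
the blocks backwards, the second orders the pieces of a block, the third the vertices of a piece. An
isolated edge below the positive source of a block with a negative run cannot change; the block is
then entered at its first negative source instead. -/
theorem edge_pos (Z : Zigzag n M L T trn s) {c eo : ℕ → ℕ} (C : LastPos M s c eo) (s0 : s 0)
    {i : ℕ} (h1 : 1 ≤ i) (hn : i < n) :
    EdgeOK n L (outPos M L T trn s c) (inPos M L T trn s eo) (keyPos M L trn s c) i
      (tailPos L T trn s eo i) (headPos M L T trn s c i) := by
  classical
  have hL := Z.L_lt h1 hn
  have hL1 := Z.L_one_le h1 hn.le
  have e1 : ∀ w, (2 * w + 1) % 2 = 1 := by omega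
  have e2 : ∀ w, (2 * w + 1) / 2 = w := by omega
  have e5 : ∀ w, 2 * w + 1 + 1 = 2 * (w + 1) := by omega
  have e7 : ∀ w, 2 * w + 1 + 2 = 2 * (w + 1) + 1 := by omega
  rcases Nat.even_or_odd' (L i) with ⟨w, hw | hw⟩
  · have et : tail L i = i + 1 := by simp [tail, hw]
    have eh : head L i = i := by simp [head, hw]
    have cw := C.mono (Nat.le_succ w)
    have cw' := C.le w
    by_cases ti : trn i <;> by_cases tj : trn (i + 1)
    · have Lj := Z.L_succ_trn i h1 hn tj
      rw [hw] at Lj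
      have ns := Z.iso_above i w tj Lj ti
      have nb := Z.iso_B i w ti hw tj
      have := C.neg w ns
      have Tw : T (2 * w) = i := by rw [← hw]; exact Z.T_L i ti
      have Tw' : T (2 * w + 1) = i + 1 := by rw [← Lj]; exact Z.T_L _ tj
      simp [EdgeOK, tailPos, headPos, outPos, inPos, keyPos, et, eh, hw, Lj, e1, e2,
        ti, tj, ns, nb, lexKey_lt, Tw', this]
      omega
    · have Lj := Z.L_succ_not i h1 hn tj
      rw [hw] at Lj
      have Tw : T (2 * w) = i := by rw [← hw]; exact Z.T_L i ti
      have hwM : w < M := by omega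
      by_cases hc : 0 < w ∧ (s w ∨ trn (i - 1))
      · by_cases hs : s (w - 1)
        · have h3 : 2 * w - 1 = 2 * (w - 1) + 1 := by omega
          have tA := Z.trn_T (2 * (w - 1) + 1) (by have := Z.L_one; omega) (by omega)
          have LA := Z.L_T (2 * (w - 1) + 1) (by have := Z.L_one; omega) (by omega)
          have rA := Z.range _ tA
          have hlt := Z.T_lt (k := 2 * (w - 1) + 1) (l := 2 * w) (by have := Z.L_one; omega)
            (by omega) (by omega)
          have c1 := C.pos (w - 1) hs
          have c2 := C.neg w
          have c3 := C.pos w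
          have c4 : s w → c (w + 1) = w + 1 := C.pos w
          have h4 : w - 1 + 1 = w := by omega
          have e8 : s w → eo (w - 1) = w := fun h => C.eo_unique (by omega) hs (by rw [← c1, h4])
            (by omega) (fun _ => h)
          -- The head at the sink `i` moves either because the next source is positive or because `i
          -- - 1` is the preceding source; the latter would be an isolated edge below that source.
          have h5 : ¬ trn (T (2 * (w - 1) + 1) + 1) → s w := by
            intro h
            rcases hc.2 with h' | h'
            · exact h'
            · exfalso
              apply h
              have : L (i - 1 + 1) = L (i - 1) + 1 := Z.L_succ_trn (i - 1)
                (by have := Z.range _ h'; omega) (by omega) (by rwa [Nat.sub_add_cancel h1])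
              rw [Nat.sub_add_cancel h1, hw] at this
              have h6 := Z.T_L _ h'
              rw [show L (i - 1) = 2 * (w - 1) + 1 by omega] at h6
              rw [h6, Nat.sub_add_cancel h1]
              exact ti
          rw [h4] at c1
          have hb : headPos M L T trn s c i = T (2 * (w - 1) + 1) := by
            simp [headPos, hw, ti, hc, below, hs, h3]
          have h6 : 2 * (w - 1) + 1 + 1 = 2 * w := by omega
          have hin : inPos M L T trn s eo (T (2 * (w - 1) + 1)) = i := by
            simp only [inPos, LA, e1, if_true, tA, e2, hs, h6, Tw]
            split_ifs with h
            · rfl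
            · rw [e8 (h5 h), Tw]
          rw [EdgeOK, hb, et, eh, hin]
          have h7 : w - 1 + 1 < M ∧ ¬ s (w - 1 + 1) ∧ trn (T (2 * (w - 1) + 1) + 1) → ¬ s w := by
            rw [h4]; tauto
          by_cases hsw : s w
          · have h9 : ¬ (w - 1 + 1 < M ∧ ¬ s (w - 1 + 1) ∧ trn (T (2 * (w - 1) + 1) + 1)) :=
              fun h => h7 h hsw
            simp [tailPos, outPos, keyPos, hw, Lj, e1, e2, ti, tj, hs, lexKey_lt, LA, tA, hsw, c4,
              h9, c1]
            omega
          -- The isolated case, where the key of the new head has its exceptional form; `h11`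
          -- identifies the vertex after the source with the sink `i`.
          · have h9 : w - 1 + 1 < M ∧ ¬ s (w - 1 + 1) ∧ trn (T (2 * (w - 1) + 1) + 1) := by
              rw [h4]
              exact ⟨hwM, hsw, by_contra fun h => hsw (h5 h)⟩
            have h10 := Z.L_succ_trn _ rA.1 (by omega) h9.2.2
            rw [LA, h6] at h10
            have h11 := Z.T_L _ h9.2.2
            rw [h10, Tw] at h11
            simp [tailPos, outPos, keyPos, hw, Lj, e1, e2, ti, tj, hs, lexKey_lt, LA, tA, hsw, c2,
              h9, c1]
            omega
        -- If `i - 1` were a turning point, its isolated edge would make the source before `i`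
        -- positive.
        · have hsw : s w := by
            rcases hc.2 with h' | h'
            · exact h'
            · exfalso
              have : L (i - 1 + 1) = L (i - 1) + 1 := Z.L_succ_trn (i - 1)
                (by have := Z.range _ h'; omega) (by omega) (by rwa [Nat.sub_add_cancel h1])
              rw [Nat.sub_add_cancel h1, hw] at this
              exact hs (Z.iso_below (i - 1) (w - 1) h' (by omega) (by rwa [Nat.sub_add_cancel h1]))
          have c1 := C.pos w hsw
          have c2 := C.neg (w - 1) hs
          -- Only here is the initial sign needed: an earlier positive source exists.
          have c3 : 0 < c w := by
            have := C.mono (show 1 ≤ w by omega)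
            have h : c 1 = 1 := C.pos 0 s0
            omega
          have sc := C.s_pred c3
          have hcw : c w < w := by
            rw [show w - 1 + 1 = w by omega] at c2
            have := C.le (w - 1)
            omega
          have e8 : eo (c w - 1) = w := C.eo_unique (by omega) sc (by omega) (by omega)
            (fun _ => hsw)
          have h3 : 2 * c w - 1 = 2 * (c w - 1) + 1 := by omega
          have tA := Z.trn_T (2 * (c w - 1) + 1) (by have := Z.L_one; omega) (by omega)
          have LA := Z.L_T (2 * (c w - 1) + 1) (by have := Z.L_one; omega) (by omega)
          have rA := Z.range _ tA
          by_cases hiso : trn (T (2 * (c w - 1) + 1) + 1)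
          · have hb : headPos M L T trn s c i = T (2 * c w + 1) := by
              simp [headPos, hw, ti, hc, below, hs, h3, hiso, mul_add]
            have h10 := Z.L_succ_trn _ rA.1 (by have := Z.range _ hiso; omega) hiso
            have h11 := Z.T_L _ hiso
            rw [h10, LA, show 2 * (c w - 1) + 1 + 1 = 2 * c w by omega] at h11
            have tA' := Z.trn_T (2 * c w + 1) (by have := Z.L_one; omega) (by omega)
            have LA' := Z.L_T (2 * c w + 1) (by have := Z.L_one; omega) (by omega)
            have rA' := Z.range _ tA'
            have ns := C.not_s le_rfl hcw
            have c4 := C.neg _ ns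
            rw [C.c_c] at c4
            have hlt := Z.T_lt (k := 2 * c w + 1) (l := 2 * w) (by have := Z.L_one; omega)
              (by omega) (by omega)
            have hin : inPos M L T trn s eo (T (2 * c w + 1)) = i := by
              simp [inPos, LA', e1, tA', e2, ns, h11, tA, e8, Tw]
            rw [EdgeOK, hb, et, eh, hin]
            simp [tailPos, outPos, keyPos, hw, Lj, e1, e2, ti, tj, hs, lexKey_lt, LA', tA', hsw, ns,
              c1, c4]
            omega
          · have hb : headPos M L T trn s c i = T (2 * (c w - 1) + 1) := by
              simp [headPos, hw, ti, hc, below, hs, h3, hiso]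
            have hin : inPos M L T trn s eo (T (2 * (c w - 1) + 1)) = i := by
              simp [inPos, LA, e1, tA, e2, sc, hiso, e8, Tw]
            rw [EdgeOK, hb, et, eh, hin]
            simp [tailPos, outPos, keyPos, hw, Lj, e1, e2, ti, tj, hs, lexKey_lt, LA, tA, hsw, sc,
              c1, hiso]
            omega
      · have h3 : ¬ (w = M ∨ 0 < w ∧ (s w ∨ trn (i - 1))) := by
          rintro (h | h)
          · omega
          · exact hc h
        by_cases hs : s w
        · have c1 := C.pos w hs
          have : w = 0 := by
            by_contra h0
            exact hc ⟨by omega, Or.inl hs⟩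
          subst this
          simp [EdgeOK, tailPos, headPos, outPos, inPos, keyPos, et, eh, hw, Lj,
            ti, tj, lexKey_lt, C.zero, hs]
          omega
        · have c1 := C.neg w hs
          have hc' : ¬ (0 < w ∧ trn (i - 1)) := by tauto
          have h3' : ¬ (w = M ∨ 0 < w ∧ trn (i - 1)) := by tauto
          simp [EdgeOK, tailPos, headPos, outPos, inPos, keyPos, et, eh, hw, Lj,
            ti, tj, hc', h3', hs, lexKey_lt, c1]
          omega
    · have Lj := Z.L_succ_trn i h1 hn tj
      rw [hw] at Lj
      have Tw : T (2 * w + 1) = i + 1 := by rw [← Lj]; exact Z.T_L _ tj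
      by_cases hs : s w
      · obtain ⟨h3, h4, h5, h6⟩ := C.eo_spec w (by omega) hs
        have tB := Z.trn_T (2 * eo w) (by omega) (by omega)
        have LB := Z.L_T (2 * eo w) (by omega) (by omega)
        have rB := Z.range _ tB
        have hlt := Z.T_lt (k := 2 * w + 1) (l := 2 * eo w) (by omega) (by omega) (by omega)
        have h7 : ¬ (eo w < M ∧ ¬ s (eo w)) := by tauto
        have h8 : 2 * (w + 1) - 1 = 2 * w + 1 := by omega
        simp [EdgeOK, tailPos, headPos, outPos, inPos, keyPos, et, eh, hw, Lj, e1, e2,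
          ti, tj, hs, lexKey_lt, Tw, tB, LB, h7, h5, h8]
        refine ⟨by omega, by omega, by omega, ?_⟩
        split_ifs <;> simp only [lexKey_lt, true_and] <;> omega
      · have := C.neg w hs
        simp [EdgeOK, tailPos, headPos, outPos, inPos, keyPos, et, eh, hw, Lj, e1, e2,
          ti, tj, hs, lexKey_lt, this]
        omega
    · have Lj := Z.L_succ_not i h1 hn tj
      rw [hw] at Lj
      by_cases hs : s w <;>
      simp [EdgeOK, tailPos, headPos, outPos, inPos, keyPos, et, eh, hw, Lj,
          ti, tj, hs, lexKey_lt] <;>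
      omega
  · have et : tail L i = i := by simp [tail, hw]
    have eh : head L i = i + 1 := by simp [head, hw]
    have cw := C.mono (Nat.le_succ (w + 1))
    have cw' := C.le (w + 1)
    by_cases ti : trn i <;> by_cases tj : trn (i + 1)
    · have Lj := Z.L_succ_trn i h1 hn tj
      rw [hw, e5] at Lj
      have hs := Z.iso_below i w ti hw tj
      have c1 := C.pos w hs
      have Tw' : T (2 * (w + 1)) = i + 1 := by rw [← Lj]; exact Z.T_L _ tj
      by_cases hM : w + 1 < M ∧ ¬ s (w + 1)
      · simp [EdgeOK, tailPos, headPos, outPos, inPos, keyPos, et, eh, hw, Lj, e1, e2,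
          ti, tj, hs, lexKey_lt, c1, hM]
        omega
      · have hM' : ¬ (w + 1 < M ∧ ¬ s (w + 1) ∧ trn (i + 1)) := by tauto
        simp [EdgeOK, tailPos, headPos, outPos, inPos, keyPos, et, eh, hw, Lj, e1, e2,
          ti, tj, hs, c1]
        split_ifs <;> simp only [lexKey_lt, true_and] <;> omega
    · have Lj := Z.L_succ_not i h1 hn tj
      rw [hw] at Lj
      by_cases hs : s w
      · have c1 := C.pos w hs
        simp [EdgeOK, tailPos, headPos, outPos, inPos, keyPos, et, eh, hw, Lj, e1, e2,
          ti, tj, hs, lexKey_lt, c1]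
        omega
      · have c1 := C.neg w hs
        have hw0 : w ≠ 0 := by rintro rfl; exact hs s0
        have tB := Z.trn_T (2 * w) (by have := Z.L_one; omega) (by omega)
        have LB := Z.L_T (2 * w) (by have := Z.L_one; omega) (by omega)
        have rB := Z.range _ tB
        have Tw : T (2 * w + 1) = i := by rw [← hw]; exact Z.T_L _ ti
        have hwM : w < M := by omega
        simp [EdgeOK, tailPos, headPos, outPos, inPos, keyPos, et, eh, hw, Lj, e1, e2,
          ti, tj, hs, lexKey_lt, c1, tB, LB, Tw, hwM]
        omega
    · have Lj := Z.L_succ_trn i h1 hn tj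
      rw [hw, e5] at Lj
      have Tw' : T (2 * (w + 1)) = i + 1 := by rw [← Lj]; exact Z.T_L _ tj
      by_cases hM : w + 1 < M ∧ ¬ s (w + 1)
      · have c1 := C.neg (w + 1) hM.2
        have tA := Z.trn_T (2 * (w + 1) + 1) (by omega) (by omega)
        have LA := Z.L_T (2 * (w + 1) + 1) (by omega) (by omega)
        have rA := Z.range _ tA
        have hlt := Z.T_lt (k := 2 * (w + 1)) (l := 2 * (w + 1) + 1) (by omega) (by omega) (by omega)
        simp [EdgeOK, tailPos, headPos, outPos, inPos, keyPos, et, eh, hw, Lj, e1, e2, e7,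
          ti, tj, lexKey_lt, hM, tA, LA, Tw', c1]
        omega
      · have hM' : ¬ (L i / 2 + 1 < M ∧ ¬ s (L i / 2 + 1)) := by rwa [hw, e2]
        have h3 : w + 1 = M ∨ s (w + 1) := by
          by_cases h : s (w + 1)
          · exact Or.inr h
          · have : ¬ (w + 1 < M) := fun h' => hM ⟨h', h⟩
            left; omega
        simp [EdgeOK, tailPos, headPos, outPos, inPos, keyPos, et, eh, hw, Lj, e1, e2,
          ti, tj, lexKey_lt, hM, h3]
        omega
    · have Lj := Z.L_succ_not i h1 hn tj
      rw [hw] at Lj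
      simp [EdgeOK, tailPos, headPos, outPos, inPos, keyPos, et, eh, hw, Lj, e1, e2,
        ti, tj, lexKey_lt]
      omega
end Zigzag
end Meander

/-! ### The new chain for an initially negative signature. -/

namespace Meander
set_option linter.unusedSimpArgs false
namespace Zigzag
variable {n M : ℕ} {L T : ℕ → ℕ} {trn s : ℕ → Prop}

/-- `d w` is one more than the index of the first negative source from `w` on, and `M + 1` if there
is none; `so` goes back to the first index with the same value of `d`. -/
structure NextNeg (M : ℕ) (s : ℕ → Prop) (d so : ℕ → ℕ) : Prop where
  last : d M = M + 1
  neg : ∀ w, w < M → ¬ s w → d w = w + 1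
  pos : ∀ w, w < M → s w → d w = d (w + 1)
  so_spec : ∀ w, w ≤ M → (w < M → ¬ s w) →
    so w ≤ w ∧ d (so w) = w + 1 ∧ (0 < so w → ¬ s (so w - 1))

namespace NextNeg
variable {d so : ℕ → ℕ}

theorem bounds (C : NextNeg M s d so) {w : ℕ} (h : w ≤ M) : w + 1 ≤ d w ∧ d w ≤ M + 1 := by
  induction h using Nat.decreasingInduction with
  | self => rw [C.last]; omega
  | of_succ w h ih =>
    by_cases hs : s w
    · rw [C.pos w h hs]; omega
    · rw [C.neg w h hs]; omega

theorem mono (C : NextNeg M s d so) {u w : ℕ} (h : u ≤ w) (hw : w ≤ M) : d u ≤ d w := by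
  induction w, h using Nat.le_induction with
  | base => exact le_rfl
  | succ w _ ih =>
    have := ih (by omega)
    by_cases hs : s w
    · rw [← C.pos w (by omega) hs]; omega
    · rw [C.neg w (by omega) hs] at this
      have := (C.bounds (w := w + 1) (by omega)).1
      omega

theorem s_of_lt (C : NextNeg M s d so) {u w : ℕ} (h1 : w ≤ u) (h2 : u + 1 < d w) (hu : u < M) :
    s u := by
  by_contra h
  have := C.mono h1 hu.le
  rw [C.neg u hu h] at this
  omega

theorem d_eq (C : NextNeg M s d so) {u w : ℕ} (h1 : w ≤ u) (h2 : u + 1 ≤ d w) (hu : u ≤ M) :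
    d u = d w := by
  induction u, h1 using Nat.le_induction with
  | base => rfl
  | succ u h ih =>
    have h3 := ih (by omega) (by omega)
    rw [← C.pos u (by omega) (C.s_of_lt h (by omega) (by omega)), h3]

/-- The function `d` is constant up to the index `d w - 1`; a positive source there would push its
value further. -/
theorem not_s (C : NextNeg M s d so) {w : ℕ} (h : w ≤ M) (h' : d w ≤ M) : ¬ s (d w - 1) := by
  have h1 := C.bounds h
  intro hs
  have h2 := C.pos _ (by omega) hs
  have h3 := C.d_eq (show w ≤ d w - 1 by omega) (by omega) (by omega)
  have h4 := (C.bounds (show d w - 1 + 1 ≤ M by omega)).1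
  omega

/-- The counterpart of `LastPos.eo_unique`. The index `w = M` acts as a virtual negative source, so
that a final positive run is a block as well. -/
theorem so_unique (C : NextNeg M s d so) {u w : ℕ} (hw : w ≤ M) (hs : w < M → ¬ s w) (hu : u ≤ M)
    (h : d u = w + 1) (hu' : 0 < u → ¬ s (u - 1)) : so w = u := by
  obtain ⟨h1, h2, h3⟩ := C.so_spec w hw hs
  have hb := C.bounds hu
  rcases lt_trichotomy (so w) u with hlt | heq | hlt
  · exact absurd (C.s_of_lt (show so w ≤ u - 1 by omega) (by omega) (by omega)) (hu' (by omega))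
  · exact heq
  · exact absurd (C.s_of_lt (show u ≤ so w - 1 by omega) (by omega) (by omega)) (h3 (by omega))

end NextNeg

section
variable (n M : ℕ) (L T : ℕ → ℕ) (trn s : ℕ → Prop) (d so : ℕ → ℕ)

open Classical in
/-- The tail of the changed edge, initially negative signature. -/
noncomputable def tailNeg (i : ℕ) : ℕ :=
  if L i % 2 = 1 then (if trn i ∧ ¬ s (L i / 2) then T (2 * so (L i / 2)) else i)
  else if trn (i + 1) ∧ s (L i / 2) then T (L i + 2) else i + 1

open Classical in
/-- The index of the source that is the head of a changed edge above the sink with label `2 * w`. -/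
noncomputable def above (w : ℕ) : ℕ :=
  if ¬ s w then w + 1 else if d w = M + 1 ∨ trn (T (2 * d w - 1) - 1) then d w - 1 else d w

open Classical in
/-- The head of the changed edge, initially negative signature. -/
noncomputable def headNeg (i : ℕ) : ℕ :=
  if L i % 2 = 1 then
    (if trn (i + 1) ∧ L i / 2 + 1 < M ∧ (¬ s (L i / 2) ∨ trn (i + 2)) then
      T (2 * above M T trn s d (L i / 2 + 1) - 1) else i + 1)
  else if trn i ∧ 0 < L i / 2 ∧ s (L i / 2 - 1) ∧ ¬ trn (i + 1) then T (L i - 1) else i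

open Classical in
/-- The edge leaving a vertex. -/
noncomputable def outNeg (t : ℕ) : ℕ :=
  if L t % 2 = 1 then (if trn t ∧ ¬ s (L t / 2) then t - 1 else t)
  else if trn t then
    (if 0 < L t / 2 ∧ s (L t / 2 - 1) then T (L t - 1) - 1 else T (2 * d (L t / 2) - 1))
  else t - 1

open Classical in
/-- The edge entering a vertex. -/
noncomputable def inNeg (t : ℕ) : ℕ :=
  if L t % 2 = 1 then
    if trn t then
      if s (L t / 2) then
        (if L t / 2 + 1 < M ∧ ¬ trn (T (L t + 1) + 1) then T (L t + 1)
          else T (2 * so (d (L t / 2) - 1)) - 1)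
      else if trn (t - 1) then T (L t - 1) - 1 else T (2 * so (L t / 2)) - 1
    else t - 1
  else if trn t then
    (if L t / 2 = M ∨ 0 < L t / 2 ∧ s (L t / 2 - 1) ∧ ¬ trn (t + 1) then t - 1 else t)
  else t

open Classical in
/-- A function that increases along all edges. -/
noncomputable def keyNeg (t : ℕ) : ℤ ×ₗ ℤ ×ₗ ℤ :=
  if L t % 2 = 1 then
    -- The shift by `4 * n` makes the last coordinate negative here and at sinks, and positive in
    -- the forms with `4 * n - 2 * t`: an arm below a positive source and its sink precede the arm
    -- above that source.
    if s (L t / 2) then lexKey (d (L t / 2)) (-((L t / 2 : ℕ) + 1)) (2 * t - 4 * n)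
    else if trn t then
      if 0 < L t / 2 ∧ s (L t / 2 - 1) ∧ trn (t - 1) then
        -- One less than the last coordinate `2 * (t - 1) - 4 * n` of the adjacent sink.
        lexKey ((L t / 2 : ℕ) + 1) (-(L t / 2 : ℕ)) (2 * t - 3 - 4 * n)
      else lexKey ((L t / 2 : ℕ) + 1) (-((L t / 2 : ℕ) + 1)) (4 * n - 2 * t)
    else lexKey ((L t / 2 : ℕ) + 1) 1 (2 * t)
  else if trn t then lexKey (d (L t / 2)) (-(L t / 2 : ℕ)) (2 * t - 4 * n)
  else lexKey (d (L t / 2)) (-((L t / 2 : ℕ) + 1)) (4 * n - 2 * t)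

end

/-- Mirror image of `edge_pos`. A block starts at its negative source and goes up the arm above it
to the preceding positive source; then down the arm below that source to its sink, up the arm above
it, and on to the positive source before. The sink in front of the positive run leads to the arm
below the negative source and so to the next block. Blocks are ordered by `d`. An isolated edge
above the negative source changes the entry to the last positive source; so does the absence of a
further negative source. -/
theorem edge_neg (Z : Zigzag n M L T trn s) {d so : ℕ → ℕ} (C : NextNeg M s d so) (L0 : L 1 = 0)
    {i : ℕ} (h1 : 1 ≤ i) (hn : i < n) :
    EdgeOK n L (outNeg L T trn s d) (inNeg M L T trn s d so) (keyNeg n L trn s d) i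
      (tailNeg L T trn s so i) (headNeg M L T trn s d i) := by
  classical
  have hL := Z.L_lt h1 hn
  have e1 : ∀ w, (2 * w + 1) % 2 = 1 := by omega
  have e2 : ∀ w, (2 * w + 1) / 2 = w := by omega
  have e5 : ∀ w, 2 * w + 1 + 1 = 2 * (w + 1) := by omega
  have e7 : ∀ w, 2 * w + 2 = 2 * (w + 1) := by omega
  rcases Nat.even_or_odd' (L i) with ⟨w, hw | hw⟩
  · have et : tail L i = i + 1 := by simp [tail, hw]
    have eh : head L i = i := by simp [head, hw]
    have hwM : w < M := by omega
    by_cases ti : trn i <;> by_cases tj : trn (i + 1)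
    · have Lj := Z.L_succ_trn i h1 hn tj
      rw [hw] at Lj
      have ns := Z.iso_above i w tj Lj ti
      have c1 := C.neg w hwM ns
      by_cases hc : 0 < w ∧ s (w - 1)
      · simp [EdgeOK, tailNeg, headNeg, outNeg, inNeg, keyNeg, et, eh, hw, Lj, e1, e2,
          ti, tj, ns, lexKey_lt, c1, hc]
        omega
      · have hc' : ¬ (0 < w ∧ s (w - 1) ∧ trn i) := by tauto
        simp [EdgeOK, tailNeg, headNeg, outNeg, inNeg, keyNeg, et, eh, hw, Lj, e1, e2,
          ti, tj, ns, lexKey_lt, c1, hc]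
        omega
    · have Lj := Z.L_succ_not i h1 hn tj
      rw [hw] at Lj
      have Tw : T (2 * w) = i := by rw [← hw]; exact Z.T_L i ti
      by_cases hc : 0 < w ∧ s (w - 1)
      · have h3 : 2 * w - 1 = 2 * (w - 1) + 1 := by omega
        have h4 : w - 1 + 1 = w := by omega
        have tA := Z.trn_T (2 * (w - 1) + 1) (by omega) (by omega)
        have LA := Z.L_T (2 * (w - 1) + 1) (by omega) (by omega)
        have rA := Z.range _ tA
        have hlt := Z.T_lt (k := 2 * (w - 1) + 1) (l := 2 * w) (by omega) (by omega) (by omega)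
        have c1 := C.pos (w - 1) (by omega) hc.2
        rw [h4] at c1
        have h6 : 2 * (w - 1) + 1 + 1 = 2 * w := by omega
        simp [EdgeOK, tailNeg, headNeg, outNeg, inNeg, keyNeg, et, eh, hw, Lj, e1, e2,
          ti, tj, lexKey_lt, c1, hc, h3, tA, LA, h4, hwM, h6, Tw]
        omega
      · have hc' : ¬ (w = M ∨ 0 < w ∧ s (w - 1)) := by
          rintro (h | h)
          · omega
          · exact hc h
        simp [EdgeOK, tailNeg, headNeg, outNeg, inNeg, keyNeg, et, eh, hw, Lj, e1, e2,
          ti, tj, lexKey_lt, hc, hc']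
        omega
    · have Lj := Z.L_succ_trn i h1 hn tj
      rw [hw] at Lj
      have Tw : T (2 * w + 1) = i + 1 := by rw [← Lj]; exact Z.T_L _ tj
      by_cases hs : s w
      · have tB := Z.trn_T (2 * (w + 1)) (by omega) (by omega)
        have LB := Z.L_T (2 * (w + 1)) (by omega) (by omega)
        have rB := Z.range _ tB
        have hlt := Z.T_lt (k := 2 * w + 1) (l := 2 * (w + 1)) (by omega) (by omega) (by omega)
        have c1 := C.pos w hwM hs
        have h8 : 2 * (w + 1) - 1 = 2 * w + 1 := by omega
        simp [EdgeOK, tailNeg, headNeg, outNeg, inNeg, keyNeg, et, eh, hw, Lj, e1, e2, e7,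
          ti, tj, hs, lexKey_lt, Tw, tB, LB, h8, c1]
        omega
      · have c1 := C.neg w hwM hs
        simp [EdgeOK, tailNeg, headNeg, outNeg, inNeg, keyNeg, et, eh, hw, Lj, e1, e2,
          ti, tj, hs, lexKey_lt, c1]
        omega
    · have Lj := Z.L_succ_not i h1 hn tj
      rw [hw] at Lj
      simp [EdgeOK, tailNeg, headNeg, outNeg, inNeg, keyNeg, et, eh, hw, Lj,
          ti, tj, lexKey_lt]
      omega
  · have et : tail L i = i := by simp [tail, hw]
    have eh : head L i = i + 1 := by simp [head, hw]
    have hwM : w < M := by omega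
    have cb := C.bounds (show w + 1 ≤ M by omega)
    by_cases ti : trn i <;> by_cases tj : trn (i + 1)
    · have Lj := Z.L_succ_trn i h1 hn tj
      rw [hw, e5] at Lj
      have hs := Z.iso_below i w ti hw tj
      have c1 := C.pos w hwM hs
      have nb : ¬ trn (i + 2) := fun h => Z.iso_B (i + 1) (w + 1) tj Lj h ti
      simp [EdgeOK, tailNeg, headNeg, outNeg, inNeg, keyNeg, et, eh, hw, Lj, e1, e2,
        ti, tj, hs, lexKey_lt, c1, nb]
      omega
    · have Lj := Z.L_succ_not i h1 hn tj
      rw [hw] at Lj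
      by_cases hs : s w
      · simp [EdgeOK, tailNeg, headNeg, outNeg, inNeg, keyNeg, et, eh, hw, Lj, e1, e2,
          ti, tj, hs, lexKey_lt]
        omega
      · have c1 := C.neg w hwM hs
        obtain ⟨h3, h4, h5⟩ := C.so_spec w hwM.le (fun _ => hs)
        have tB := Z.trn_T (2 * so w) (by omega) (by omega)
        have LB := Z.L_T (2 * so w) (by omega) (by omega)
        have rB := Z.range _ tB
        have Tw : T (2 * w + 1) = i := by rw [← hw]; exact Z.T_L _ ti
        have h6 : ¬ (0 < so w ∧ s (so w - 1)) := by tauto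
        have h8 : 2 * (w + 1) - 1 = 2 * w + 1 := by omega
        simp [EdgeOK, tailNeg, headNeg, outNeg, inNeg, keyNeg, et, eh, hw, Lj, e1, e2,
          ti, tj, hs, c1, tB, LB, Tw, h6, h4, h8]
        split_ifs <;> simp only [lexKey_lt, true_and] <;> omega
    · have Lj := Z.L_succ_trn i h1 hn tj
      rw [hw, e5] at Lj
      have Tw' : T (2 * (w + 1)) = i + 1 := by rw [← Lj]; exact Z.T_L _ tj
      by_cases hM : w + 1 < M ∧ (¬ s w ∨ trn (i + 2))
      · by_cases hs' : s (w + 1)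
        · have nt : ¬ trn (i + 2) := fun h => by
            have := Z.L_succ_trn (i + 1) (by omega) (by have := Z.range _ h; omega) h
            exact Z.iso_above (i + 1) (w + 1) h (by omega) tj hs'
          have hs : ¬ s w := by tauto
          have c1 := C.neg w hwM hs
          have c2 := C.pos _ hM.1 hs'
          have cb2 := C.bounds (show w + 1 + 1 ≤ M by omega)
          -- The source `w` is negative, so the positive run starts at `w + 1`.
          have hso : so (d (w + 1) - 1) = w + 1 := by
            apply C.so_unique (by omega) _ (by omega) (by omega)
            · intro _; simpa using hs
            · intro h
              exact C.not_s (w := w + 1) (by omega) (by omega)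
          by_cases hd : d (w + 1) = M + 1 ∨ trn (T (2 * d (w + 1) - 1) - 1)
          · have h3 : 2 * (d (w + 1) - 1) - 1 = 2 * (d (w + 1) - 2) + 1 := by omega
            have tA := Z.trn_T (2 * (d (w + 1) - 2) + 1) (by omega) (by omega)
            have LA := Z.L_T (2 * (d (w + 1) - 2) + 1) (by omega) (by omega)
            have rA := Z.range _ tA
            have sA : s (d (w + 1) - 2) := C.s_of_lt (w := w + 1) (by omega) (by omega) (by omega)
            have dA := C.d_eq (w := w + 1) (u := d (w + 1) - 2) (by omega) (by omega) (by omega)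
            have hb : headNeg M L T trn s d i = T (2 * (d (w + 1) - 2) + 1) := by
              simp [headNeg, hw, e1, e2, tj, hM, above, hs', hd, h3]
            -- The entry vertex is the last source of its positive run. Unless the run is final, the
            -- sink after it is joined to the negative source by an isolated edge.
            have hi : ¬ (d (w + 1) - 2 + 1 < M ∧
                ¬ trn (T (2 * (d (w + 1) - 2) + 1 + 1) + 1)) := by
              rintro ⟨h4, h5⟩
              rcases hd with hd | hd
              · omega
              · have tC := Z.trn_T (2 * d (w + 1) - 1) (by omega) (by omega)
                have rC := Z.range _ tC
                have rD := Z.range _ hd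
                have h6 := Z.L_succ_trn (T (2 * d (w + 1) - 1) - 1) (by omega) (by omega)
                  (by rwa [Nat.sub_add_cancel rC.1])
                rw [Nat.sub_add_cancel rC.1, Z.L_T _ (by omega) (by omega)] at h6
                have h7 := Z.T_L _ hd
                rw [show L (T (2 * d (w + 1) - 1) - 1) = 2 * (d (w + 1) - 2) + 1 + 1 by omega] at h7
                rw [h7, Nat.sub_add_cancel rC.1] at h5
                exact h5 tC
            have hin : inNeg M L T trn s d so (T (2 * (d (w + 1) - 2) + 1)) = i := by
              simp only [inNeg, LA, e1, if_true, tA, e2, sA, hi, if_false, dA, hso, Tw']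
              omega
            rw [EdgeOK, hb, et, eh, hin]
            simp [tailNeg, outNeg, keyNeg, hw, Lj, e1, e2, ti, tj, hs, lexKey_lt, LA, sA, tA, dA]
            omega
          · have h3 : 2 * d (w + 1) - 1 = 2 * (d (w + 1) - 1) + 1 := by omega
            have hdM : d (w + 1) ≤ M := by
              by_contra h
              exact hd (Or.inl (by omega))
            have tA := Z.trn_T (2 * (d (w + 1) - 1) + 1) (by omega) (by omega)
            have LA := Z.L_T (2 * (d (w + 1) - 1) + 1) (by omega) (by omega)
            have rA := Z.range _ tA
            have sA : ¬ s (d (w + 1) - 1) := C.not_s (by omega) hdM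
            have hb : headNeg M L T trn s d i = T (2 * (d (w + 1) - 1) + 1) := by
              simp only [headNeg, hw, e1, e2, if_true, tj, hM, true_and, above, hs', hd, if_false,
                not_true]
              rw [h3]
            have hd' : ¬ trn (T (2 * (d (w + 1) - 1) + 1) - 1) := by rw [← h3]; tauto
            have hin : inNeg M L T trn s d so (T (2 * (d (w + 1) - 1) + 1)) = i := by
              simp only [inNeg, LA, e1, if_true, tA, e2, sA, if_false, hd', hso, Tw']
              omega
            rw [EdgeOK, hb, et, eh, hin]
            simp [tailNeg, outNeg, keyNeg, hw, Lj, e1, e2, ti, tj, hs, lexKey_lt, LA, sA, tA, hd']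
            omega
        · have c1 := C.neg (w + 1) hM.1 hs'
          have tA := Z.trn_T (2 * (w + 1) + 1) (by omega) (by omega)
          have LA := Z.L_T (2 * (w + 1) + 1) (by omega) (by omega)
          have rA := Z.range _ tA
          have hlt := Z.T_lt (k := 2 * (w + 1)) (l := 2 * (w + 1) + 1) (by omega) (by omega)
            (by omega)
          have hb : headNeg M L T trn s d i = T (2 * (w + 1) + 1) := by
            simp [headNeg, hw, e1, e2, tj, hM, above, hs', mul_add]
          have hso : ¬ trn (T (2 * (w + 1) + 1) - 1) → ¬ s w := by
            intro h h'
            have h3 : trn (i + 2) := by tauto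
            have h4 : L (i + 2) = L (i + 1) + 1 :=
              Z.L_succ_trn (i + 1) (by omega) (by have := Z.range _ h3; omega) h3
            have h5 := Z.T_L _ h3
            rw [show L (i + 2) = 2 * (w + 1) + 1 by omega] at h5
            rw [h5] at h
            exact h tj
          have hin : inNeg M L T trn s d so (T (2 * (w + 1) + 1)) = i := by
            simp only [inNeg, LA, e1, if_true, tA, e2, hs', if_false]
            split_ifs with h
            · simp [Tw']
            · rw [C.so_unique (w := w + 1) (u := w + 1) (by omega) (fun _ => hs') (by omega) c1
                (fun _ => hso h), Tw']
              omega
          rw [EdgeOK, hb, et, eh, hin]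
          by_cases hs : s w
          · have h3 : trn (T (2 * (w + 1) + 1) - 1) := by
              by_contra h; exact hso h hs
            have h4 : trn (i + 2) := by tauto
            have h6 : L (i + 2) = L (i + 1) + 1 :=
              Z.L_succ_trn (i + 1) (by omega) (by have := Z.range _ h4; omega) h4
            have h5 := Z.T_L _ h4
            rw [show L (i + 2) = 2 * (w + 1) + 1 by omega] at h5
            have c2 := C.pos w hwM hs
            simp [tailNeg, outNeg, keyNeg, hw, Lj, e1, e2, ti, tj, hs, lexKey_lt, LA, tA, hs', c1,
              c2, h3]
            omega
          · simp [tailNeg, outNeg, keyNeg, hw, Lj, e1, e2, ti, tj, hs, lexKey_lt, LA, tA, hs', c1]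
            omega
      · have h3 : w + 1 = M ∨ (s w ∧ ¬ trn (i + 2)) := by
          by_cases h : w + 1 < M
          · right; exact ⟨by tauto, by tauto⟩
          · left; omega
        have ht : tailNeg L T trn s so i = i := by simp [tailNeg, hw, e1, ti]
        have hh : headNeg M L T trn s d i = i + 1 := by simp [headNeg, hw, e1, e2, tj, hM]
        rw [EdgeOK, ht, hh, et, eh]
        by_cases hs : s w
        · have c2 := C.pos w hwM hs
          have h3' : ¬ trn (i + 1 + 1) ∨ w + 1 = M := by tauto
          simp [outNeg, inNeg, keyNeg, hw, Lj, e1, e2, ti, tj, lexKey_lt, hs, c2]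
          exact ⟨⟨h1, hn.le⟩, hn, fun h => h3'.resolve_right h⟩
        · have h3' : w + 1 = M := by tauto
          simp [outNeg, inNeg, keyNeg, hw, Lj, e1, e2, ti, tj, lexKey_lt, hs, h3', C.last]
          omega
    · have Lj := Z.L_succ_not i h1 hn tj
      rw [hw] at Lj
      by_cases hs : s w <;>
      · simp [EdgeOK, tailNeg, headNeg, outNeg, inNeg, keyNeg, et, eh, hw, Lj, e1, e2,
          ti, tj, lexKey_lt, hs]
        omega
end Zigzag
end Meander

namespace Meander

/-! ### Simple systems from increasing chains -/

section Chain

variable {n : ℕ} {φ : ℕ → ℕ} {a b : ℕ → ℕ} {K : Type*} [LinearOrder K] {h : ℕ → K}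

/-- The roots attached to the edges of a directed graph on the vertices `φ 1, …, φ n`. -/
def edgeRoots (n : ℕ) (φ a b : ℕ → ℕ) : Set (Fin n → ℝ) :=
  {v | ∃ i : ℕ, 1 ≤ i ∧ i < n ∧ v = eps n (φ (a i)) - eps n (φ (b i))}

/-- A directed graph on `{1, …, n}` with `n - 1` edges, at most one edge leaving and at most one
edge entering each vertex, and edges increasing for `h`. -/
structure IsChain (n : ℕ) (a b : ℕ → ℕ) (h : ℕ → K) : Prop where
  mem_a : ∀ i, 1 ≤ i → i < n → 1 ≤ a i ∧ a i ≤ n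
  mem_b : ∀ i, 1 ≤ i → i < n → 1 ≤ b i ∧ b i ≤ n
  inj_a : ∀ i j, 1 ≤ i → i < n → 1 ≤ j → j < n → a i = a j → i = j
  inj_b : ∀ i j, 1 ≤ i → i < n → 1 ≤ j → j < n → b i = b j → i = j
  lt : ∀ i, 1 ≤ i → i < n → h (a i) < h (b i)

namespace IsChain

/-- `t` is the head and `s` the tail of an edge. -/
def Step (n : ℕ) (a b : ℕ → ℕ) (s t : ℕ) : Prop := ∃ i, 1 ≤ i ∧ i < n ∧ a i = s ∧ b i = t

/-- The `n - 1` heads are distinct, so exactly one vertex is not a head. An unreachable vertex of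
minimal height would have a predecessor, unreachable as well and lower. -/
theorem exists_first (C : IsChain n a b h) (hn : 1 ≤ n) : ∃ m, 1 ≤ m ∧ m ≤ n ∧
    ∀ t, 1 ≤ t → t ≤ n → Relation.ReflTransGen (Step n a b) m t := by
  classical
  have hcard : ((Finset.Ico 1 n).image b).card = n - 1 := by
    rw [Finset.card_image_of_injOn, Nat.card_Ico]
    intro i hi j hj
    simp only [Finset.coe_Ico, Set.mem_Ico] at hi hj
    exact C.inj_b i j hi.1 hi.2 hj.1 hj.2
  have hsub : (Finset.Ico 1 n).image b ⊆ Finset.Icc 1 n := by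
    intro x hx
    obtain ⟨i, hi, rfl⟩ := Finset.mem_image.1 hx
    rw [Finset.mem_Ico] at hi
    exact Finset.mem_Icc.2 (C.mem_b i hi.1 hi.2)
  have hdiff : (Finset.Icc 1 n \ (Finset.Ico 1 n).image b).card = 1 := by
    rw [Finset.card_sdiff_of_subset hsub, hcard, Nat.card_Icc]; omega
  obtain ⟨m, hm⟩ := Finset.card_eq_one.1 hdiff
  have hm' : m ∈ Finset.Icc 1 n \ (Finset.Ico 1 n).image b := by rw [hm]; simp
  rw [Finset.mem_sdiff, Finset.mem_Icc] at hm'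
  refine ⟨m, hm'.1.1, hm'.1.2, ?_⟩
  by_contra hc
  push Not at hc
  obtain ⟨t0, ht0, ht0n, ht0'⟩ := hc
  obtain ⟨t, ht, hmin⟩ := Finset.exists_min_image
    ((Finset.Icc 1 n).filter fun t => ¬ Relation.ReflTransGen (Step n a b) m t) h
    ⟨t0, by simp [ht0, ht0n, ht0']⟩
  rw [Finset.mem_filter, Finset.mem_Icc] at ht
  have htm : t ≠ m := by rintro rfl; exact ht.2 .refl
  have htb : t ∈ (Finset.Ico 1 n).image b := by
    by_contra hb
    have : t ∈ Finset.Icc 1 n \ (Finset.Ico 1 n).image b := by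
      rw [Finset.mem_sdiff, Finset.mem_Icc]; exact ⟨ht.1, hb⟩
    rw [hm, Finset.mem_singleton] at this
    exact htm this
  obtain ⟨i, hi, rfl⟩ := Finset.mem_image.1 htb
  rw [Finset.mem_Ico] at hi
  have hlt := C.lt i hi.1 hi.2
  by_cases hr : Relation.ReflTransGen (Step n a b) m (a i)
  · exact ht.2 (hr.tail ⟨i, hi.1, hi.2, rfl, rfl⟩)
  · have := hmin (a i) (by
      rw [Finset.mem_filter, Finset.mem_Icc]; exact ⟨C.mem_a i hi.1 hi.2, hr⟩)
    exact absurd this (not_le.2 hlt)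

/-- Both vertices are reachable from the first one, and paths cannot branch since tails are
distinct. -/
theorem total (C : IsChain n a b h) {s t : ℕ} (hs : 1 ≤ s) (hsn : s ≤ n) (ht : 1 ≤ t)
    (htn : t ≤ n) :
    Relation.ReflTransGen (Step n a b) s t ∨ Relation.ReflTransGen (Step n a b) t s := by
  obtain ⟨m, -, -, hm⟩ := C.exists_first (hs.trans hsn)
  refine Relation.ReflTransGen.total_of_right_unique ?_ (hm s hs hsn) (hm t ht htn)
  rintro x y z ⟨i, hi, hin, rfl, rfl⟩ ⟨j, hj, hjn, hij, rfl⟩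
  rw [C.inj_a i j hi hin hj hjn hij.symm]

theorem eq_or_lt (C : IsChain n a b h) {s t : ℕ} (hst : Relation.ReflTransGen (Step n a b) s t) :
    s = t ∨ h s < h t := by
  induction hst with
  | refl => exact Or.inl rfl
  | tail _ hstep ih =>
    obtain ⟨i, hi, hin, rfl, rfl⟩ := hstep
    have := C.lt i hi hin
    rcases ih with rfl | ih
    · exact Or.inr this
    · exact Or.inr (ih.trans this)

theorem sub_mem_natSpan {s t : ℕ} (hst : Relation.ReflTransGen (Step n a b) s t) :
    eps n (φ s) - eps n (φ t) ∈ natSpan (edgeRoots n φ a b) := by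
  induction hst with
  | refl => rw [sub_self]; exact AddSubmonoid.zero_mem _
  | tail _ hstep ih =>
    obtain ⟨i, hi, hin, rfl, rfl⟩ := hstep
    rw [← sub_add_sub_cancel]
    exact AddSubmonoid.add_mem _ ih (AddSubmonoid.subset_closure ⟨i, hi, hin, rfl⟩)

/-- Any two vertices are joined by a directed path, and the height decides its direction; the edge
roots along it telescope. This is how original edges are shown to be positive. -/
theorem natSpan_of_lt (C : IsChain n a b h) {s t : ℕ} (hs : 1 ≤ s) (hsn : s ≤ n) (ht : 1 ≤ t)
    (htn : t ≤ n) (hst : h s < h t) :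
    eps n (φ s) - eps n (φ t) ∈ natSpan (edgeRoots n φ a b) := by
  rcases C.total hs hsn ht htn with h1 | h1
  · exact sub_mem_natSpan h1
  · rcases C.eq_or_lt h1 with rfl | h2
    · exact absurd hst (lt_irrefl _)
    · exact absurd hst (not_lt.2 h2.le)

/-- Together with the basis vector of the first vertex, the edge roots form a family of `n` vectors
spanning `ℝⁿ`. -/
theorem linearIndepOn (C : IsChain n a b h) (hn : 1 ≤ n)
    (hφ : Set.BijOn φ (Set.Icc 1 n) (Set.Icc 1 n)) :
    LinearIndepOn ℝ id (edgeRoots n φ a b) := by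
  obtain ⟨m, hm1, hmn, hm⟩ := C.exists_first hn
  set w : Fin n → (Fin n → ℝ) := fun j =>
    if j.val = 0 then eps n (φ m) else eps n (φ (a j)) - eps n (φ (b j)) with hw
  have hmem : ∀ v ∈ edgeRoots n φ a b, v ∈ Set.range w := by
    rintro v ⟨i, hi, hin, rfl⟩
    exact ⟨⟨i, hin⟩, by simp [hw, show i ≠ 0 by omega]⟩
  have hnat : ∀ v ∈ natSpan (edgeRoots n φ a b), v ∈ Submodule.span ℝ (Set.range w) := by
    intro v hv
    refine AddSubmonoid.closure_induction (fun x hx => Submodule.subset_span (hmem x hx))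
      (Submodule.zero_mem _) (fun x y _ _ => Submodule.add_mem _) hv
  have hE : ∀ t, 1 ≤ t → t ≤ n → eps n (φ t) ∈ Submodule.span ℝ (Set.range w) := by
    intro t ht htn
    have h1 := hnat _ (sub_mem_natSpan (φ := φ) (hm t ht htn))
    have h2 : eps n (φ m) ∈ Submodule.span ℝ (Set.range w) :=
      Submodule.subset_span ⟨⟨0, hn⟩, by simp [hw]⟩
    have := Submodule.sub_mem _ h2 h1
    rwa [sub_sub_cancel] at this
  have hli : LinearIndependent ℝ w := by
    apply linearIndependent_of_top_le_span_of_card_eq_finrank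
    · intro v _
      rw [pi_eq_sum_univ' v]
      refine Submodule.sum_mem _ fun i _ => Submodule.smul_mem _ _ ?_
      obtain ⟨t, ht, hti⟩ := hφ.surjOn (show i.val + 1 ∈ Set.Icc 1 n from ⟨by omega, i.2⟩)
      have := hE t ht.1 ht.2
      rw [hti] at this
      convert this using 1
      ext j
      simp [eps, Pi.single_apply, Fin.ext_iff, eq_comm]
    · simp
  exact (hli.linearIndepOn_id).mono hmem

theorem isSimpleSystem (C : IsChain n a b h) (hn : 1 ≤ n)
    (hφ : Set.BijOn φ (Set.Icc 1 n) (Set.Icc 1 n)) : IsSimpleSystem (edgeRoots n φ a b) := by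
  refine ⟨?_, C.linearIndepOn hn hφ, ?_⟩
  · rintro v ⟨i, hi, hin, rfl⟩
    have ha := C.mem_a i hi hin
    have hb := C.mem_b i hi hin
    have ha' := hφ.mapsTo ha
    have hb' := hφ.mapsTo hb
    refine ⟨_, _, ha'.1, ha'.2, hb'.1, hb'.2, fun heq => ?_, rfl⟩
    have := C.lt i hi hin
    rw [hφ.injOn ha hb heq] at this
    exact lt_irrefl _ this
  · rintro v ⟨i, j, hi, hin, hj, hjn, hij, rfl⟩
    obtain ⟨s, hs, rfl⟩ := hφ.surjOn (show i ∈ Set.Icc 1 n from ⟨hi, hin⟩)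
    obtain ⟨t, ht, rfl⟩ := hφ.surjOn (show j ∈ Set.Icc 1 n from ⟨hj, hjn⟩)
    rw [neg_sub]
    exact (C.total hs.1 hs.2 ht.1 ht.2).imp sub_mem_natSpan sub_mem_natSpan

/-- Moving the head `t` of the edge `e` in front of the vertex `b f`. -/
theorem move (C : IsChain n a b h) {e f : ℕ} (he : 1 ≤ e) (hen : e < n) (hf : 1 ≤ f)
    (hfn : f < n) (hef : e ≠ f) (hf' : a f ≠ b e) :
    IsChain n (fun i => Equiv.swap (b e) (a e) (a i)) (fun i => b (Equiv.swap e f i))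
      (fun t => toLex (if t = b e then (h (b f), (0 : ℕ)) else (h t, 1))) := by
  -- With `e : y → t` and `f : u → z`, the new edges are `e : t → z` and `f : u → t`, and an edge
  -- that left `t` now leaves `y`. The vertex `t` receives the height of `z`, with a second
  -- coordinate putting it just before `z`.
  have hab : a e ≠ b e := fun heq => (lt_irrefl _ (heq ▸ C.lt e he hen : h (b e) < h (b e)))
  have swap_mem : ∀ i, 1 ≤ i → i < n → 1 ≤ Equiv.swap e f i ∧ Equiv.swap e f i < n := by
    intro i hi hin
    rw [Equiv.swap_apply_def]
    split_ifs <;> omega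
  have hbne : ∀ i, 1 ≤ i → i < n → i ≠ e → b i ≠ b e := fun i hi hin hie heq =>
    hie (C.inj_b i e hi hin he hen heq)
  refine ⟨?_, ?_, ?_, ?_, ?_⟩
  · intro i hi hin
    have h1 := C.mem_a i hi hin
    have h2 := C.mem_a e he hen
    have h3 := C.mem_b e he hen
    rw [Equiv.swap_apply_def]
    split_ifs <;> assumption
  · intro i hi hin
    exact C.mem_b _ (swap_mem i hi hin).1 (swap_mem i hi hin).2
  · intro i j hi hin hj hjn hij
    exact C.inj_a i j hi hin hj hjn ((Equiv.swap _ _).injective hij)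
  · intro i j hi hin hj hjn hij
    exact (Equiv.swap e f).injective (C.inj_b _ _ (swap_mem i hi hin).1 (swap_mem i hi hin).2
      (swap_mem j hj hjn).1 (swap_mem j hj hjn).2 hij)
  · intro i hi hin
    by_cases hie : i = e
    · subst hie
      rw [Equiv.swap_apply_right, Equiv.swap_apply_left, if_pos rfl,
        if_neg (hbne f hf hfn (Ne.symm hef)), Prod.Lex.toLex_lt_toLex]
      exact Or.inr ⟨rfl, Nat.zero_lt_one⟩
    by_cases hif : i = f
    · subst hif
      have h1 : a i ≠ a e := fun heq => hie (C.inj_a i e hi hin he hen heq)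
      rw [Equiv.swap_apply_of_ne_of_ne hf' h1, Equiv.swap_apply_right, if_neg hf', if_pos rfl,
        Prod.Lex.toLex_lt_toLex]
      exact Or.inl (C.lt i hi hin)
    have h1 : a i ≠ a e := fun heq => hie (C.inj_a i e hi hin he hen heq)
    rw [Equiv.swap_apply_of_ne_of_ne hie hif, if_neg (hbne i hi hin hie)]
    by_cases hit : a i = b e
    · rw [hit, Equiv.swap_apply_left, if_neg hab, Prod.Lex.toLex_lt_toLex]
      left
      have := C.lt i hi hin
      rw [hit] at this
      exact (C.lt e he hen).trans this
    · rw [Equiv.swap_apply_of_ne_of_ne hit h1, if_neg hit, Prod.Lex.toLex_lt_toLex]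
      exact Or.inl (C.lt i hi hin)

end IsChain
end Chain
end Meander

namespace Meander

/-! ### Arithmetic of the meander -/

/-- The assumptions on `p` and `q`. -/
structure Admissible (p q : ℕ) : Prop where
  pos : 0 < p
  le : p ≤ q
  two_lt : 2 < p + q
  coprime : Nat.Coprime p q

namespace Admissible

variable {p q : ℕ}

theorem lt (H : Admissible p q) : p < q := by
  rcases H.le.lt_or_eq with h | h
  · exact h
  · have h1 := H.coprime
    rw [← h, Nat.coprime_self] at h1
    have := H.two_lt
    omega

theorem not_both_even (H : Admissible p q) : p % 2 = 1 ∨ q % 2 = 1 := by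
  by_contra h
  have h1 : 2 ∣ p := by omega
  have h2 : 2 ∣ q := by omega
  have := Nat.dvd_gcd h1 h2
  rw [H.coprime] at this
  omega

theorem phi_succ (t : ℕ) (ht : 1 ≤ t) :
    phi p q (t + 1) = if t % 2 = 1 then sigma p q (phi p q t) else tau p q (phi p q t) := by
  obtain ⟨k, rfl⟩ : ∃ k, t = k + 1 := ⟨t - 1, by omega⟩
  rw [phi]
  by_cases h : Even k
  · have : (k + 1) % 2 = 1 := by rw [Nat.even_iff] at h; omega
    rw [if_pos h, if_pos this]
  · have : ¬ (k + 1) % 2 = 1 := by rw [Nat.even_iff] at h; omega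
    rw [if_neg h, if_neg this]

theorem phi_mem (H : Admissible p q) (t : ℕ) (ht : 1 ≤ t) :
    1 ≤ phi p q t ∧ phi p q t ≤ p + q := by
  have h1 := H.pos
  have h2 := H.lt
  induction t, ht using Nat.le_induction with
  | base =>
    rw [phi, start]
    split_ifs <;> omega
  | succ t ht ih =>
    rw [phi_succ t ht, sigma, tau]
    split_ifs <;> omega

/-- The start is the fixed point of `τ` in `{1, …, p}` if `p` is odd, and in `{p + 1, …, n}` if `p`
is even; in the latter case `q` is odd. -/
theorem two_start (p q : ℕ) (H : Admissible p q) :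
    2 * start p q = p + 1 ∧ p % 2 = 1 ∨ 2 * start p q = p + q + p + 1 ∧ p % 2 = 0 := by
  have := H.not_both_even
  rw [start]
  split_ifs with h
  · rw [Nat.odd_iff] at h; omega
  · rw [Nat.odd_iff] at h; omega

/-- The residue of `φ(t)` modulo `n`, up to the starting point. -/
theorem phi_modEq (H : Admissible p q) (m : ℕ) :
    ((p + q : ℕ) : ℤ) ∣ phi p q (2 * m + 1) - start p q - p * m ∧
    ((p + q : ℕ) : ℤ) ∣ phi p q (2 * m + 2) - 1 + start p q + p * m := by
  -- Modulo `n`, `σ` is `x ↦ 1 - x` and `τ` is `x ↦ p + 1 - x`, so `τσ` is translation by `p`.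
  have key : ∀ m : ℕ, ((p + q : ℕ) : ℤ) ∣ phi p q (2 * m + 1) - start p q - p * m →
      ((p + q : ℕ) : ℤ) ∣ phi p q (2 * m + 2) - 1 + start p q + p * m := by
    intro m ⟨c, hc⟩
    have h1 := H.phi_mem (2 * m + 1) (by omega)
    have h2 : phi p q (2 * m + 2) = sigma p q (phi p q (2 * m + 1)) := by
      rw [phi_succ (2 * m + 1) (by omega), if_pos (by omega)]
    refine ⟨1 - c, ?_⟩
    rw [h2, sigma, Nat.cast_sub (by omega)]
    push_cast at hc ⊢
    linarith
  induction m with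
  | zero =>
    have : ((p + q : ℕ) : ℤ) ∣ phi p q (2 * 0 + 1) - start p q - p * (0 : ℕ) := by simp [phi]
    exact ⟨this, key 0 this⟩
  | succ m ih =>
    obtain ⟨-, c, hc⟩ := ih
    have h1 := H.phi_mem (2 * m + 2) (by omega)
    have h2 : phi p q (2 * (m + 1) + 1) = tau p q (phi p q (2 * m + 2)) := by
      rw [show 2 * (m + 1) + 1 = 2 * m + 2 + 1 by ring, phi_succ (2 * m + 2) (by omega),
        if_neg (by omega)]
    have : ((p + q : ℕ) : ℤ) ∣ phi p q (2 * (m + 1) + 1) - start p q - p * (m + 1 : ℕ) := by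
      rw [h2, tau]
      split_ifs with h
      · refine ⟨-c, ?_⟩
        rw [Nat.cast_sub (by omega)]
        push_cast at hc ⊢
        linarith
      · refine ⟨1 - c, ?_⟩
        rw [Nat.cast_sub (by omega)]
        push_cast at hc ⊢
        linarith
    exact ⟨this, key _ this⟩

theorem isCoprime (H : Admissible p q) : IsCoprime ((p + q : ℕ) : ℤ) (p : ℤ) := by
  rw [Nat.isCoprime_iff_coprime]
  simpa using H.coprime.symm

theorem dvd_two_start (H : Admissible p q) :
    ((p + q : ℕ) : ℤ) ∣ 2 * start p q - (p + 1) := by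
  rcases two_start p q H with ⟨h, -⟩ | ⟨h, -⟩
  · exact ⟨0, by push_cast at *; linarith [(by exact_mod_cast h : (2 * start p q : ℤ) = p + 1)]⟩
  · exact ⟨1, by
      push_cast; linarith [(by exact_mod_cast h : (2 * start p q : ℤ) = p + q + p + 1)]⟩

theorem lt_of_dvd_mul (H : Admissible p q) {k : ℤ} (h : ((p + q : ℕ) : ℤ) ∣ p * k)
    (h1 : -((p + q : ℕ) : ℤ) < k) (h2 : k < (p + q : ℕ)) : k = 0 := by
  have h3 := H.isCoprime.dvd_of_dvd_mul_left h
  exact Int.eq_zero_of_abs_lt_dvd h3 (abs_lt.2 ⟨h1, h2⟩)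

/-- Multiplication by `p` is injective modulo `n`, which settles indices of equal parity. For
different parities `2a ≡ p + 1` gives `n ∣ p (m + k + 1)` with `0 < m + k + 1 < n`, which is
impossible. -/
theorem phi_injOn (H : Admissible p q) : Set.InjOn (phi p q) (Set.Icc 1 (p + q)) := by
  have key : ∀ m k : ℕ, 2 * m + 1 ≤ p + q → 2 * k + 2 ≤ p + q →
      phi p q (2 * m + 1) ≠ phi p q (2 * k + 2) := by
    intro m k hm hk h
    obtain ⟨c1, h1⟩ := (H.phi_modEq m).1
    obtain ⟨c2, h2⟩ := (H.phi_modEq k).2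
    obtain ⟨c3, h3⟩ := H.dvd_two_start
    rw [h] at h1
    have : ((p + q : ℕ) : ℤ) ∣ p * ((m + k + 1 : ℕ) : ℤ) := ⟨c2 - c1 - c3, by
      push_cast at *; linarith⟩
    have := H.lt_of_dvd_mul this (by push_cast; omega) (by push_cast; omega)
    omega
  intro s hs t ht hst
  rw [Set.mem_Icc] at hs ht
  rcases Nat.even_or_odd' s with ⟨m, hm | hm⟩ <;> rcases Nat.even_or_odd' t with ⟨k, hk | hk⟩
  · obtain ⟨m, rfl⟩ : ∃ m', m = m' + 1 := ⟨m - 1, by omega⟩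
    obtain ⟨k, rfl⟩ : ∃ k', k = k' + 1 := ⟨k - 1, by omega⟩
    subst hm hk
    obtain ⟨c1, h1⟩ := (H.phi_modEq m).2
    obtain ⟨c2, h2⟩ := (H.phi_modEq k).2
    rw [show 2 * (m + 1) = 2 * m + 2 by ring, show 2 * (k + 1) = 2 * k + 2 by ring] at hst
    rw [hst] at h1
    have := H.lt_of_dvd_mul (k := (m : ℤ) - k) ⟨c1 - c2, by push_cast at *; linarith⟩
      (by push_cast; omega) (by push_cast; omega)
    omega
  · obtain ⟨m, rfl⟩ : ∃ m', m = m' + 1 := ⟨m - 1, by omega⟩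
    subst hm hk
    exact absurd hst.symm (key k m (by omega) (by omega))
  · obtain ⟨k, rfl⟩ : ∃ k', k = k' + 1 := ⟨k - 1, by omega⟩
    subst hm hk
    exact absurd hst (key m k (by omega) (by omega))
  · subst hm hk
    obtain ⟨c1, h1⟩ := (H.phi_modEq m).1
    obtain ⟨c2, h2⟩ := (H.phi_modEq k).1
    rw [hst] at h1
    have := H.lt_of_dvd_mul (k := (m : ℤ) - k) ⟨c2 - c1, by push_cast at *; linarith⟩
      (by push_cast; omega) (by push_cast; omega)
    omega

theorem phi_bijOn (H : Admissible p q) :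
    Set.BijOn (phi p q) (Set.Icc 1 (p + q)) (Set.Icc 1 (p + q)) := by
  have h1 : Set.MapsTo (phi p q) (Set.Icc 1 (p + q)) (Set.Icc 1 (p + q)) :=
    fun t ht => H.phi_mem t ht.1
  refine ⟨h1, H.phi_injOn, ?_⟩
  exact ((Set.finite_Icc 1 (p + q)).injOn_iff_bijOn_of_mapsTo h1).1 H.phi_injOn |>.surjOn

/-- The path ends at `t = n`. -/
theorem phi_end (H : Admissible p q) : phi p q (p + q + 1) = phi p q (p + q) := by
  have h3 := H.dvd_two_start
  have h4 := H.two_lt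
  have ha := H.phi_mem (p + q) (by omega)
  have hb := H.phi_mem (p + q + 1) (by omega)
  have key : ((p + q : ℕ) : ℤ) ∣ (phi p q (p + q + 1) : ℤ) - phi p q (p + q) := by
    obtain ⟨c3, h3⟩ := h3
    rcases Nat.even_or_odd' (p + q) with ⟨m, hm | hm⟩
    · obtain ⟨m, rfl⟩ : ∃ m', m = m' + 1 := ⟨m - 1, by omega⟩
      obtain ⟨c1, h1⟩ := (H.phi_modEq m).2
      obtain ⟨c2, h2⟩ := (H.phi_modEq (m + 1)).1
      have e1 : p + q = 2 * m + 2 := by omega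
      have e2 : p + q + 1 = 2 * (m + 1) + 1 := by omega
      rw [show phi p q (p + q) = phi p q (2 * m + 2) by rw [e1],
        show phi p q (p + q + 1) = phi p q (2 * (m + 1) + 1) by rw [e2]]
      have e3 : (p : ℤ) * (2 * m + 2) = p * (p + q) := by
        congr 1; exact_mod_cast e1.symm
      refine ⟨c2 - c1 + p + c3 - 1 + 1, ?_⟩
      push_cast at *
      nlinarith
    · obtain ⟨c1, h1⟩ := (H.phi_modEq m).1
      obtain ⟨c2, h2⟩ := (H.phi_modEq m).2
      rw [show phi p q (p + q) = phi p q (2 * m + 1) by rw [hm],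
        show phi p q (p + q + 1) = phi p q (2 * m + 2) by rw [hm]]
      have e3 : (p : ℤ) * (2 * m + 1) = p * (p + q) := by
        congr 1; exact_mod_cast hm.symm
      refine ⟨c2 - c1 - p - c3, ?_⟩
      push_cast at *
      nlinarith
  have := Int.eq_zero_of_abs_lt_dvd key (abs_lt.2 ⟨by push_cast; omega, by push_cast; omega⟩)
  omega

end Admissible
end Meander

/-! ### Turning points, labels and orientation of the path. -/

namespace Meander
namespace Admissible

variable {p q : ℕ}

/-- For `x ≤ p < q` one always has `x < σ(x)`, so only `τ(x) ≤ x` remains; for `x > p` one needs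
`σ(x) ≤ x ≤ τ(x)`. These linear conditions let `omega` settle questions about turning points. -/
theorem isTurning_iff (H : Admissible p q) {t : ℕ} (ht : 1 ≤ t) (htn : t ≤ p + q) :
    IsTurning p q t ↔ phi p q t ≤ p ∧ p + 1 ≤ 2 * phi p q t ∨
      p < phi p q t ∧ p + q + 1 ≤ 2 * phi p q t ∧ 2 * phi p q t ≤ p + q + p + 1 := by
  have h1 := H.phi_mem t ht
  have h2 := H.lt
  rw [IsTurning, sigma, tau]
  simp only [ht, htn, true_and]
  rw [Nat.cast_sub (by omega)]
  by_cases hx : phi p q t ≤ p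
  · rw [if_pos hx, Nat.cast_sub (by omega)]
    simp only [hx, true_and, not_lt.2 hx, false_and, or_false]
    push_cast
    constructor
    · intro h
      by_contra hc
      have h3 : (phi p q t : ℤ) - (p + q + 1 - phi p q t) < 0 := by omega
      have h4 : (phi p q t : ℤ) - (p + 1 - phi p q t) < 0 := by omega
      have := mul_pos_of_neg_of_neg h3 h4
      linarith
    · intro h
      exact mul_nonpos_of_nonpos_of_nonneg (by omega) (by omega)
  · rw [if_neg hx, Nat.cast_sub (by omega)]
    simp only [hx, false_and, not_le.1 hx, true_and, false_or]
    push_cast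
    constructor
    · intro h
      by_contra hc
      rcases lt_or_ge (2 * phi p q t) (p + q + 1) with h5 | h5
      · have h3 : (phi p q t : ℤ) - (p + q + 1 - phi p q t) < 0 := by omega
        have h4 : (phi p q t : ℤ) - (p + q + p + 1 - phi p q t) < 0 := by omega
        have := mul_pos_of_neg_of_neg h3 h4
        linarith
      · have h3 : 0 < (phi p q t : ℤ) - (p + q + 1 - phi p q t) := by omega
        have h4 : 0 < (phi p q t : ℤ) - (p + q + p + 1 - phi p q t) := by omega
        have := mul_pos h3 h4
        linarith
    · intro h
      exact mul_nonpos_of_nonneg_of_nonpos (by omega) (by omega)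

/-- The edge `{t, t + 1}` in coordinates. -/
theorem phi_step (H : Admissible p q) {t : ℕ} (ht : 1 ≤ t) (htn : t < p + q) :
    phi p q (t + 1) ≠ phi p q t ∧
    (t % 2 = 1 ∧ phi p q t + phi p q (t + 1) = p + q + 1 ∨
      t % 2 = 0 ∧ phi p q t ≤ p ∧ phi p q (t + 1) ≤ p ∧ phi p q t + phi p q (t + 1) = p + 1 ∨
      t % 2 = 0 ∧ p < phi p q t ∧ p < phi p q (t + 1) ∧
        phi p q t + phi p q (t + 1) = p + q + p + 1) := by
  have h1 := H.phi_mem t ht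
  have h2 := H.phi_mem (t + 1) (by omega)
  refine ⟨fun h => ?_, ?_⟩
  · have := H.phi_injOn (show t + 1 ∈ Set.Icc 1 (p + q) from ⟨by omega, htn⟩)
      (show t ∈ Set.Icc 1 (p + q) from ⟨ht, htn.le⟩) h
    omega
  · have h3 := phi_succ (p := p) (q := q) t ht
    rw [sigma, tau] at h3
    split_ifs at h3 <;> omega

theorem isTurning_one (H : Admissible p q) : IsTurning p q 1 := by
  have := H.two_lt
  have := H.lt
  have := two_start p q H
  rw [H.isTurning_iff le_rfl (by omega)]
  simp only [phi]
  omega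

theorem isTurning_n (H : Admissible p q) : IsTurning p q (p + q) := by
  have h1 := H.two_lt
  have h2 := H.lt
  have h3 := phi_succ (p := p) (q := q) (p + q) (by omega)
  have h4 := H.phi_mem (p + q) (by omega)
  rw [H.phi_end, sigma, tau] at h3
  rw [H.isTurning_iff (by omega) le_rfl]
  split_ifs at h3 <;> omega

/-- The number of turning points up to `i`. -/
def count (p q i : ℕ) : ℕ := ((Finset.Icc 1 i).filter (fun t => IsTurning p q t)).card

theorem count_succ (i : ℕ) :
    count p q (i + 1) = count p q i + if IsTurning p q (i + 1) then 1 else 0 := by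
  rw [count, count, ← Finset.insert_Icc_right_eq_Icc_add_one (by omega), Finset.filter_insert]
  split_ifs
  · rw [Finset.card_insert_of_notMem (by simp)]
  · rfl

theorem count_one (H : Admissible p q) : count p q 1 = 1 := by
  have := count_succ (p := p) (q := q) 0
  rw [if_pos (by exact H.isTurning_one)] at this
  simpa [count] using this

theorem one_le_count (H : Admissible p q) {t : ℕ} (ht : 1 ≤ t) : 1 ≤ count p q t := by
  rw [← H.count_one]
  exact Finset.card_le_card (Finset.filter_subset_filter _ (Finset.Icc_subset_Icc_right ht))

theorem label_eq (t : ℕ) : label p q t = count p q t - (if p % 2 = 1 then 0 else 1) := by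
  simp only [label, count, Nat.odd_iff]

theorem label_one (H : Admissible p q) : label p q 1 = p % 2 := by
  rw [label_eq, H.count_one]
  split_ifs <;> omega

theorem label_succ_of_turning (H : Admissible p q) {t : ℕ} (ht : 1 ≤ t)
    (h : IsTurning p q (t + 1)) : label p q (t + 1) = label p q t + 1 := by
  have := H.one_le_count ht
  rw [label_eq, label_eq, count_succ, if_pos h]
  split_ifs <;> omega

theorem label_succ_of_not {t : ℕ} (h : ¬ IsTurning p q (t + 1)) :
    label p q (t + 1) = label p q t := by
  rw [label_eq, label_eq, count_succ, if_neg h, add_zero]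

/-- The parity of the label is the direction of the edge. -/
theorem label_odd_iff (H : Admissible p q) {t : ℕ} (ht : 1 ≤ t) (htn : t < p + q) :
    label p q t % 2 = 1 ↔ (phi p q t < phi p q (t + 1) ↔ t % 2 = 1) := by
  have h2 := H.lt
  induction t, ht using Nat.le_induction with
  | base =>
    have h3 := two_start p q H
    have h4 := H.phi_step le_rfl htn
    have h5 : phi p q 1 = start p q := rfl
    rw [h5] at h4
    rw [H.label_one, h5]
    omega
  | succ t ht ih =>
    have ih := ih (by omega)
    have h3 := H.phi_step ht (by omega)
    have h4 := H.phi_step (t := t + 1) (by omega) htn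
    have h5 := H.isTurning_iff (t := t + 1) (by omega) (by omega)
    -- At an ordinary vertex both neighbours lie on the same side, so going up and going down
    -- alternate like the parity of `t`. At a turning point two successive steps go the same way,
    -- and the equivalence flips together with the label.
    by_cases hT : IsTurning p q (t + 1)
    · rw [H.label_succ_of_turning ht hT]
      have h6 := h5.1 hT
      omega
    · rw [label_succ_of_not hT]
      have h6 := mt h5.2 hT
      omega

/-- Sources lie in `{1, …, p}` and sinks beyond it, because the step of `σ` goes up at the former
and does not at the latter. The coefficients of `α_p` are computed from this. -/
theorem label_turning_odd_iff (H : Admissible p q) {t : ℕ} (h : IsTurning p q t) :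
    label p q t % 2 = 1 ↔ phi p q t ≤ p := by
  obtain ⟨ht, htn, -⟩ := id h
  have h2 := H.lt
  rcases ht.eq_or_lt with rfl | ht1
  · have h3 := two_start p q H
    have h5 : phi p q 1 = start p q := rfl
    rw [H.label_one, h5]
    omega
  · obtain ⟨t, rfl⟩ : ∃ t', t = t' + 1 := ⟨t - 1, by omega⟩
    have h3 := H.phi_step (t := t) (by omega) (by omega)
    have h4 := H.label_odd_iff (t := t) (by omega) (by omega)
    have h5 := (H.isTurning_iff (t := t + 1) (by omega) (by omega)).1 h
    rw [H.label_succ_of_turning (by omega) h]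
    omega

/-- The coordinates of the turning points fill two integer intervals, whose lengths add up to `p +
1`. -/
theorem count_n (H : Admissible p q) : count p q (p + q) = p + 1 := by
  have h2 := H.lt
  have h3 := H.not_both_even
  have h1 : ((Finset.Icc 1 (p + q)).filter (fun t => IsTurning p q t)).image (phi p q) =
      Finset.Icc ((p + 2) / 2) p ∪ Finset.Icc ((p + q + 2) / 2) ((p + q + p + 1) / 2) := by
    ext x
    simp only [Finset.mem_image, Finset.mem_filter, Finset.mem_Icc, Finset.mem_union]
    constructor
    · rintro ⟨t, ⟨ht, hT⟩, rfl⟩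
      have := (H.isTurning_iff ht.1 ht.2).1 hT
      omega
    · intro hx
      obtain ⟨t, ht, rfl⟩ := H.phi_bijOn.surjOn (show x ∈ Set.Icc 1 (p + q) from
        ⟨by omega, by omega⟩)
      refine ⟨t, ⟨ht, (H.isTurning_iff ht.1 ht.2).2 ?_⟩, rfl⟩
      omega
  rw [count, ← Finset.card_image_of_injOn (f := phi p q), h1, Finset.card_union_of_disjoint,
    Nat.card_Icc, Nat.card_Icc]
  · omega
  · rw [Finset.disjoint_left]
    intro x hx hx'
    rw [Finset.mem_Icc] at hx hx'
    omega
  · refine H.phi_injOn.mono ?_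
    intro t ht
    simp only [Finset.coe_filter, Finset.mem_Icc, Set.mem_ofPred_eq] at ht
    exact ht.1

theorem count_eq_nat_count {t : ℕ} (h : IsTurning p q t) :
    count p q t = Nat.count (IsTurning p q) t + 1 := by
  have key : ∀ t, Nat.count (IsTurning p q) (t + 1) = count p q t := by
    intro t
    induction t with
    | zero =>
      have : ¬ IsTurning p q 0 := fun h => absurd h.1 (by omega)
      simp [Nat.count_succ, this, count]
    | succ t ih => rw [Nat.count_succ, ih, count_succ]
  rw [← key, Nat.count_succ, if_pos h]

theorem finite_turning (p q : ℕ) : (Set.ofPred (IsTurning p q)).Finite :=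
  (Set.finite_Icc 1 (p + q)).subset fun _ h => ⟨h.1, h.2.1⟩

theorem card_turning (H : Admissible p q) : (finite_turning p q).toFinset.card = p + 1 := by
  rw [← H.count_n, count]
  congr 1
  ext t
  simp only [Set.Finite.mem_toFinset, Set.mem_ofPred_eq, Finset.mem_filter, Finset.mem_Icc]
  exact ⟨fun h => ⟨⟨h.1, h.2.1⟩, h⟩, fun h => h.2⟩

theorem turn_label {t : ℕ} (h : IsTurning p q t) :
    turn p q (label p q t) = t := by
  rw [turn, label_eq, count_eq_nat_count h]
  have : (if Odd p then Nat.count (IsTurning p q) t + 1 - (if p % 2 = 1 then 0 else 1) - 1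
      else Nat.count (IsTurning p q) t + 1 - (if p % 2 = 1 then 0 else 1)) =
      Nat.count (IsTurning p q) t := by
    simp only [Nat.odd_iff]
    split_ifs <;> omega
  rw [this]
  exact Nat.nth_count h

/-- The labels run over `1, …, p + 1` or `0, …, p` according to the parity of `p`; either way the
path ends in a sink. -/
theorem label_n (H : Admissible p q) : label p q (p + q) = 2 * numJ p := by
  rw [label_eq, H.count_n, numJ]
  split_ifs <;> omega

theorem isTurning_turn (H : Admissible p q) {k : ℕ} (h1 : label p q 1 ≤ k) (h2 : k ≤ 2 * numJ p) :
    IsTurning p q (turn p q k) := by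
  rw [H.label_one] at h1
  rw [numJ] at h2
  refine Nat.nth_mem_of_lt_card (finite_turning p q) ?_
  rw [H.card_turning]
  simp only [Nat.odd_iff]
  split_ifs <;> omega

theorem label_turn (H : Admissible p q) {k : ℕ} (h1 : label p q 1 ≤ k) (h2 : k ≤ 2 * numJ p) :
    label p q (turn p q k) = k := by
  have hT := H.isTurning_turn h1 h2
  rw [label_eq, count_eq_nat_count hT]
  rw [H.label_one] at h1
  rw [numJ] at h2
  have : Nat.count (IsTurning p q) (turn p q k) = if Odd p then k - 1 else k := by
    refine Nat.count_nth fun hf => ?_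
    have : hf.toFinset = (finite_turning p q).toFinset := rfl
    rw [this, H.card_turning]
    simp only [Nat.odd_iff]
    split_ifs <;> omega
  rw [this]
  simp only [Nat.odd_iff]
  split_ifs <;> omega

/-! ### Nil and isolated points -/

theorem coeff_sub (n p : ℕ) (v w : Fin n → ℝ) : coeff n p (v - w) = coeff n p v - coeff n p w := by
  simp only [coeff, ← Finset.sum_sub_distrib]
  refine Finset.sum_congr rfl fun j _ => ?_
  split_ifs <;> simp

theorem coeff_phi (H : Admissible p q) {s t : ℕ} (hs : 1 ≤ s) (ht : 1 ≤ t) :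
    coeff (p + q) p (eps (p + q) (phi p q s) - eps (p + q) (phi p q t)) =
      (if phi p q s ≤ p then 1 else 0) - (if phi p q t ≤ p then 1 else 0) := by
  rw [coeff_sub, coeff_eps _ _ _ (H.phi_mem s hs).1 (H.phi_mem s hs).2,
    coeff_eps _ _ _ (H.phi_mem t ht).1 (H.phi_mem t ht).2]

theorem isNil_iff (H : Admissible p q) {t : ℕ} (ht : 1 ≤ t) :
    IsNil p q t ↔ ¬ (phi p q t ≤ p ↔ phi p q (t + 1) ≤ p) := by
  rw [IsNil, beta, betaI, H.coeff_phi ht (by omega)]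
  split_ifs with h1 h2 h2 <;> simp [h1, h2]

/-- The involution `τ` preserves `{1, …, p}` while `σ` maps it beyond `p`, so the nil edge at a
source is its `σ`-edge. -/
theorem isNil_source_below (H : Admissible p q) {t : ℕ} (h : IsTurning p q t)
    (hL : label p q t % 2 = 1) (ht : t < p + q) : IsNil p q t ↔ t % 2 = 1 := by
  have h1 := (H.label_turning_odd_iff h).1 hL
  have h2 := H.lt
  have h3 := H.phi_step h.1 ht
  rw [H.isNil_iff h.1]
  omega

theorem isNil_source_above (H : Admissible p q) {t : ℕ} (ht : 1 ≤ t) (h : IsTurning p q (t + 1))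
    (hL : label p q (t + 1) % 2 = 1) : IsNil p q t ↔ t % 2 = 1 := by
  have h1 := (H.label_turning_odd_iff h).1 hL
  have h2 := H.lt
  have h3 := H.phi_step ht (by have := h.2.1; omega)
  rw [H.isNil_iff ht]
  omega

/-- If the other end `x'` of the edge is at most `p`, then `2x' ≥ q + 1 > p + 1`, so it is a source.
Conversely, consecutive labels have different parity, so adjacent turning points lie on different
sides of `p`. -/
theorem isNil_sink_below (H : Admissible p q) {t : ℕ} (h : IsTurning p q t)
    (hL : label p q t % 2 = 0) (ht : t < p + q) : IsNil p q t ↔ IsTurning p q (t + 1) := by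
  have h1 := H.label_turning_odd_iff h
  have h2 := H.lt
  have h3 := H.phi_step h.1 ht
  have h4 := (H.isTurning_iff h.1 h.2.1).1 h
  rw [H.isNil_iff h.1]
  constructor
  · intro h5
    rw [H.isTurning_iff (by omega) (by omega)]
    omega
  · intro h5
    have := H.label_turning_odd_iff h5
    rw [H.label_succ_of_turning h.1 h5] at this
    omega

theorem isNil_sink_above (H : Admissible p q) {t : ℕ} (ht : 1 ≤ t) (h : IsTurning p q (t + 1))
    (hL : label p q (t + 1) % 2 = 0) : IsNil p q t ↔ IsTurning p q t := by
  have h1 := H.label_turning_odd_iff h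
  have h2 := H.lt
  have htn : t < p + q := by have := h.2.1; omega
  have h3 := H.phi_step ht htn
  have h4 := (H.isTurning_iff h.1 h.2.1).1 h
  rw [H.isNil_iff ht]
  constructor
  · intro h5
    rw [H.isTurning_iff (by omega) (by omega)]
    omega
  · intro h5
    have := H.label_turning_odd_iff h5
    have := H.label_succ_of_turning ht h
    omega

/-- An edge between two turning points is nil, and therefore given by `σ`. -/
theorem isolated_odd (H : Admissible p q) {t : ℕ} (h : IsTurning p q t)
    (h' : IsTurning p q (t + 1)) : IsNil p q t ∧ t % 2 = 1 := by
  have htn : t < p + q := by have := h'.2.1; omega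
  have h3 := H.phi_step h.1 htn
  have h4 := H.label_turning_odd_iff h
  have h5 := H.label_turning_odd_iff h'
  rw [H.label_succ_of_turning h.1 h'] at h5
  rw [H.isNil_iff h.1]
  omega

/-- The signature, indexed from `0`. -/
def Positive (p q w : ℕ) : Prop := sg p q (w + 1) = 1

theorem positive_iff_nil (w : ℕ) : Positive p q w ↔ IsNil p q (turn p q (2 * w + 1)) := by
  rw [Positive, sg, show 2 * (w + 1) - 1 = 2 * w + 1 by omega]
  split_ifs with h <;> simp [h]

theorem sg_eq_neg_one (w : ℕ) : sg p q (w + 1) = -1 ↔ ¬ Positive p q w := by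
  rw [Positive, sg]
  split_ifs <;> simp

theorem positive_iff (H : Admissible p q) {t w : ℕ} (h : IsTurning p q t)
    (hL : label p q t = 2 * w + 1) : Positive p q w ↔ t % 2 = 1 := by
  have ht : t < p + q := by
    have := h.2.1
    by_contra hc
    have h1 : t = p + q := by omega
    rw [h1, H.label_n] at hL
    omega
  rw [positive_iff_nil, ← hL, turn_label h, H.isNil_source_below h (by omega) ht]

/-- Isolated edges are `σ`-edges, hence have odd index, and a source is positive exactly if its
index is odd. The three conditions on isolated edges are parity statements. -/
theorem zigzag (H : Admissible p q) :
    Zigzag (p + q) (numJ p) (label p q) (turn p q) (IsTurning p q) (Positive p q) where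
  range t h := ⟨h.1, h.2.1⟩
  T_L t h := turn_label h
  trn_T k h1 h2 := H.isTurning_turn h1 h2
  L_T k h1 h2 := H.label_turn h1 h2
  L_succ_trn t h1 h2 h := H.label_succ_of_turning h1 h
  L_succ_not t h1 h2 h := label_succ_of_not h
  trn_one := H.isTurning_one
  trn_n := H.isTurning_n
  L_one := by rw [H.label_one]; omega
  L_n := H.label_n
  iso_below t w h hL h' := (H.positive_iff h hL).2 (H.isolated_odd h h').2
  iso_above t w h hL h' := by
    rw [H.positive_iff h hL]
    have := (H.isolated_odd h' h).2
    omega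
  iso_B t w h hL h' h'' := by
    have h1 := (H.isolated_odd h h').2
    have h2 := h''.1
    have h3 := (H.isolated_odd h'' (by rwa [Nat.sub_add_cancel (by omega)])).2
    omega
  s_zero h := by rw [H.positive_iff H.isTurning_one (by rw [h])]

end Admissible
end Meander

namespace Meander
set_option linter.unusedSimpArgs false
namespace Admissible

variable {p q : ℕ}

/-! ### Runs -/

theorem sg_eq_iff (x y : ℕ) :
    sg p q (x + 1) = sg p q (y + 1) ↔ (Positive p q x ↔ Positive p q y) := by
  rw [Positive, Positive, sg, sg]
  split_ifs <;> simp

theorem runEnd_spec {j : ℕ} (hj : j ≤ numJ p) :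
    j < runEnd p q j ∧ runEnd p q j ≤ numJ p + 1 ∧
    (runEnd p q j ≤ numJ p → sg p q (runEnd p q j) ≠ sg p q j) ∧
    ∀ x, j < x → x < runEnd p q j → sg p q x = sg p q j := by
  -- The set is non-empty, so the infimum is attained and is not the default value `0`.
  have hmem : numJ p + 1 ∈ {w | j < w ∧ (numJ p < w ∨ sg p q w ≠ sg p q j)} :=
    ⟨by omega, Or.inl (by omega)⟩
  have h1 := Nat.sInf_mem ⟨_, hmem⟩
  refine ⟨h1.1, Nat.sInf_le hmem, fun h => h1.2.resolve_left (not_lt.2 h), fun x hx hxr => ?_⟩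
  have h2 := Nat.notMem_of_lt_sInf hxr
  by_contra hc
  exact h2 ⟨hx, Or.inr hc⟩

theorem runStart_spec {j : ℕ} (hj : 1 ≤ j) :
    1 ≤ runStart p q j ∧ runStart p q j ≤ j ∧
    (1 < runStart p q j → sg p q (runStart p q j - 1) ≠ sg p q j) ∧
    ∀ x, runStart p q j ≤ x → x ≤ j → sg p q x = sg p q j := by
  have hmem : j ∈ {w | 1 ≤ w ∧ w ≤ j ∧ ∀ x, w ≤ x → x ≤ j → sg p q x = sg p q j} :=
    ⟨hj, le_rfl, fun x h1 h2 => by rw [le_antisymm h2 h1]⟩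
  have h1 := Nat.sInf_mem ⟨_, hmem⟩
  refine ⟨h1.1, h1.2.1, fun h hc => ?_, h1.2.2⟩
  have h2 : runStart p q j - 1 < runStart p q j := by omega
  refine Nat.notMem_of_lt_sInf h2 ⟨by omega, ?_, fun x hx hxj => ?_⟩
  · have : runStart p q j ≤ j := h1.2.1
    omega
  · rcases hx.eq_or_lt with rfl | hx
    · exact hc
    · exact h1.2.2 x (by change runStart p q j ≤ x; omega) hxj

open Classical in
/-- The number of the last positive source among the first `w` ones. -/
noncomputable def lastPos (p q : ℕ) : ℕ → ℕ
  | 0 => 0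
  | w + 1 => if Positive p q w then w + 1 else lastPos p q w

open Classical in
/-- The number of sources up to the end of the negative run following the source `w`. -/
noncomputable def endOf (p q w : ℕ) : ℕ :=
  if w + 1 < numJ p ∧ ¬ Positive p q (w + 1) then runEnd p q (w + 2) - 1 else w + 1

theorem lastPos_const {u w : ℕ} (h : u ≤ w) (hs : ∀ x, u ≤ x → x < w → ¬ Positive p q x) :
    lastPos p q w = lastPos p q u := by
  induction w, h using Nat.le_induction with
  | base => rfl
  | succ w h ih =>
    rw [lastPos, if_neg (hs w h (by omega)), ih fun x h1 h2 => hs x h1 (by omega)]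

theorem lastPos_spec : Zigzag.LastPos (numJ p) (Positive p q) (lastPos p q) (endOf p q) where
  zero := rfl
  pos w h := by rw [lastPos, if_pos h]
  neg w h := by rw [lastPos, if_neg h]
  eo_spec w hw hs := by
    rw [endOf]
    split_ifs with h
    · obtain ⟨h1, h2, h3, h4⟩ := runEnd_spec (p := p) (q := q) (j := w + 2) (by omega)
      refine ⟨by omega, by omega, ?_, fun h5 => ?_⟩
      · rw [lastPos_const (u := w + 1) (by omega), lastPos, if_pos hs]
        intro x hx hx'
        rcases hx.eq_or_lt with rfl | hx
        · exact h.2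
        · have := h4 (x + 1) (by omega) (by omega)
          rw [show w + 2 = w + 1 + 1 by omega, sg_eq_iff] at this
          tauto
      · have h6 := h3 (by omega)
        rw [show runEnd p q (w + 2) = runEnd p q (w + 2) - 1 + 1 by omega,
          show w + 2 = w + 1 + 1 by omega, Ne, sg_eq_iff] at h6
        rw [show w + 2 = w + 1 + 1 by omega]
        tauto
    · refine ⟨le_rfl, by omega, by rw [lastPos, if_pos hs], fun h5 => ?_⟩
      tauto

/-- As the signature starts positively, a negative run is preceded by a positive source: the one
numbered `runStart p q w - 1` from one, or `runStart p q w - 2` from zero. -/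
theorem lastPos_eq_runStart {w : ℕ} (hs0 : Positive p q 0) (hw : 0 < w)
    (hs : ¬ Positive p q (w - 1)) : lastPos p q w = runStart p q w - 1 := by
  obtain ⟨h1, h2, h3, h4⟩ := runStart_spec (p := p) (q := q) (j := w) hw
  have hneg : ∀ x, runStart p q w - 1 ≤ x → x < w → ¬ Positive p q x := by
    intro x hx hxw
    have := h4 (x + 1) (by omega) (by omega)
    rw [show sg p q w = sg p q (w - 1 + 1) by congr 1; omega, sg_eq_iff] at this
    tauto
  have h5 : runStart p q w - 1 ≠ 0 := fun h => hneg 0 (by omega) hw hs0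
  have h6 := h3 (by omega)
  rw [show runStart p q w - 1 = runStart p q w - 2 + 1 by omega,
    show sg p q w = sg p q (w - 1 + 1) by congr 1; omega, Ne, sg_eq_iff] at h6
  have h7 : Positive p q (runStart p q w - 2) := by tauto
  rw [lastPos_const (u := runStart p q w - 1) (by omega) hneg,
    show runStart p q w - 1 = runStart p q w - 2 + 1 by omega, lastPos, if_pos h7]

open Classical in
/-- One more than the index of the next negative source. -/
noncomputable def nextNeg (p q w : ℕ) : ℕ :=
  if w < numJ p ∧ Positive p q w then runEnd p q (w + 1) else w + 1

open Classical in
/-- The number of sources before the positive run preceding the source `w`. -/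
noncomputable def startOf (p q w : ℕ) : ℕ :=
  if 0 < w ∧ Positive p q (w - 1) then runStart p q w - 1 else w

/-- Two neighbours in one positive run see the same end of it; if the earlier end were different, it
would have both signs. -/
theorem nextNeg_pos {w : ℕ} (hw : w < numJ p) (hs : Positive p q w) :
    nextNeg p q w = nextNeg p q (w + 1) := by
  obtain ⟨h1, h2, h3, h4⟩ := runEnd_spec (p := p) (q := q) (j := w + 1) (by omega)
  rw [nextNeg, if_pos ⟨hw, hs⟩, nextNeg]
  split_ifs with h
  · obtain ⟨h1', h2', h3', h4'⟩ := runEnd_spec (p := p) (q := q) (j := w + 1 + 1) (by omega)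
    have heq : sg p q (w + 1 + 1) = sg p q (w + 1) := (sg_eq_iff _ _).2 (by tauto)
    rw [heq] at h3' h4'
    rcases lt_trichotomy (runEnd p q (w + 1)) (runEnd p q (w + 1 + 1)) with hlt | h5 | hlt
    · rcases Nat.lt_or_ge (w + 1 + 1) (runEnd p q (w + 1)) with h6 | h6
      · exact absurd (h4' _ h6 hlt) (h3 (by omega))
      · have h7 : runEnd p q (w + 1) = w + 1 + 1 := by omega
        have := h3 (by omega)
        rw [h7] at this
        exact absurd heq this
    · exact h5
    · exact absurd (h4 _ (by omega) hlt) (h3' (by omega))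
  · by_contra hc
    have h5 := h4 (w + 1 + 1) (by omega) (by omega)
    rw [sg_eq_iff] at h5
    have h6 : ¬ (w + 1 < numJ p) := by tauto
    omega

theorem nextNeg_const {u w : ℕ} (h : u ≤ w) (hw : w ≤ numJ p)
    (hs : ∀ x, u ≤ x → x < w → Positive p q x) : nextNeg p q u = nextNeg p q w := by
  induction w, h using Nat.le_induction with
  | base => rfl
  | succ w h ih =>
    rw [← nextNeg_pos (by omega) (hs w h (by omega)),
      ih (by omega) fun x h1 h2 => hs x h1 (by omega)]

theorem nextNeg_spec : Zigzag.NextNeg (numJ p) (Positive p q) (nextNeg p q) (startOf p q) where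
  last := by rw [nextNeg, if_neg (by simp)]
  neg w _ h := by rw [nextNeg, if_neg (by tauto)]
  pos w hw h := nextNeg_pos hw h
  so_spec w hw hs := by
    have hd : nextNeg p q w = w + 1 := by rw [nextNeg, if_neg (by tauto)]
    rw [startOf]
    split_ifs with h
    · obtain ⟨h1, h2, h3, h4⟩ := runStart_spec (p := p) (q := q) (j := w) (by omega)
      refine ⟨by omega, ?_, fun h5 => ?_⟩
      · rw [nextNeg_const (w := w) (by omega) hw, hd]
        intro x hx hxw
        have := h4 (x + 1) (by omega) (by omega)
        rw [show sg p q w = sg p q (w - 1 + 1) by congr 1; omega, sg_eq_iff] at this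
        tauto
      · have h6 := h3 (by omega)
        rw [show runStart p q w - 1 = runStart p q w - 1 - 1 + 1 by omega,
          show sg p q w = sg p q (w - 1 + 1) by congr 1; omega, Ne, sg_eq_iff] at h6
        tauto
    · exact ⟨le_rfl, hd, fun h5 => by tauto⟩

end Admissible
end Meander

/-! ### The added interval values as moves of edge ends. -/

namespace Meander
set_option linter.unusedSimpArgs false
namespace Admissible

variable {p q : ℕ}

open Zigzag

theorem sign_of_odd {i : ℕ} (h : label p q i % 2 = 1) : sign p q i = 1 := by
  rw [sign]; exact Even.neg_one_pow (by rw [Nat.even_iff]; omega)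

theorem sign_of_even {i : ℕ} (h : label p q i % 2 ≠ 1) : sign p q i = -1 := by
  rw [sign]; exact Odd.neg_one_pow (by rw [Nat.odd_iff]; omega)

theorem signedBeta_eq (i : ℕ) : signedBeta p q i =
    eps (p + q) (phi p q (tail (label p q) i)) - eps (p + q) (phi p q (head (label p q) i)) := by
  rw [signedBeta, beta, betaI, tail, head]
  split_ifs with h
  · rw [sign_of_odd h, one_smul]
  · rw [sign_of_even h, neg_one_smul, neg_sub]

theorem beta'_of_nil {i : ℕ} (h : IsNil p q i) : beta' p q i = beta p q i := by
  rw [beta', if_pos h]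

theorem beta'_of_not {i : ℕ} (h1 : ¬ IsInternal p q (i + 1)) (h2 : ¬ IsInternal p q i) :
    beta' p q i = beta p q i := by
  rw [beta', if_neg h1, if_neg h2, ite_self]

theorem beta'_above {i : ℕ} (h : ¬ IsNil p q i) (h1 : IsInternal p q (i + 1)) :
    beta' p q i = beta p q i + if sg p q 1 = 1 then addAbovePos p q (label p q (i + 1))
      else addAboveNeg p q (label p q (i + 1)) := by
  rw [beta', if_neg h, if_pos h1]

theorem beta'_below {i : ℕ} (h : ¬ IsNil p q i) (h1 : ¬ IsInternal p q (i + 1))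
    (h2 : IsInternal p q i) :
    beta' p q i = beta p q i + if sg p q 1 = 1 then addBelowPos p q (label p q i)
      else addBelowNeg p q (label p q i) := by
  rw [beta', if_neg h, if_neg h1, if_pos h2]

theorem betaI_add_betaI (i j k : ℕ) : betaI p q i j + betaI p q j k = betaI p q i k := by
  simp [betaI]

/-- The simple and the compound value have one description: both lead to the last sink of the block
of the source `w`. -/
theorem addAbovePos_odd (w : ℕ) : addAbovePos p q (2 * w + 1) =
    betaI p q (turn p q (2 * w + 1)) (turn p q (2 * endOf p q w)) := by
  have h1 : Odd (2 * w + 1) := ⟨w, rfl⟩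
  have h2 : (2 * w + 1 + 1) / 2 = w + 1 := by omega
  classical
  rw [addAbovePos, if_pos h1]
  simp only [h2, sg_eq_neg_one, endOf]
  split_ifs with h
  · have := (runEnd_spec (p := p) (q := q) (j := w + 2) (by omega)).1
    rw [show w + 1 + 1 = w + 2 by rfl]
    congr 2
    omega
  · rfl

theorem even_two_mul_not_odd (w : ℕ) : ¬ Odd (2 * w) := by
  rw [Nat.not_odd_iff_even]; exact even_two_mul w

/-- The value of `addAbovePos` at a sink. -/
theorem addAbovePos_even_of_not {w : ℕ} (hs : ¬ Positive p q w) : addAbovePos p q (2 * w) =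
    betaI p q (turn p q (2 * w)) (turn p q (2 * w + 1)) := by
  have h2 : 2 * w / 2 = w := by omega
  rw [addAbovePos, if_neg (even_two_mul_not_odd w), h2]
  exact if_pos ((sg_eq_neg_one w).2 hs)

theorem addAbovePos_even {w : ℕ} (hs : Positive p q w) : addAbovePos p q (2 * w) = 0 := by
  have h2 : 2 * w / 2 = w := by omega
  rw [addAbovePos, if_neg (even_two_mul_not_odd w), h2]
  exact if_neg (fun h => (sg_eq_neg_one w).1 h hs)

theorem isNil_above_sink (H : Admissible p q) {w : ℕ} (h1 : label p q 1 ≤ 2 * w)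
    (h2 : w ≤ numJ p) (h3 : 1 < turn p q (2 * w)) :
    IsNil p q (turn p q (2 * w) - 1) ↔ IsTurning p q (turn p q (2 * w) - 1) := by
  have h4 := H.isTurning_turn h1 (by omega)
  have h5 := H.label_turn h1 (by omega)
  exact H.isNil_sink_above (t := turn p q (2 * w) - 1) (by omega)
    (by rwa [Nat.sub_add_cancel (by omega)]) (by rw [Nat.sub_add_cancel (by omega)]; omega)

theorem positive_of_isolated (H : Admissible p q) {i w : ℕ} (ti : IsTurning p q i)
    (hw : label p q i = 2 * w) (h : IsTurning p q (i - 1)) : 0 < w ∧ Positive p q (w - 1) := by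
  have Z := H.zigzag
  have h1 := h.1
  have hLi := Z.L_succ_trn (i - 1) (by omega) (by have := ti.2.1; omega)
    (by rwa [Nat.sub_add_cancel (by omega)])
  rw [Nat.sub_add_cancel (by omega), hw] at hLi
  exact ⟨by omega, Z.iso_below (i - 1) (w - 1) h (by omega)
    (by rwa [Nat.sub_add_cancel (by omega)])⟩

/-- All non-zero cases of the definition are covered by the source `below`, the entry of the
preceding block. When the value above the sink is nil, that edge is isolated, so the source before
the sink is positive. -/
theorem addBelowPos_even_of (H : Admissible p q) (s0 : Positive p q 0) {i w : ℕ} (hw0 : 0 < w)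
    (hwM : w < numJ p) (ti : IsTurning p q i) (hi : 1 < i) (hw : label p q i = 2 * w)
    (hc : Positive p q w ∨ IsTurning p q (i - 1)) : addBelowPos p q (2 * w) =
      betaI p q (turn p q (2 * below (turn p q) (IsTurning p q) (Positive p q)
        (lastPos p q) w - 1)) i := by
  have Z := H.zigzag
  have C := lastPos_spec (p := p) (q := q)
  have h2 : 2 * w / 2 = w := by omega
  have Tw : turn p q (2 * w) = i := by rw [← hw]; exact Z.T_L i ti
  have hnil := H.isNil_above_sink (w := w) (by have := Z.L_one; omega) hwM.le (by omega)
  have hsp : sg p q w = 1 ↔ Positive p q (w - 1) := by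
    rw [Positive, Nat.sub_add_cancel hw0]
  rw [Tw] at hnil
  rw [addBelowPos, if_neg (even_two_mul_not_odd w), h2, Tw]
  dsimp only
  by_cases hsw : Positive p q w
  · rw [if_neg (fun h => (sg_eq_neg_one w).1 h hsw)]
    by_cases hs : Positive p q (w - 1)
    · rw [if_pos (hsp.2 hs), below, if_pos hs]
    · have hc1 := lastPos_eq_runStart s0 hw0 hs
      have hc2 : 0 < lastPos p q w := by
        have h2 := C.mono (show 1 ≤ w by omega)
        have h3 : lastPos p q 1 = 1 := C.pos 0 s0
        omega
      have hT : 2 * runStart p q w - 3 = 2 * lastPos p q w - 1 := by omega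
      have hT' : 2 * runStart p q w - 1 = 2 * (lastPos p q w + 1) - 1 := by omega
      have tA := Z.trn_T (2 * lastPos p q w - 1) (by have := Z.L_one; omega)
        (by have := C.le w; omega)
      rw [if_neg (mt hsp.1 hs), hT, hT', below, if_neg hs]
      by_cases hiso : IsTurning p q (turn p q (2 * lastPos p q w - 1) + 1)
      · rw [if_pos ⟨tA, hiso⟩, if_pos hiso]
      · rw [if_neg (fun h => hiso h.2), if_neg hiso]
  · have hti := hc.resolve_left hsw
    rw [if_pos ((sg_eq_neg_one w).2 hsw), if_pos (hnil.2 hti), below,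
      if_pos (H.positive_of_isolated ti hw hti).2]

theorem addBelowPos_even_of_not (H : Admissible p q) {i w : ℕ} (hw0 : 0 < w)
    (hwM : w < numJ p) (ti : IsTurning p q i) (hi : 1 < i) (hw : label p q i = 2 * w)
    (hc : ¬ (Positive p q w ∨ IsTurning p q (i - 1))) : addBelowPos p q (2 * w) = 0 := by
  have Z := H.zigzag
  have h2 : 2 * w / 2 = w := by omega
  have Tw : turn p q (2 * w) = i := by rw [← hw]; exact Z.T_L i ti
  have hnil := H.isNil_above_sink (w := w) (by have := Z.L_one; omega) hwM.le (by omega)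
  rw [Tw] at hnil
  rw [addBelowPos, if_neg (even_two_mul_not_odd w), h2, Tw]
  dsimp only
  rw [if_pos ((sg_eq_neg_one w).2 (fun h => hc (Or.inl h))),
    if_neg (fun h => hc (Or.inr (hnil.1 h)))]

/-- The values `β'_i` for an initially positive signature. -/
theorem sign_smul_beta'_pos (H : Admissible p q) (s0 : Positive p q 0) {i : ℕ} (h1 : 1 ≤ i)
    (hn : i < p + q) : sign p q i • beta' p q i =
      betaI p q (tailPos (label p q) (turn p q) (IsTurning p q) (Positive p q) (endOf p q) i)
        (headPos (numJ p) (label p q) (turn p q) (IsTurning p q) (Positive p q) (lastPos p q) i) := by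
  have Z := H.zigzag
  have C := lastPos_spec (p := p) (q := q)
  have hL := Z.L_lt h1 hn
  have hL1 := Z.L_one_le h1 hn.le
  have e1 : ∀ w, (2 * w + 1) % 2 = 1 := by omega
  have e2 : ∀ w, (2 * w + 1) / 2 = w := by omega
  have e5 : ∀ w, 2 * w + 1 + 1 = 2 * (w + 1) := by omega
  have ss : sg p q 1 = 1 := s0
  have ssn : ∀ w, sg p q (w + 1) = -1 ↔ ¬ Positive p q w := sg_eq_neg_one
  rcases Nat.even_or_odd' (label p q i) with ⟨w, hw | hw⟩
  · rw [sign_of_even (by omega)]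
    by_cases ti : IsTurning p q i <;> by_cases tj : IsTurning p q (i + 1)
    · have Lj := Z.L_succ_trn i h1 hn tj
      rw [hw] at Lj
      have ns := Z.iso_above i w tj Lj ti
      have nb := Z.iso_B i w ti hw tj
      rw [beta'_of_nil (H.isolated_odd ti tj).1]
      simp [tailPos, headPos, hw, ti, tj, ns, nb, beta, betaI]
    · have hnil : ¬ IsNil p q i := by rwa [H.isNil_sink_below ti (by omega) hn]
      have hint : ¬ IsInternal p q (i + 1) := fun h => tj h.1
      have Tw : turn p q (2 * w) = i := by rw [← hw]; exact Z.T_L i ti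
      rcases Nat.eq_zero_or_pos w with rfl | hw0
      · have hi : i = 1 := by
          have h2 := Z.T_L 1 Z.trn_one
          rw [show label p q 1 = 2 * 0 by omega] at h2
          omega
        rw [beta'_of_not hint (by rw [IsInternal]; omega)]
        simp [tailPos, headPos, hw, ti, tj, beta, betaI]
      · have hi : 1 < i := by
          rcases h1.eq_or_lt with rfl | h
          · have := Z.L_one; omega
          · exact h
        have ht : tailPos (label p q) (turn p q) (IsTurning p q) (Positive p q) (endOf p q) i =
            i + 1 := by simp [tailPos, hw, tj]
        rw [beta'_below hnil hint ⟨ti, hi, hn⟩, if_pos ss, hw, ht]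
        by_cases hc : Positive p q w ∨ IsTurning p q (i - 1)
        · rw [H.addBelowPos_even_of s0 hw0 (by omega) ti hi hw hc]
          simp [headPos, hw, ti, hw0, hc, beta, betaI]
        · rw [H.addBelowPos_even_of_not hw0 (by omega) ti hi hw hc]
          simp [headPos, hw, hc, beta, betaI]
    · have Lj := Z.L_succ_trn i h1 hn tj
      rw [hw] at Lj
      have Tw : turn p q (2 * w + 1) = i + 1 := by rw [← Lj]; exact Z.T_L _ tj
      have hps := H.positive_iff tj Lj
      have hnil : IsNil p q i ↔ ¬ Positive p q w := by
        rw [H.isNil_source_above h1 tj (by omega), hps]; omega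
      have hh : headPos (numJ p) (label p q) (turn p q) (IsTurning p q) (Positive p q)
        (lastPos p q) i = i := by simp [headPos, hw, ti]
      by_cases hs : Positive p q w
      · have hin : i + 1 < p + q := by
          rcases Nat.lt_or_ge (i + 1) (p + q) with h | h
          · exact h
          · have : i + 1 = p + q := by omega
            rw [this, Z.L_n] at Lj
            omega
        -- Telescoping `β_{i, i+1} + ι_{i+1, u} = β_{i, u}` replaces one end of the edge; here the
        -- sign is `-1`, so this end is the tail.
        rw [beta'_above (by tauto) ⟨tj, by omega, hin⟩, if_pos ss, Lj, addAbovePos_odd, Tw, beta,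
          betaI_add_betaI, hh]
        simp [tailPos, hw, tj, hs, betaI]
      · rw [beta'_of_nil (by tauto), hh]
        simp [tailPos, hw, tj, hs, beta, betaI]
    · rw [beta'_of_not (fun h => tj h.1) (fun h => ti h.1)]
      simp [tailPos, headPos, hw, ti, tj, beta, betaI]
  · rw [sign_of_odd (by omega), one_smul]
    by_cases ti : IsTurning p q i <;> by_cases tj : IsTurning p q (i + 1)
    · have hs := Z.iso_below i w ti hw tj
      rw [beta'_of_nil (H.isolated_odd ti tj).1]
      simp [tailPos, headPos, hw, e1, e2, ti, tj, hs, beta]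
    · have hps := H.positive_iff ti hw
      have hnil : IsNil p q i ↔ Positive p q w := by
        rw [H.isNil_source_below ti (by omega) hn, hps]
      by_cases hs : Positive p q w
      · rw [beta'_of_nil (by tauto)]
        simp [tailPos, headPos, hw, e1, e2, ti, tj, hs, beta]
      · have Tw : turn p q (2 * w + 1) = i := by rw [← hw]; exact Z.T_L _ ti
        have hi : 1 < i := by
          rcases h1.eq_or_lt with rfl | h
          · have h2 := Z.L_one
            have h3 : w = 0 := by omega
            rw [h3] at hs
            exact absurd s0 hs
          · exact h
        rw [beta'_below (by tauto) (fun h => tj h.1) ⟨ti, hi, hn⟩, if_pos ss, hw, addBelowPos,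
          if_pos ⟨w, rfl⟩, Tw]
        simp [tailPos, headPos, hw, e1, e2, ti, tj, hs, beta, betaI]
    · have Lj := Z.L_succ_trn i h1 hn tj
      rw [hw, e5] at Lj
      have Tw : turn p q (2 * (w + 1)) = i + 1 := by rw [← Lj]; exact Z.T_L _ tj
      have hnil : ¬ IsNil p q i := by rwa [H.isNil_sink_above h1 tj (by omega)]
      have ht : tailPos (label p q) (turn p q) (IsTurning p q) (Positive p q) (endOf p q) i =
        i := by simp [tailPos, hw, e1, ti]
      by_cases hM : w + 1 < numJ p
      · have hin : i + 1 < p + q := by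
          have := Z.T_lt (k := 2 * (w + 1)) (l := 2 * numJ p) (by omega) (by omega) le_rfl
          rw [Tw, Z.T_n] at this
          exact this
        rw [beta'_above hnil ⟨tj, by omega, hin⟩, if_pos ss, Lj, ht]
        have e7 : 2 * w + 1 + 2 = 2 * (w + 1) + 1 := by omega
        by_cases hs : Positive p q (w + 1)
        · rw [addAbovePos_even hs]
          simp [headPos, hw, e1, e2, ti, tj, hs, beta]
        · rw [addAbovePos_even_of_not hs, Tw, beta, betaI_add_betaI]
          simp [headPos, hw, e1, e2, e7, ti, tj, hs, hM]
      · have hin : i + 1 = p + q := by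
          rw [← Tw, show w + 1 = numJ p by omega, Z.T_n]
        rw [beta'_of_not (by rw [IsInternal]; omega) (fun h => ti h.1)]
        simp [tailPos, headPos, hw, e1, e2, ti, tj, hM, beta]
    · rw [beta'_of_not (fun h => tj h.1) (fun h => ti h.1)]
      simp [tailPos, headPos, hw, e1, e2, ti, tj, beta]

/-- Both cases start from the sink in front of the positive run preceding the source `w`, or in
front of `w` itself if there is none. -/
theorem addBelowNeg_odd (w : ℕ) : addBelowNeg p q (2 * w + 1) =
    betaI p q (turn p q (2 * startOf p q w)) (turn p q (2 * w + 1)) := by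
  have h1 : ¬ Odd (2 * w) := even_two_mul_not_odd w
  have h2 : (2 * w + 1 + 1) / 2 = w + 1 := by omega
  have h3 : (2 ≤ w + 1 ∧ sg p q (w + 1 - 1) = 1) ↔ (0 < w ∧ Positive p q (w - 1)) := by
    rcases Nat.eq_zero_or_pos w with rfl | hw
    · simp
    · rw [Positive, Nat.sub_add_cancel hw, Nat.add_sub_cancel]
      exact and_congr_left fun _ => by omega
  rw [addBelowNeg, if_pos ⟨w, rfl⟩, h2, startOf]
  dsimp only
  by_cases h : 0 < w ∧ Positive p q (w - 1)
  · rw [if_pos (h3.2 h), if_pos h, Nat.add_sub_cancel, Nat.mul_sub]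
  · rw [if_neg (mt h3.1 h), if_neg h, Nat.add_sub_cancel]

theorem sg_eq_one {w : ℕ} (hw : 0 < w) : sg p q w = 1 ↔ Positive p q (w - 1) := by
  rw [Positive, Nat.sub_add_cancel hw]

theorem addBelowNeg_even {w : ℕ} (hw : 0 < w) (hs : Positive p q (w - 1)) :
    addBelowNeg p q (2 * w) = betaI p q (turn p q (2 * w - 1)) (turn p q (2 * w)) := by
  have h2 : 2 * w / 2 = w := by omega
  rw [addBelowNeg, if_neg (even_two_mul_not_odd w), h2]
  exact if_pos ((sg_eq_one hw).2 hs)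

theorem addBelowNeg_even_of_not {w : ℕ} (hw : 0 < w) (hs : ¬ Positive p q (w - 1)) :
    addBelowNeg p q (2 * w) = 0 := by
  have h2 : 2 * w / 2 = w := by omega
  rw [addBelowNeg, if_neg (even_two_mul_not_odd w), h2]
  exact if_neg (mt (sg_eq_one hw).1 hs)

theorem addAboveNeg_even_of (H : Admissible p q) (L0 : label p q 1 = 0) {t w : ℕ}
    (hwM : w + 1 < numJ p) (ht : IsTurning p q t) (hL : label p q t = 2 * (w + 1))
    (hc : ¬ Positive p q w ∨ IsTurning p q (t + 1)) : addAboveNeg p q (2 * (w + 1)) =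
      betaI p q t (turn p q (2 * above (numJ p) (turn p q) (IsTurning p q) (Positive p q)
        (nextNeg p q) (w + 1) - 1)) := by
  have Z := H.zigzag
  have C := nextNeg_spec (p := p) (q := q)
  have h2 : 2 * (w + 1) / 2 = w + 1 := by omega
  have Tw : turn p q (2 * (w + 1)) = t := by rw [← hL]; exact Z.T_L t ht
  have htn : t < p + q := by
    have := Z.T_lt (k := 2 * (w + 1)) (l := 2 * numJ p) (by omega) (by omega) le_rfl
    rwa [Tw, Z.T_n] at this
  have hnil := H.isNil_sink_below ht (by omega) htn
  rw [addAboveNeg, if_neg (even_two_mul_not_odd _), h2, Tw]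
  dsimp only
  by_cases hs : Positive p q w
  · have ht' := hc.resolve_left (not_not.2 hs)
    have hns : ¬ Positive p q (w + 1) := by
      have h3 := Z.L_succ_trn t ht.1 htn ht'
      exact Z.iso_above t (w + 1) ht' (by omega) ht
    have hs1 : sg p q (w + 1) = 1 := hs
    rw [if_pos hs1, if_pos (hnil.2 ht'), above, if_pos hns]
    rfl
  · have hs1 : ¬ sg p q (w + 1) = 1 := hs
    rw [if_neg hs1]
    by_cases hs' : Positive p q (w + 1)
    · have hd : nextNeg p q (w + 1) = runEnd p q (w + 1 + 1) := by
        rw [nextNeg, if_pos ⟨hwM, hs'⟩]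
      have hb := C.bounds (show w + 1 ≤ numJ p by omega)
      rw [if_neg (fun h => (sg_eq_neg_one (w + 1)).1 h hs'), ← hd, above, if_neg (not_not.2 hs')]
      by_cases hM : nextNeg p q (w + 1) = numJ p + 1
      · rw [if_pos (by omega), if_pos (Or.inl hM), hM, Nat.add_sub_cancel]
      · rw [if_neg (by omega)]
        have tA := Z.trn_T (2 * nextNeg p q (w + 1) - 1) (by omega) (by omega)
        have tB := Z.trn_T (2 * nextNeg p q (w + 1) - 2) (by omega) (by omega)
        have LA := Z.L_T (2 * nextNeg p q (w + 1) - 1) (by omega) (by omega)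
        have LB := Z.L_T (2 * nextNeg p q (w + 1) - 2) (by omega) (by omega)
        -- The definition tests the vertex after the sink, `above` the vertex before the next
        -- source; adjacency of these two turning points makes the tests agree.
        have hiso : IsIsolated p q (turn p q (2 * nextNeg p q (w + 1) - 2)) ↔
            (nextNeg p q (w + 1) = numJ p + 1 ∨
              IsTurning p q (turn p q (2 * nextNeg p q (w + 1) - 1) - 1)) := by
          rw [or_iff_right hM]
          constructor
          · intro h
            have h3 := Z.T_L _ h.2
            rw [Z.L_succ_trn _ tB.1 (by have := h.2.2.1; omega) h.2, LB,
              show 2 * nextNeg p q (w + 1) - 2 + 1 = 2 * nextNeg p q (w + 1) - 1 by omega] at h3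
            rw [h3, Nat.add_sub_cancel]
            exact tB
          · intro h
            have h4 := h.1
            have h5 : IsTurning p q (turn p q (2 * nextNeg p q (w + 1) - 1) - 1 + 1) := by
              rwa [Nat.sub_add_cancel (by omega)]
            have h6 := Z.L_succ_trn _ h.1 (by have := tA.2.1; omega) h5
            rw [Nat.sub_add_cancel (by omega), LA] at h6
            have h3 := Z.T_L _ h
            rw [show label p q (turn p q (2 * nextNeg p q (w + 1) - 1) - 1) =
              2 * nextNeg p q (w + 1) - 2 by omega] at h3
            refine ⟨tB, ?_⟩
            rwa [h3]
        by_cases hi : IsIsolated p q (turn p q (2 * nextNeg p q (w + 1) - 2))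
        · rw [if_pos hi, if_pos (hiso.1 hi)]
          congr 2; omega
        · rw [if_neg hi, if_neg (mt hiso.2 hi)]
    · rw [if_pos ((sg_eq_neg_one (w + 1)).2 hs'), above, if_pos hs']
      rfl

theorem addAboveNeg_even_of_not (H : Admissible p q) {t w : ℕ} (ht : IsTurning p q t)
    (htn : t < p + q) (hL : label p q t = 2 * (w + 1))
    (hc : ¬ (¬ Positive p q w ∨ IsTurning p q (t + 1))) : addAboveNeg p q (2 * (w + 1)) = 0 := by
  have Z := H.zigzag
  have h2 : 2 * (w + 1) / 2 = w + 1 := by omega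
  have Tw : turn p q (2 * (w + 1)) = t := by rw [← hL]; exact Z.T_L t ht
  have hnil := H.isNil_sink_below ht (by omega) htn
  rw [addAboveNeg, if_neg (even_two_mul_not_odd _), h2, Tw]
  dsimp only
  have hs : sg p q (w + 1) = 1 := by by_contra h; exact hc (Or.inl h)
  rw [if_pos hs, if_neg fun h => hc (Or.inr (hnil.1 h))]

/-- The values `β'_i` for an initially negative signature. -/
theorem sign_smul_beta'_neg (H : Admissible p q) (s0 : ¬ Positive p q 0) {i : ℕ} (h1 : 1 ≤ i)
    (hn : i < p + q) : sign p q i • beta' p q i =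
      betaI p q (tailNeg (label p q) (turn p q) (IsTurning p q) (Positive p q) (startOf p q) i)
        (headNeg (numJ p) (label p q) (turn p q) (IsTurning p q) (Positive p q) (nextNeg p q) i) := by
  have Z := H.zigzag
  have L0 : label p q 1 = 0 := by
    by_contra h
    have := Z.L_one
    exact s0 (Z.s_zero (by omega))
  have hL := Z.L_lt h1 hn
  have e1 : ∀ w, (2 * w + 1) % 2 = 1 := by omega
  have e2 : ∀ w, (2 * w + 1) / 2 = w := by omega
  have e5 : ∀ w, 2 * w + 1 + 1 = 2 * (w + 1) := by omega
  have e7 : ∀ w, 2 * w + 2 = 2 * (w + 1) := by omega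
  have ss : ¬ sg p q 1 = 1 := s0
  rcases Nat.even_or_odd' (label p q i) with ⟨w, hw | hw⟩
  · rw [sign_of_even (by omega)]
    by_cases ti : IsTurning p q i <;> by_cases tj : IsTurning p q (i + 1)
    · have Lj := Z.L_succ_trn i h1 hn tj
      rw [hw] at Lj
      have ns := Z.iso_above i w tj Lj ti
      rw [beta'_of_nil (H.isolated_odd ti tj).1]
      simp [tailNeg, headNeg, hw, ti, tj, ns, beta, betaI]
    · have hnil : ¬ IsNil p q i := by rwa [H.isNil_sink_below ti (by omega) hn]
      have hint : ¬ IsInternal p q (i + 1) := fun h => tj h.1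
      have Tw : turn p q (2 * w) = i := by rw [← hw]; exact Z.T_L i ti
      rcases Nat.eq_zero_or_pos w with rfl | hw0
      · have hi : i = 1 := by
          have h2 := Z.T_L 1 Z.trn_one
          rw [show label p q 1 = 2 * 0 by omega] at h2
          omega
        rw [beta'_of_not hint (by rw [IsInternal]; omega)]
        simp [tailNeg, headNeg, hw, ti, tj, beta, betaI]
      · have hi : 1 < i := by
          rcases h1.eq_or_lt with rfl | h
          · omega
          · exact h
        rw [beta'_below hnil hint ⟨ti, hi, hn⟩, if_neg ss, hw]
        by_cases hs : Positive p q (w - 1)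
        · rw [addBelowNeg_even hw0 hs, Tw]
          simp [tailNeg, headNeg, hw, ti, tj, hw0, hs, beta, betaI]
        · rw [addBelowNeg_even_of_not hw0 hs]
          simp [tailNeg, headNeg, hw, ti, tj, hs, beta, betaI]
    · have Lj := Z.L_succ_trn i h1 hn tj
      rw [hw] at Lj
      have Tw : turn p q (2 * w + 1) = i + 1 := by rw [← Lj]; exact Z.T_L _ tj
      have hps := H.positive_iff tj Lj
      have hnil : IsNil p q i ↔ ¬ Positive p q w := by
        rw [H.isNil_source_above h1 tj (by omega), hps]; omega
      by_cases hs : Positive p q w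
      · have hin : i + 1 < p + q := by
          rcases Nat.lt_or_ge (i + 1) (p + q) with h | h
          · exact h
          · have : i + 1 = p + q := by omega
            rw [this, Z.L_n] at Lj
            omega
        rw [beta'_above (by tauto) ⟨tj, by omega, hin⟩, if_neg ss, Lj, addAboveNeg,
          if_pos ⟨w, rfl⟩, Tw, beta, betaI_add_betaI, e5]
        simp [tailNeg, headNeg, hw, ti, tj, hs, betaI, e7]
      · rw [beta'_of_nil (by tauto)]
        simp [tailNeg, headNeg, hw, ti, tj, hs, beta, betaI]
    · rw [beta'_of_not (fun h => tj h.1) (fun h => ti h.1)]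
      simp [tailNeg, headNeg, hw, ti, tj, beta, betaI]
  · rw [sign_of_odd (by omega), one_smul]
    by_cases ti : IsTurning p q i <;> by_cases tj : IsTurning p q (i + 1)
    · have Lj := Z.L_succ_trn i h1 hn tj
      rw [hw, e5] at Lj
      have hs := Z.iso_below i w ti hw tj
      have nb : ¬ IsTurning p q (i + 2) := fun h => Z.iso_B (i + 1) (w + 1) tj Lj h ti
      rw [beta'_of_nil (H.isolated_odd ti tj).1]
      simp [tailNeg, headNeg, hw, e1, e2, ti, tj, hs, nb, beta]
    · have hps := H.positive_iff ti hw
      have hnil : IsNil p q i ↔ Positive p q w := by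
        rw [H.isNil_source_below ti (by omega) hn, hps]
      by_cases hs : Positive p q w
      · rw [beta'_of_nil (by tauto)]
        simp [tailNeg, headNeg, hw, e1, e2, ti, tj, hs, beta]
      · have Tw : turn p q (2 * w + 1) = i := by rw [← hw]; exact Z.T_L _ ti
        have hi : 1 < i := by
          rcases h1.eq_or_lt with rfl | h
          · omega
          · exact h
        rw [beta'_below (by tauto) (fun h => tj h.1) ⟨ti, hi, hn⟩, if_neg ss, hw,
          addBelowNeg_odd, Tw]
        simp [tailNeg, headNeg, hw, e1, e2, ti, tj, hs, beta, betaI]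
    · have Lj := Z.L_succ_trn i h1 hn tj
      rw [hw, e5] at Lj
      have Tw : turn p q (2 * (w + 1)) = i + 1 := by rw [← Lj]; exact Z.T_L _ tj
      have hnil : ¬ IsNil p q i := by rwa [H.isNil_sink_above h1 tj (by omega)]
      have ht : tailNeg (label p q) (turn p q) (IsTurning p q) (Positive p q) (startOf p q) i =
        i := by simp [tailNeg, hw, e1, ti]
      by_cases hM : w + 1 < numJ p
      · have hin : i + 1 < p + q := by
          have := Z.T_lt (k := 2 * (w + 1)) (l := 2 * numJ p) (by omega) (by omega) le_rfl
          rw [Tw, Z.T_n] at this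
          exact this
        rw [beta'_above hnil ⟨tj, by omega, hin⟩, if_neg ss, Lj, ht]
        by_cases hc : ¬ Positive p q w ∨ IsTurning p q (i + 1 + 1)
        · have hc' : ¬ Positive p q w ∨ IsTurning p q (i + 2) := hc
          rw [H.addAboveNeg_even_of L0 hM tj Lj hc, beta, betaI_add_betaI]
          simp [headNeg, hw, e1, e2, tj, hM, hc']
        · have hc' : ¬ (¬ Positive p q w ∨ IsTurning p q (i + 2)) := hc
          rw [H.addAboveNeg_even_of_not tj hin Lj hc]
          simp [headNeg, hw, e1, e2, hc', beta]
      · have hin : i + 1 = p + q := by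
          rw [← Tw, show w + 1 = numJ p by omega, Z.T_n]
        rw [beta'_of_not (by rw [IsInternal]; omega) (fun h => ti h.1)]
        simp [tailNeg, headNeg, hw, e1, e2, ti, tj, hM, beta]
    · rw [beta'_of_not (fun h => tj h.1) (fun h => ti h.1)]
      simp [tailNeg, headNeg, hw, e1, e2, ti, tj, beta]

end Admissible
end Meander

/-! ### The types of changed edges, and the facts needed at the exceptional edge. -/

namespace Meander
set_option linter.unusedSimpArgs false

namespace Zigzag
variable {n M : ℕ} {L T : ℕ → ℕ} {trn s : ℕ → Prop}

/-- An edge is unchanged, or it starts in a source and its tail is moved to a sink, or it ends in a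
sink and its head is moved to a source. -/
def Kind (L : ℕ → ℕ) (trn : ℕ → Prop) (i a b : ℕ) : Prop :=
  (a = tail L i ∧ b = head L i) ∨
  (trn (tail L i) ∧ L (tail L i) % 2 = 1 ∧ b = head L i ∧ trn a ∧ L a % 2 = 0) ∨
  (trn (head L i) ∧ L (head L i) % 2 = 0 ∧ a = tail L i ∧ trn b ∧ L b % 2 = 1)

/-- No edge has both ends moved: both would be turning points, and the signature forced by an
isolated edge keeps its tail in place. -/
theorem kind_pos (Z : Zigzag n M L T trn s) {c eo : ℕ → ℕ} (C : LastPos M s c eo) (s0 : s 0)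
    {i : ℕ} (h1 : 1 ≤ i) (hn : i < n) :
    Kind L trn i (tailPos L T trn s eo i) (headPos M L T trn s c i) := by
  have hL := Z.L_lt h1 hn
  have hL1 := Z.L_one_le h1 hn.le
  have hL0 := Z.L_one
  by_cases ho : L i % 2 = 1
  · have et : tail L i = i := by simp [tail, ho]
    have eh : head L i = i + 1 := by simp [head, ho]
    rw [Kind, tailPos, headPos, et, eh, if_pos ho, if_pos ho]
    by_cases hA : trn i ∧ ¬ s (L i / 2)
    · right; left
      have hw : L i / 2 ≠ 0 := fun h => hA.2 (by rwa [h])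
      rw [if_pos hA, if_neg (by tauto)]
      refine ⟨hA.1, ho, rfl, Z.trn_T _ (by omega) (by omega), ?_⟩
      rw [Z.L_T _ (by omega) (by omega)]; omega
    · rw [if_neg hA]
      by_cases hB : trn (i + 1) ∧ ¬ trn i ∧ L i / 2 + 1 < M ∧ ¬ s (L i / 2 + 1)
      · right; right
        have := Z.L_succ_trn i h1 hn hB.1
        rw [if_pos hB]
        refine ⟨hB.1, by omega, rfl, Z.trn_T _ (by omega) (by omega), ?_⟩
        rw [Z.L_T _ (by omega) (by omega)]; omega
      · left
        rw [if_neg hB]; exact ⟨rfl, rfl⟩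
  · have et : tail L i = i + 1 := by simp [tail, ho]
    have eh : head L i = i := by simp [head, ho]
    rw [Kind, tailPos, headPos, et, eh, if_neg ho, if_neg ho]
    by_cases hA : trn (i + 1) ∧ s (L i / 2)
    · right; left
      have hLi := Z.L_succ_trn i h1 hn hA.1
      have ⟨h3, h4, _⟩ := C.eo_spec (L i / 2) (by omega) hA.2
      have hB : ¬ (trn i ∧ 0 < L i / 2 ∧ (s (L i / 2) ∨ trn (i - 1))) := fun h =>
        Z.iso_above i (L i / 2) hA.1 (by omega) h.1 hA.2
      rw [if_pos hA, if_neg hB]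
      refine ⟨hA.1, by omega, rfl, Z.trn_T _ (by omega) (by omega), ?_⟩
      rw [Z.L_T _ (by omega) (by omega)]; omega
    · rw [if_neg hA]
      by_cases hB : trn i ∧ 0 < L i / 2 ∧ (s (L i / 2) ∨ trn (i - 1))
      · right; right
        rw [if_pos hB]
        have hb : 1 ≤ below T trn s c (L i / 2) ∧ below T trn s c (L i / 2) ≤ M := by
          have h3 := C.mono (show 1 ≤ L i / 2 by omega)
          have h4 : c 1 = 1 := C.pos 0 s0
          have h5 := C.le (L i / 2)
          rw [below]
          split_ifs <;> omega
        refine ⟨hB.1, by omega, rfl, Z.trn_T _ (by omega) (by omega), ?_⟩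
        rw [Z.L_T _ (by omega) (by omega)]; omega
      · left
        rw [if_neg hB]; exact ⟨rfl, rfl⟩

theorem kind_neg (Z : Zigzag n M L T trn s) {d so : ℕ → ℕ} (C : NextNeg M s d so) (L0 : L 1 = 0)
    {i : ℕ} (h1 : 1 ≤ i) (hn : i < n) :
    Kind L trn i (tailNeg L T trn s so i) (headNeg M L T trn s d i) := by
  have hL := Z.L_lt h1 hn
  by_cases ho : L i % 2 = 1
  · have et : tail L i = i := by simp [tail, ho]
    have eh : head L i = i + 1 := by simp [head, ho]
    rw [Kind, tailNeg, headNeg, et, eh, if_pos ho, if_pos ho]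
    by_cases hA : trn i ∧ ¬ s (L i / 2)
    · right; left
      have hB : ¬ (trn (i + 1) ∧ L i / 2 + 1 < M ∧ (¬ s (L i / 2) ∨ trn (i + 2))) := fun h =>
        hA.2 (Z.iso_below i _ hA.1 (by omega) h.1)
      have ⟨h3, _⟩ := C.so_spec (L i / 2) (by omega) (fun _ => hA.2)
      rw [if_pos hA, if_neg hB]
      refine ⟨hA.1, ho, rfl, Z.trn_T _ (by omega) (by omega), ?_⟩
      rw [Z.L_T _ (by omega) (by omega)]; omega
    · rw [if_neg hA]
      by_cases hB : trn (i + 1) ∧ L i / 2 + 1 < M ∧ (¬ s (L i / 2) ∨ trn (i + 2))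
      · right; right
        have := Z.L_succ_trn i h1 hn hB.1
        rw [if_pos hB]
        have hb : 1 ≤ above M T trn s d (L i / 2 + 1) ∧ above M T trn s d (L i / 2 + 1) ≤ M := by
          have h3 := C.bounds (show L i / 2 + 1 ≤ M by omega)
          have h4 := C.last
          rw [above]
          by_cases h5 : s (L i / 2 + 1)
          · rw [if_neg (not_not.2 h5)]
            by_cases h6 : d (L i / 2 + 1) = M + 1 ∨ trn (T (2 * d (L i / 2 + 1) - 1) - 1)
            · rw [if_pos h6]; omega
            · rw [if_neg h6]; rw [not_or] at h6; omega
          · rw [if_pos h5]; omega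
        refine ⟨hB.1, by omega, rfl, Z.trn_T _ (by omega) (by omega), ?_⟩
        rw [Z.L_T _ (by omega) (by omega)]; omega
      · left
        rw [if_neg hB]; exact ⟨rfl, rfl⟩
  · have et : tail L i = i + 1 := by simp [tail, ho]
    have eh : head L i = i := by simp [head, ho]
    rw [Kind, tailNeg, headNeg, et, eh, if_neg ho, if_neg ho]
    by_cases hA : trn (i + 1) ∧ s (L i / 2)
    · right; left
      have hLi := Z.L_succ_trn i h1 hn hA.1
      rw [if_pos hA, if_neg (by tauto)]
      refine ⟨hA.1, by omega, rfl, Z.trn_T _ (by omega) (by omega), ?_⟩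
      rw [Z.L_T _ (by omega) (by omega)]; omega
    · rw [if_neg hA]
      by_cases hB : trn i ∧ 0 < L i / 2 ∧ s (L i / 2 - 1) ∧ ¬ trn (i + 1)
      · right; right
        rw [if_pos hB]
        refine ⟨hB.1, by omega, rfl, Z.trn_T _ (by omega) (by omega), ?_⟩
        rw [Z.L_T _ (by omega) (by omega)]; omega
      · left
        rw [if_neg hB]; exact ⟨rfl, rfl⟩

theorem trn_tail (Z : Zigzag n M L T trn s) {i : ℕ} (h1 : 1 ≤ i) (hn : i < n)
    (h : trn (tail L i)) : L (tail L i) % 2 = 1 := by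
  rw [tail] at *
  split_ifs at * with ho
  · exact ho
  · have := Z.L_succ_trn i h1 hn h; omega

theorem trn_head (Z : Zigzag n M L T trn s) {i : ℕ} (h1 : 1 ≤ i) (hn : i < n)
    (h : trn (head L i)) : L (head L i) % 2 = 0 := by
  rw [head] at *
  split_ifs at * with ho
  · have := Z.L_succ_trn i h1 hn h; omega
  · omega

theorem tail_mem {i : ℕ} (h1 : 1 ≤ i) (hn : i < n) : 1 ≤ tail L i ∧ tail L i ≤ n := by
  rw [tail]; split_ifs <;> omega

theorem head_mem {i : ℕ} (h1 : 1 ≤ i) (hn : i < n) : 1 ≤ head L i ∧ head L i ≤ n := by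
  rw [head]; split_ifs <;> omega

/-- The non-nil edge at a source always has its tail moved to a sink; hence an unchanged exceptional
edge cannot start at a source unless it is nil. -/
theorem tailPos_even (Z : Zigzag n M L T trn s) {c eo : ℕ → ℕ} (C : LastPos M s c eo) (s0 : s 0)
    {i : ℕ} (h1 : 1 ≤ i) (hn : i < n) (ht : trn (tail L i))
    (hs : L i % 2 = 1 ∧ ¬ s (L i / 2) ∨ L i % 2 = 0 ∧ s (L i / 2)) :
    L (tailPos L T trn s eo i) % 2 = 0 := by
  have hL := Z.L_lt h1 hn
  have hL1 := Z.L_one_le h1 hn.le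
  have hL0 := Z.L_one
  rw [tail] at ht
  rw [tailPos]
  rcases hs with ⟨ho, hs⟩ | ⟨he, hs⟩
  · rw [if_pos ho] at ht ⊢
    have hw : L i / 2 ≠ 0 := fun h => hs (by rwa [h])
    rw [if_pos ⟨ht, hs⟩, Z.L_T _ (by omega) (by omega)]
    omega
  · rw [if_neg (by omega)] at ht ⊢
    obtain ⟨h3, h4, -⟩ := C.eo_spec (L i / 2) (by omega) hs
    rw [if_pos ⟨ht, hs⟩, Z.L_T _ (by omega) (by omega)]
    omega

theorem tailNeg_even (Z : Zigzag n M L T trn s) {d so : ℕ → ℕ} (C : NextNeg M s d so)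
    (L0 : L 1 = 0) {i : ℕ} (h1 : 1 ≤ i) (hn : i < n) (ht : trn (tail L i))
    (hs : L i % 2 = 1 ∧ ¬ s (L i / 2) ∨ L i % 2 = 0 ∧ s (L i / 2)) :
    L (tailNeg L T trn s so i) % 2 = 0 := by
  have hL := Z.L_lt h1 hn
  rw [tail] at ht
  rw [tailNeg]
  rcases hs with ⟨ho, hs⟩ | ⟨he, hs⟩
  · rw [if_pos ho] at ht ⊢
    obtain ⟨h3, -⟩ := C.so_spec (L i / 2) (by omega) (fun _ => hs)
    rw [if_pos ⟨ht, hs⟩, Z.L_T _ (by omega) (by omega)]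
    omega
  · rw [if_neg (by omega)] at ht ⊢
    have hLi := Z.L_succ_trn i h1 hn ht
    rw [if_pos ⟨ht, hs⟩, Z.L_T _ (by omega) (by omega)]
    omega

/-- An edge whose tail is moved to the sink `t` lies on the side of the changed edge at `t`. -/
theorem side_pos (Z : Zigzag n M L T trn s) {c eo : ℕ → ℕ} (C : LastPos M s c eo) (s0 : s 0)
    {i t : ℕ} (h1 : 1 ≤ i) (hn : i < n) (ht : 1 < t) (htn : t < n)
    (ha : tailPos L T trn s eo i = t) (hne : t ≠ tail L i) :
    (L i % 2 = 1 → headPos M L T trn s c t = t ∨ trn (t - 1)) ∧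
    (L i % 2 = 0 → headPos M L T trn s c (t - 1) = t) := by
  have hL := Z.L_lt h1 hn
  have hL1 := Z.L_one_le h1 hn.le
  have hL0 := Z.L_one
  refine ⟨fun ho => ?_, fun he => ?_⟩
  · rw [tail, if_pos ho] at hne
    rw [tailPos, if_pos ho] at ha
    by_cases hA : trn i ∧ ¬ s (L i / 2)
    · have hw : L i / 2 ≠ 0 := fun h => hA.2 (by rwa [h])
      rw [if_pos hA] at ha
      have hLt := Z.L_T (L i - 1) (by omega) (by omega)
      rw [ha] at hLt
      rw [headPos, if_neg (by omega)]
      by_cases hB : trn t ∧ 0 < L t / 2 ∧ (s (L t / 2) ∨ trn (t - 1))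
      · right
        refine hB.2.2.resolve_left fun h => hA.2 ?_
        rwa [show L i / 2 = L t / 2 by omega]
      · left; rw [if_neg hB]
    · rw [if_neg hA] at ha
      exact absurd ha.symm hne
  · rw [tail, if_neg (by omega)] at hne
    rw [tailPos, if_neg (by omega)] at ha
    by_cases hA : trn (i + 1) ∧ s (L i / 2)
    · rw [if_pos hA] at ha
      obtain ⟨h3, h4, h5, h6⟩ := C.eo_spec (L i / 2) (by omega) hA.2
      have hLt := Z.L_T (2 * eo (L i / 2)) (by omega) (by omega)
      have hTt := Z.trn_T (2 * eo (L i / 2)) (by omega) (by omega)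
      rw [ha] at hLt hTt
      have h7 := Z.L_succ_trn (t - 1) (by omega) (by omega) (by rwa [Nat.sub_add_cancel ht.le])
      rw [Nat.sub_add_cancel ht.le, hLt] at h7
      rw [headPos, if_pos (by omega), Nat.sub_add_cancel ht.le,
        show L (t - 1) / 2 + 1 = eo (L i / 2) by omega, if_neg (by tauto)]
    · rw [if_neg hA] at ha
      exact absurd ha.symm hne

end Zigzag

namespace Admissible

variable {p q : ℕ}
open Zigzag

/-- The vertex vectors. -/
theorem eps_apply {n k : ℕ} (hk : 1 ≤ k) (hkn : k ≤ n) (l : ℕ) :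
    eps n l ⟨k - 1, by omega⟩ = if k = l then 1 else 0 := by
  simp [eps, Nat.sub_add_cancel hk]

theorem eps_sub_inj {n a b c d : ℕ} (ha : 1 ≤ a ∧ a ≤ n) (hb : 1 ≤ b ∧ b ≤ n) (hab : a ≠ b)
    (h : eps n a - eps n b = eps n c - eps n d) : a = c ∧ b = d := by
  have h1 := congrFun h ⟨a - 1, by omega⟩
  have h2 := congrFun h ⟨b - 1, by omega⟩
  simp only [Pi.sub_apply, eps_apply ha.1 ha.2, eps_apply hb.1 hb.2, if_true, if_neg hab,
    if_neg hab.symm] at h1 h2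
  constructor
  · by_contra hc
    rw [if_neg hc] at h1
    split_ifs at h1 <;> norm_num at h1
  · by_contra hd
    rw [if_neg hd] at h2
    split_ifs at h2 <;> norm_num at h2

/-- Nothing cancels, so there are two positive coordinates or a coordinate equal to `2`; a root has
a single positive coordinate, equal to `1`. -/
theorem sub_add_sub_notMem_roots {n a b c d : ℕ} (ha : 1 ≤ a ∧ a ≤ n)
    (hc : 1 ≤ c ∧ c ≤ n) (hab : a ≠ b) (had : a ≠ d) (hcb : c ≠ b) (hcd : c ≠ d) :
    eps n a - eps n b + (eps n c - eps n d) ∉ roots n := by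
  rintro ⟨i, j, hi, hin, hj, hjn, hij, h⟩
  have h1 := congrFun h ⟨a - 1, by omega⟩
  have h2 := congrFun h ⟨c - 1, by omega⟩
  simp only [Pi.sub_apply, Pi.add_apply, eps_apply ha.1 ha.2, eps_apply hc.1 hc.2, if_true,
    if_neg hab, if_neg had, if_neg hcb, if_neg hcd] at h1 h2
  by_cases hac : a = c
  · subst hac
    simp only [if_true] at h1
    split_ifs at h1 <;> norm_num at h1
  · rw [if_neg hac] at h1
    rw [if_neg (Ne.symm hac)] at h2
    have e1 : a = i := by
      by_contra hai
      rw [if_neg hai] at h1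
      split_ifs at h1 <;> norm_num at h1
    have e2 : c = i := by
      by_contra hci
      rw [if_neg hci] at h2
      split_ifs at h2 <;> norm_num at h2
    exact hac (e1.trans e2.symm)

theorem neg_mem_roots {n : ℕ} {v : Fin n → ℝ} (h : v ∈ roots n) : -v ∈ roots n := by
  obtain ⟨i, j, hi, hin, hj, hjn, hij, rfl⟩ := h
  exact ⟨j, i, hj, hjn, hi, hin, hij.symm, neg_sub _ _⟩

theorem phi_inj (H : Admissible p q) {s t : ℕ} (hs : 1 ≤ s ∧ s ≤ p + q) (ht : 1 ≤ t ∧ t ≤ p + q)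
    (h : phi p q s = phi p q t) : s = t := H.phi_injOn hs ht h

theorem betaI_inj (H : Admissible p q) {a b c d : ℕ} (ha : 1 ≤ a ∧ a ≤ p + q)
    (hb : 1 ≤ b ∧ b ≤ p + q) (hc : 1 ≤ c ∧ c ≤ p + q) (hd : 1 ≤ d ∧ d ≤ p + q) (hab : a ≠ b)
    (h : betaI p q a b = betaI p q c d) : a = c ∧ b = d := by
  have := eps_sub_inj (H.phi_mem a ha.1) (H.phi_mem b hb.1) (fun h' => hab (H.phi_inj ha hb h')) h
  exact ⟨H.phi_inj ha hc this.1, H.phi_inj hb hd this.2⟩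

/-- The functions `out` and `inn` are left inverses of `a` and `b`, so injectivity follows without
comparing pairs of edges. -/
theorem isChain_of_edgeOK {K : Type*} [LinearOrder K] {n : ℕ} {L out inn : ℕ → ℕ} {key : ℕ → K}
    {a b : ℕ → ℕ} (h : ∀ i, 1 ≤ i → i < n → EdgeOK n L out inn key i (a i) (b i)) :
    IsChain n a b key where
  mem_a i h1 hn := (h i h1 hn).1
  mem_b i h1 hn := (h i h1 hn).2.1
  inj_a i j h1 hn h1' hn' he := by
    rw [← (h i h1 hn).2.2.1, he, (h j h1' hn').2.2.1]
  inj_b i j h1 hn h1' hn' he := by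
    rw [← (h i h1 hn).2.2.2.1, he, (h j h1' hn').2.2.2.1]
  lt i h1 hn := (h i h1 hn).2.2.2.2.1

/-- The tails and heads of the roots `ϵ_i β'_i`, with an order in which both these roots and the
roots `ϵ_i β_i` are positive. -/
structure PrimeData (p q : ℕ) (a b : ℕ → ℕ) (h : ℕ → ℤ ×ₗ ℤ ×ₗ ℤ) : Prop where
  chain : IsChain (p + q) a b h
  mono : ∀ i, 1 ≤ i → i < p + q → h (tail (label p q) i) < h (head (label p q) i)
  prime_eq : ∀ i, 1 ≤ i → i < p + q → sign p q i • beta' p q i = betaI p q (a i) (b i)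
  kind : ∀ i, 1 ≤ i → i < p + q → Kind (label p q) (IsTurning p q) i (a i) (b i)
  side : p % 2 = 1 → ∀ i t, 1 ≤ i → i < p + q → 1 < t → t < p + q → a i = t →
    t ≠ tail (label p q) i →
    (label p q i % 2 = 1 → b t = t ∨ IsTurning p q (t - 1)) ∧
    (label p q i % 2 = 0 → b (t - 1) = t)
  source : ∀ i, 1 ≤ i → i < p + q → IsTurning p q (tail (label p q) i) → ¬ IsNil p q i →
    label p q (a i) % 2 = 0

/-- A boundary edge of a source is not nil if and only if it lies on the side opposite to the one
given by the signature. -/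
theorem positive_of_source (H : Admissible p q) {i : ℕ} (h1 : 1 ≤ i) (hn : i < p + q)
    (ht : IsTurning p q (tail (label p q) i)) (hnil : ¬ IsNil p q i) :
    label p q i % 2 = 1 ∧ ¬ Positive p q (label p q i / 2) ∨
      label p q i % 2 = 0 ∧ Positive p q (label p q i / 2) := by
  rw [tail] at ht
  split_ifs at ht with ho
  · left
    rw [H.isNil_source_below ht ho hn] at hnil
    rw [H.positive_iff ht (w := label p q i / 2) (by omega)]
    exact ⟨ho, hnil⟩
  · right
    have hL := H.label_succ_of_turning h1 ht
    rw [H.isNil_source_above h1 ht (by omega)] at hnil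
    rw [H.positive_iff ht (w := label p q i / 2) (by omega)]
    omega

/-- For `p` odd the path starts in a positive source, so the field `side` is vacuous for an
initially negative signature. -/
theorem exists_primeData (H : Admissible p q) : ∃ a b h, PrimeData p q a b h := by
  have Z := H.zigzag
  by_cases s0 : Positive p q 0
  · have C := lastPos_spec (p := p) (q := q)
    refine ⟨_, _, _, isChain_of_edgeOK fun i h1 hn => Z.edge_pos C s0 h1 hn,
      fun i h1 hn => (Z.edge_pos C s0 h1 hn).2.2.2.2.2,
      fun i h1 hn => H.sign_smul_beta'_pos s0 h1 hn, fun i h1 hn => Z.kind_pos C s0 h1 hn,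
      fun _ i t h1 hn ht htn ha hne => Z.side_pos C s0 h1 hn ht htn ha hne,
      fun i h1 hn ht hnil => Z.tailPos_even C s0 h1 hn ht (H.positive_of_source h1 hn ht hnil)⟩
  · have C := nextNeg_spec (p := p) (q := q)
    have L0 : label p q 1 = 0 := by
      by_contra h
      have := Z.L_one
      exact s0 (Z.s_zero (by omega))
    refine ⟨_, _, _, isChain_of_edgeOK fun i h1 hn => Z.edge_neg C L0 h1 hn,
      fun i h1 hn => (Z.edge_neg C L0 h1 hn).2.2.2.2.2,
      fun i h1 hn => H.sign_smul_beta'_neg s0 h1 hn, fun i h1 hn => Z.kind_neg C L0 h1 hn,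
      fun hp => ?_,
      fun i h1 hn ht hnil => Z.tailNeg_even C L0 h1 hn ht (H.positive_of_source h1 hn ht hnil)⟩
    rw [H.label_one] at L0
    omega

end Admissible
end Meander

namespace Meander
set_option linter.unusedSimpArgs false
namespace Admissible

variable {p q : ℕ}
open Zigzag

/-! ### The exceptional index -/

theorem isExceptional_iff (H : Admissible p q) {i : ℕ} (h1 : 1 ≤ i) (hn : i < p + q) :
    IsExceptional p q i ↔
      phi p q (i + 1) = phi p q i + 1 ∨ phi p q i = phi p q (i + 1) + 1 := by
  have ha := H.phi_mem i h1
  have hb := H.phi_mem (i + 1) (by omega)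
  have hne := (H.phi_step h1 hn).1
  constructor
  · rintro ⟨-, -, k, hk, hkn, h | h⟩
    · have := eps_sub_inj ha hb hne.symm h
      omega
    · rw [alpha, neg_sub] at h
      have := eps_sub_inj ha hb hne.symm h
      omega
  · rintro (h | h)
    · exact ⟨h1, hn, phi p q i, ha.1, by omega, Or.inl (by rw [beta, betaI, h, alpha])⟩
    · exact ⟨h1, hn, phi p q (i + 1), hb.1, by omega,
        Or.inr (by rw [beta, betaI, h, alpha, neg_sub])⟩

/-- An edge joins a vertex and its image under `σ`. -/
theorem exists_sigma_edge (H : Admissible p q) {x : ℕ} (hx : 1 ≤ x ∧ x ≤ p + q)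
    (hs : sigma p q x ≠ x) : ∃ e, 1 ≤ e ∧ e < p + q ∧
      (phi p q e = x ∧ phi p q (e + 1) = sigma p q x ∨
        phi p q e = sigma p q x ∧ phi p q (e + 1) = x) := by
  obtain ⟨t, ht, rfl⟩ := H.phi_bijOn.surjOn hx
  rw [Set.mem_Icc] at ht
  rcases Nat.mod_two_eq_zero_or_one t with h | h
  · have h2 := phi_succ (p := p) (q := q) (t - 1) (by omega)
    rw [if_pos (by omega), Nat.sub_add_cancel ht.1] at h2
    have h3 := H.phi_mem (t - 1) (by omega)
    refine ⟨t - 1, by omega, by omega, Or.inr ⟨?_, by rw [Nat.sub_add_cancel ht.1]⟩⟩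
    rw [h2, sigma, sigma]; omega
  · have h2 := phi_succ (p := p) (q := q) t ht.1
    rw [if_pos h] at h2
    refine ⟨t, ht.1, lt_of_le_of_ne ht.2 ?_, Or.inl ⟨rfl, h2⟩⟩
    rintro rfl
    rw [H.phi_end] at h2
    exact hs h2.symm

/-- An edge joins a vertex and its image under `τ`. -/
theorem exists_tau_edge (H : Admissible p q) {x : ℕ} (hx : 1 ≤ x ∧ x ≤ p + q)
    (hs : tau p q x ≠ x) : ∃ e, 1 ≤ e ∧ e < p + q ∧
      (phi p q e = x ∧ phi p q (e + 1) = tau p q x ∨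
        phi p q e = tau p q x ∧ phi p q (e + 1) = x) := by
  have hlt := H.lt
  obtain ⟨t, ht, rfl⟩ := H.phi_bijOn.surjOn hx
  rw [Set.mem_Icc] at ht
  rcases Nat.mod_two_eq_zero_or_one t with h | h
  · have h2 := phi_succ (p := p) (q := q) t ht.1
    rw [if_neg (by omega)] at h2
    refine ⟨t, ht.1, lt_of_le_of_ne ht.2 ?_, Or.inl ⟨rfl, h2⟩⟩
    rintro rfl
    rw [H.phi_end] at h2
    exact hs h2.symm
  · have ht1 : t ≠ 1 := by
      rintro rfl
      apply hs
      have h3 := two_start p q H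
      rw [show phi p q 1 = start p q from rfl, tau]
      split_ifs <;> omega
    have h2 := phi_succ (p := p) (q := q) (t - 1) (by omega)
    rw [if_neg (by omega), Nat.sub_add_cancel ht.1] at h2
    have h3 := H.phi_mem (t - 1) (by omega)
    refine ⟨t - 1, by omega, by omega, Or.inr ⟨?_, by rw [Nat.sub_add_cancel ht.1]⟩⟩
    rw [h2]
    simp only [tau]
    split_ifs <;> omega

/-- The smaller coordinate of the end points of the exceptional edge. -/
theorem exceptional_cases (H : Admissible p q) {i : ℕ} (h : IsExceptional p q i) :
    ∃ x, (phi p q i = x ∧ phi p q (i + 1) = x + 1 ∨ phi p q i = x + 1 ∧ phi p q (i + 1) = x) ∧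
      (i % 2 = 1 ∧ 2 * x = p + q ∨ i % 2 = 0 ∧ 2 * x = p ∨ i % 2 = 0 ∧ 2 * x = p + q + p) := by
  have h3 := (H.isExceptional_iff h.1 h.2.1).1 h
  have h4 := H.phi_step h.1 h.2.1
  rcases h3 with h3 | h3
  · exact ⟨phi p q i, by omega, by omega⟩
  · exact ⟨phi p q (i + 1), by omega, by omega⟩

/-- A reflection of an interval joins two neighbours exactly if the interval has even length, namely
its middle pair. Of the lengths `p + q`, `p`, `q` exactly one is even. -/
theorem existsUnique_exceptional (H : Admissible p q) : ∃! e : ℕ, IsExceptional p q e := by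
  have h1 := H.not_both_even
  have h2 := H.lt
  have h3 := H.pos
  have hex : ∃ e, IsExceptional p q e := by
    by_cases hn : (p + q) % 2 = 0
    · have hs : sigma p q ((p + q) / 2) = (p + q) / 2 + 1 := by rw [sigma]; omega
      obtain ⟨e, he, hen, h⟩ := H.exists_sigma_edge (x := (p + q) / 2) (by omega) (by omega)
      exact ⟨e, (H.isExceptional_iff he hen).2 (by omega)⟩
    · by_cases hp : p % 2 = 0
      · have hs : tau p q (p / 2) = p / 2 + 1 := by rw [tau, if_pos (by omega)]; omega
        obtain ⟨e, he, hen, h⟩ := H.exists_tau_edge (x := p / 2) (by omega) (by omega)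
        exact ⟨e, (H.isExceptional_iff he hen).2 (by omega)⟩
      · have hs : tau p q (p + q / 2) = p + q / 2 + 1 := by rw [tau, if_neg (by omega)]; omega
        obtain ⟨e, he, hen, h⟩ := H.exists_tau_edge (x := p + q / 2) (by omega) (by omega)
        exact ⟨e, (H.isExceptional_iff he hen).2 (by omega)⟩
  obtain ⟨e, he⟩ := hex
  refine ⟨e, he, fun e' he' => ?_⟩
  obtain ⟨x, hx, hx'⟩ := H.exceptional_cases he
  obtain ⟨y, hy, hy'⟩ := H.exceptional_cases he'
  -- Parity allows only one of the three alternatives for `2 * x`, so both edges join the same pair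
  -- of vertices.
  have hxy : x = y := by omega
  subst hxy
  obtain ⟨a1, a2, -⟩ := he
  obtain ⟨b1, b2, -⟩ := he'
  have inj := fun s t hs ht => H.phi_inj (s := s) (t := t) hs ht
  have i1 := inj e' e ⟨b1, b2.le⟩ ⟨a1, a2.le⟩
  have i2 := inj e' (e + 1) ⟨b1, b2.le⟩ ⟨by omega, a2⟩
  have i3 := inj (e' + 1) e ⟨by omega, b2⟩ ⟨a1, a2.le⟩
  omega

/-! ### The main statements -/

/-- The four parts of the theorem for given values `β''`. -/
theorem conclusion_of_chain (H : Admissible p q) {K : Type*} [LinearOrder K] {a b : ℕ → ℕ}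
    {h : ℕ → K} {e : ℕ} (he : 1 ≤ e) (hen : e < p + q) (C : IsChain (p + q) a b h)
    (hS : ∀ i, 1 ≤ i → i < p + q → betaStar2 p q e i = betaI p q (a i) (b i))
    (hmono : ∀ i, 1 ≤ i → i < p + q → i ≠ e →
      h (tail (label p q) i) < h (head (label p q) i))
    (hk : ∀ i, 1 ≤ i → i < p + q → a i = tail (label p q) i ∧ b i = head (label p q) i ∨
      p < phi p q (a i) ∧ phi p q (b i) ≤ p)
    (hne : ¬ (a e = tail (label p q) e ∧ b e = head (label p q) e)) :
    IsSimpleSystem (PiStar2 p q e) ∧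
      (∀ i : ℕ, 1 ≤ i → i < p + q → betaStar2 p q e i ≠ signedBeta p q i →
        coeff (p + q) p (betaStar2 p q e i) = -1) ∧
      betaStar2 p q e e ≠ signedBeta p q e ∧
      (∀ i : ℕ, 1 ≤ i → i < p + q → i ≠ e → signedBeta p q i ∈ natSpan (PiStar2 p q e)) := by
  have hPi : PiStar2 p q e = edgeRoots (p + q) (phi p q) a b := by
    ext v
    constructor
    · rintro ⟨i, h1, hn, rfl⟩
      exact ⟨i, h1, hn, hS i h1 hn⟩
    · rintro ⟨i, h1, hn, rfl⟩
      exact ⟨i, h1, hn, (hS i h1 hn).symm⟩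
  refine ⟨?_, ?_, ?_, ?_⟩
  · rw [hPi]
    exact C.isSimpleSystem (by omega) H.phi_bijOn
  · intro i h1 hn hi
    rcases hk i h1 hn with h2 | h2
    · exfalso
      rw [hS i h1 hn, h2.1, h2.2, signedBeta_eq] at hi
      exact hi rfl
    · rw [hS i h1 hn, betaI, H.coeff_phi (C.mem_a i h1 hn).1 (C.mem_b i h1 hn).1,
        if_neg (by omega), if_pos h2.2]
      norm_num
  · rw [hS e he hen, signedBeta_eq]
    intro heq
    have hab : a e ≠ b e := fun h' => by
      have := C.lt e he hen
      rw [h'] at this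
      exact lt_irrefl _ this
    exact hne (H.betaI_inj (C.mem_a e he hen) (C.mem_b e he hen) (tail_mem he hen)
      (head_mem he hen) hab heq)
  · intro i h1 hn hi
    rw [hPi, signedBeta_eq]
    have ht := tail_mem (L := label p q) h1 hn
    have hh := head_mem (L := label p q) h1 hn
    exact C.natSpan_of_lt ht.1 ht.2 hh.1 hh.2 (hmono i h1 hn hi)

theorem sign_mul_self (i : ℕ) : sign p q i * sign p q i = 1 := by
  rw [sign, ← pow_add]; exact Even.neg_one_pow ⟨_, rfl⟩

theorem smul_sign_smul (i : ℕ) (v : Fin (p + q) → ℝ) : sign p q i • sign p q i • v = v := by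
  rw [smul_smul, sign_mul_self, one_smul]

theorem sign_smul_inj {i : ℕ} {v w : Fin (p + q) → ℝ} (h : sign p q i • v = sign p q i • w) :
    v = w := by
  rw [← smul_sign_smul i v, h, smul_sign_smul]

namespace PrimeData
variable {a b : ℕ → ℕ} {h : ℕ → ℤ ×ₗ ℤ ×ₗ ℤ}

theorem ne (D : PrimeData p q a b h) {i : ℕ} (h1 : 1 ≤ i) (hn : i < p + q) : a i ≠ b i :=
  fun h' => by
    have := D.chain.lt i h1 hn
    rw [h'] at this
    exact lt_irrefl _ this

theorem eq_of_beta' (D : PrimeData p q a b h) (H : Admissible p q) {i : ℕ} (h1 : 1 ≤ i)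
    (hn : i < p + q) (he : beta' p q i = beta p q i) :
    a i = tail (label p q) i ∧ b i = head (label p q) i := by
  have h2 := D.prime_eq i h1 hn
  have h3 := signedBeta_eq (p := p) (q := q) i
  rw [he] at h2
  rw [signedBeta, h2] at h3
  exact H.betaI_inj (D.chain.mem_a i h1 hn) (D.chain.mem_b i h1 hn) (tail_mem h1 hn)
    (head_mem h1 hn) (D.ne h1 hn) h3

theorem beta'_eq (D : PrimeData p q a b h) {i : ℕ} (h1 : 1 ≤ i)
    (hn : i < p + q) (he : a i = tail (label p q) i ∧ b i = head (label p q) i) :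
    beta' p q i = beta p q i := by
  apply sign_smul_inj (i := i)
  rw [D.prime_eq i h1 hn, he.1, he.2]
  exact (signedBeta_eq i).symm

/-- The coefficient of `α_p` in a changed value. -/
theorem phi_of_changed (D : PrimeData p q a b h) (H : Admissible p q) {i : ℕ} (h1 : 1 ≤ i)
    (hn : i < p + q) : a i = tail (label p q) i ∧ b i = head (label p q) i ∨
      p < phi p q (a i) ∧ phi p q (b i) ≤ p := by
  by_cases hc : a i = tail (label p q) i ∧ b i = head (label p q) i
  · exact Or.inl hc
  right
  -- Nil values never change, so the original ends lie on the same side of `p`; the moved end goes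
  -- to the other side.
  have hnil : ¬ IsNil p q i := fun hnil =>
    hc (D.eq_of_beta' H h1 hn (beta'_of_nil hnil))
  rw [H.isNil_iff h1, not_not] at hnil
  have hth : phi p q (tail (label p q) i) ≤ p ↔ phi p q (head (label p q) i) ≤ p := by
    rw [tail, head]
    split_ifs
    · exact hnil
    · exact hnil.symm
  rcases D.kind i h1 hn with h2 | ⟨h2, h3, h4, h5, h6⟩ | ⟨h2, h3, h4, h5, h6⟩
  · exact absurd h2 hc
  · have h7 := (H.label_turning_odd_iff h2).1 h3
    have h8 := H.label_turning_odd_iff h5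
    rw [h4]
    exact ⟨by omega, hth.1 h7⟩
  · have h7 := H.label_turning_odd_iff h2
    have h8 := (H.label_turning_odd_iff h5).1 h6
    rw [h4]
    refine ⟨?_, h8⟩
    by_contra hle
    have := hth.1 (by omega)
    omega

/-- The theorem if the exceptional value is changed. -/
theorem conclusion_of_ne (D : PrimeData p q a b h) (H : Admissible p q) {e : ℕ} (he : 1 ≤ e)
    (hen : e < p + q) (hc : beta' p q e ≠ beta p q e) :
    IsSimpleSystem (PiStar2 p q e) ∧
      (∀ i : ℕ, 1 ≤ i → i < p + q → betaStar2 p q e i ≠ signedBeta p q i →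
        coeff (p + q) p (betaStar2 p q e i) = -1) ∧
      betaStar2 p q e e ≠ signedBeta p q e ∧
      (∀ i : ℕ, 1 ≤ i → i < p + q → i ≠ e → signedBeta p q i ∈ natSpan (PiStar2 p q e)) := by
  refine H.conclusion_of_chain he hen D.chain (fun i h1 hn => ?_)
    (fun i h1 hn _ => D.mono i h1 hn) (fun i h1 hn => D.phi_of_changed H h1 hn)
    (fun h' => hc (D.beta'_eq he hen h'))
  rw [betaStar2, beta'', if_pos hc]
  exact D.prime_eq i h1 hn

end PrimeData
end Admissible
end Meander

namespace Meander
set_option linter.unusedSimpArgs false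
namespace Admissible

variable {p q : ℕ}
open Zigzag

/-! ### The correction at an unchanged exceptional value -/

theorem label_tail {i : ℕ} (h : ¬ IsTurning p q (tail (label p q) i)) : label p q (tail (label p q) i) = label p q i := by
  rw [tail] at h ⊢
  split_ifs at h ⊢
  · rfl
  · exact label_succ_of_not h

theorem label_head {i : ℕ} (h : ¬ IsTurning p q (head (label p q) i)) : label p q (head (label p q) i) = label p q i := by
  rw [head] at h ⊢
  split_ifs at h ⊢
  · exact label_succ_of_not h
  · rfl

theorem tail_ne_sink (H : Admissible p q) {i t : ℕ} (h1 : 1 ≤ i) (hn : i < p + q)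
    (ht : IsTurning p q t) (hL : label p q t % 2 = 0) : t ≠ tail (label p q) i := by
  rintro rfl
  have := trn_tail H.zigzag h1 hn ht
  omega

theorem sign_smul_beta (i : ℕ) : sign p q i • beta p q i =
    betaI p q (tail (label p q) i) (head (label p q) i) := signedBeta_eq i

theorem sign_eq_neg {i j : ℕ} (h : label p q i % 2 ≠ label p q j % 2) :
    sign p q i = - sign p q j := by
  rcases Nat.mod_two_eq_zero_or_one (label p q i) with hi | hi
  · rw [sign_of_even (by omega), sign_of_odd (by omega)]
  · rw [sign_of_odd hi, sign_of_even (by omega), neg_neg]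

theorem sign_eq {i j : ℕ} (h : label p q i % 2 = label p q j % 2) :
    sign p q i = sign p q j := by
  rcases Nat.mod_two_eq_zero_or_one (label p q i) with hi | hi
  · rw [sign_of_even (by omega), sign_of_even (by omega)]
  · rw [sign_of_odd hi, sign_of_odd (by omega)]

theorem sign_smul_mem_roots (i : ℕ) {v : Fin (p + q) → ℝ} :
    sign p q i • v ∈ roots (p + q) ↔ v ∈ roots (p + q) := by
  rcases Nat.mod_two_eq_zero_or_one (label p q i) with hi | hi
  · rw [sign_of_even (by omega), neg_one_smul]
    exact ⟨fun h => by simpa using neg_mem_roots h, neg_mem_roots⟩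
  · rw [sign_of_odd hi, one_smul]

theorem betaI_mem_roots (H : Admissible p q) {a b : ℕ} (ha : 1 ≤ a ∧ a ≤ p + q)
    (hb : 1 ≤ b ∧ b ≤ p + q) (hab : a ≠ b) : betaI p q a b ∈ roots (p + q) :=
  ⟨_, _, (H.phi_mem a ha.1).1, (H.phi_mem a ha.1).2, (H.phi_mem b hb.1).1, (H.phi_mem b hb.1).2,
    fun h => hab (H.phi_inj ha hb h), rfl⟩

theorem betaI_add_betaI_notMem_roots (H : Admissible p q) {a b c d : ℕ} (ha : 1 ≤ a ∧ a ≤ p + q)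
    (hb : 1 ≤ b ∧ b ≤ p + q) (hc : 1 ≤ c ∧ c ≤ p + q) (hd : 1 ≤ d ∧ d ≤ p + q) (hab : a ≠ b)
    (had : a ≠ d) (hcb : c ≠ b) (hcd : c ≠ d) :
    betaI p q a b + betaI p q c d ∉ roots (p + q) :=
  sub_add_sub_notMem_roots (H.phi_mem a ha.1) (H.phi_mem c hc.1)
    (fun h => hab (H.phi_inj ha hb h)) (fun h => had (H.phi_inj ha hd h))
    (fun h => hcb (H.phi_inj hc hb h)) (fun h => hcd (H.phi_inj hc hd h))

/-- The two edges at an internal turning point that is the head of the edge `e`. -/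
theorem excOther_spec (H : Admissible p q) {e : ℕ} (he : 1 ≤ e) (hen : e < p + q)
    (ht : IsTurning p q (head (label p q) e)) (hy : ¬ IsTurning p q (tail (label p q) e))
    (h1 : 1 < head (label p q) e) (h2 : head (label p q) e < p + q) :
    1 ≤ excOther p q e ∧ excOther p q e < p + q ∧ excOther p q e ≠ e ∧
      head (label p q) (excOther p q e) = head (label p q) e ∧
      label p q (excOther p q e) % 2 ≠ label p q e % 2 ∧
      ∀ i, head (label p q) i = head (label p q) e → i = e ∨ i = excOther p q e := by
  rcases Nat.mod_two_eq_zero_or_one (label p q e) with ho | ho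
  · have hh : head (label p q) e = e := by rw [head, if_neg (by omega)]
    rw [hh] at ht h1 h2 ⊢
    have hf : excOther p q e = e - 1 := by rw [excOther, if_pos ht]
    have hL := H.label_succ_of_turning (t := e - 1) (by omega) (by rwa [Nat.sub_add_cancel he])
    rw [Nat.sub_add_cancel he] at hL
    rw [hf]
    refine ⟨by omega, by omega, by omega, ?_, by omega, fun i hi => ?_⟩
    · rw [head, if_pos (by omega)]; omega
    · rw [head] at hi
      split_ifs at hi <;> omega
  · have hh : head (label p q) e = e + 1 := by rw [head, if_pos ho]
    have hyt : tail (label p q) e = e := by rw [tail, if_pos ho]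
    rw [hh] at ht h1 h2 ⊢
    rw [hyt] at hy
    have hf : excOther p q e = e + 1 := by rw [excOther, if_neg hy]
    have hL := H.label_succ_of_turning he ht
    rw [hf]
    refine ⟨by omega, by omega, by omega, ?_, by omega, fun i hi => ?_⟩
    · rw [head, if_neg (by omega)]
    · rw [head] at hi
      split_ifs at hi <;> omega

theorem excTurn_eq {e : ℕ} (ht : IsTurning p q (head (label p q) e))
    (hy : ¬ IsTurning p q (tail (label p q) e)) : excTurn p q e = head (label p q) e := by
  rw [excTurn]
  rw [head] at *
  rw [tail] at *
  split_ifs at * with h1 h2 <;> first | rfl | contradiction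

namespace PrimeData
variable {a b : ℕ → ℕ} {h : ℕ → ℤ ×ₗ ℤ ×ₗ ℤ}

/-- If the exceptional value is unchanged, it is a boundary value of a sink. -/
theorem exceptional_sink (D : PrimeData p q a b h) (H : Admissible p q) {e : ℕ}
    (he : IsExceptional p q e) (hc : beta' p q e = beta p q e) :
    p % 2 = 1 ∧ IsTurning p q (head (label p q) e) ∧ ¬ IsTurning p q (tail (label p q) e) ∧
      p < phi p q (head (label p q) e) ∧ p < phi p q (tail (label p q) e) ∧
      (e % 2 = 1 ∧ 2 * phi p q (head (label p q) e) = p + q + 2 ∨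
        e % 2 = 0 ∧ 2 * phi p q (head (label p q) e) = p + q + p) := by
  obtain ⟨x, hx, hcase⟩ := H.exceptional_cases he
  obtain ⟨he1, hen, -⟩ := he
  have hlt := H.lt
  have hpos := H.pos
  have hpar := H.not_both_even
  have hdir := H.label_odd_iff he1 hen
  have htm := tail_mem (L := label p q) he1 hen
  have hhm := head_mem (L := label p q) he1 hen
  have key : e % 2 = 1 ∧ phi p q (tail (label p q) e) = x ∧ phi p q (head (label p q) e) = x + 1 ∨
      e % 2 = 0 ∧ phi p q (tail (label p q) e) = x + 1 ∧ phi p q (head (label p q) e) = x := by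
    rw [tail, head]
    split_ifs <;> omega
  rw [H.isTurning_iff htm.1 htm.2, H.isTurning_iff hhm.1 hhm.2]
  rcases hcase with hcase | hcase | hcase
  · omega
  -- Here the edge is `τ` on `{1, …, p}` and its tail is a source. The edge is not nil, so its tail
  -- would have been moved to a sink.
  · exfalso
    have ht : IsTurning p q (tail (label p q) e) := by
      rw [H.isTurning_iff htm.1 htm.2]; omega
    have hnil : ¬ IsNil p q e := by rw [H.isNil_iff he1]; omega
    have h1 := D.source e he1 hen ht hnil
    rw [(D.eq_of_beta' H he1 hen hc).1] at h1
    have := trn_tail H.zigzag he1 hen ht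
    omega
  · omega

/-- The theorem if the exceptional value is an unchanged boundary value of an internal turning
point. -/
theorem conclusion_internal (D : PrimeData p q a b h) (H : Admissible p q) {e : ℕ}
    (he : IsExceptional p q e) (hc : beta' p q e = beta p q e)
    (h1 : 1 < head (label p q) e) (h2 : head (label p q) e < p + q) :
    IsSimpleSystem (PiStar2 p q e) ∧
      (∀ i : ℕ, 1 ≤ i → i < p + q → betaStar2 p q e i ≠ signedBeta p q i →
        coeff (p + q) p (betaStar2 p q e i) = -1) ∧
      betaStar2 p q e e ≠ signedBeta p q e ∧
      (∀ i : ℕ, 1 ≤ i → i < p + q → i ≠ e → signedBeta p q i ∈ natSpan (PiStar2 p q e)) := by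
  obtain ⟨hp, ht, hy, hpt, hpy, -⟩ := D.exceptional_sink H he hc
  obtain ⟨he1, hen, -⟩ := he
  obtain ⟨hf1, hfn, hfe, hhf, hLf, hefu⟩ := H.excOther_spec he1 hen ht hy h1 h2
  have hexc := excTurn_eq ht hy
  have hLt := trn_head H.zigzag he1 hen ht
  obtain ⟨hae, hbe⟩ := D.eq_of_beta' H he1 hen hc
  have hLy := label_tail hy
  -- The chain edge leaving the sink cannot have the parity of `e`: by `side` this would make the
  -- head of `e` a changed one, or make the tail of `e` a turning point.
  have hside : ∀ i, 1 ≤ i → i < p + q → a i = head (label p q) e →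
      label p q i % 2 ≠ label p q e % 2 := by
    intro i hi hin hai
    obtain ⟨s1, s2⟩ := D.side hp i _ hi hin h1 h2 hai (H.tail_ne_sink hi hin ht hLt)
    rcases Nat.mod_two_eq_zero_or_one (label p q e) with ho | ho
    · have hh : head (label p q) e = e := by rw [head, if_neg (by omega)]
      rw [hh] at s2 h1 hbe
      intro hL
      have := D.chain.inj_b (e - 1) e (by omega) (by omega) he1 hen
        ((s2 (by omega)).trans hbe.symm)
      omega
    · have hh : head (label p q) e = e + 1 := by rw [head, if_pos ho]
      have hyt : tail (label p q) e = e := by rw [tail, if_pos ho]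
      rw [hh] at s1 h2 hbe
      rw [hyt] at hy
      intro hL
      rcases s1 (by omega) with s1 | s1
      · have := D.chain.inj_b (e + 1) e (by omega) h2 he1 hen (s1.trans hbe.symm)
        omega
      · rw [Nat.add_sub_cancel] at s1
        exact hy s1
  have hint : IsInternal p q (head (label p q) e) := ⟨ht, h1, h2⟩
  obtain ⟨f, hf⟩ : ∃ f, excOther p q e = f := ⟨_, rfl⟩
  have hiota : excIota p q e = beta' p q f - beta p q f := by
    rw [excIota]; simp only [hexc, if_pos hint, hf]
  rw [hf] at hf1 hfn hfe hhf hLf hefu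
  generalize htt : head (label p q) e = t at *
  generalize hyy : tail (label p q) e = y at *
  have hty : t ≠ y := by rintro rfl; exact hy ht
  have htl : ∀ i, 1 ≤ i → i < p + q → t ≠ tail (label p q) i :=
    fun i hi hin => H.tail_ne_sink hi hin ht hLt
  have htm : 1 ≤ t ∧ t ≤ p + q := ⟨h1.le, h2.le⟩
  have hym : 1 ≤ y ∧ y ≤ p + q := hae ▸ D.chain.mem_a e he1 hen
  -- Since `e` keeps its head `t`, the other edge at `t` cannot; so its head was moved to a source.
  have hbf : b f ≠ t := fun hb => hfe (D.chain.inj_b f e hf1 hfn he1 hen (hb.trans hbe.symm))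
  obtain ⟨haf, htbf, hLbf⟩ :
      a f = tail (label p q) f ∧ IsTurning p q (b f) ∧ label p q (b f) % 2 = 1 := by
    rcases D.kind f hf1 hfn with hk | hk | hk
    · exact absurd (hk.2.trans hhf) hbf
    · exact absurd (hk.2.2.1.trans hhf) hbf
    · exact hk.2.2
  have haft : a f ≠ t := by rw [haf]; exact (htl f hf1 hfn).symm
  have hay : ∀ i, 1 ≤ i → i < p + q → i ≠ e → a i ≠ y := fun i hi hin hie h' =>
    hie (D.chain.inj_a i e hi hin he1 hen (h'.trans hae.symm))
  have hbt : ∀ i, 1 ≤ i → i < p + q → i ≠ e → b i ≠ t := fun i hi hin hie h' =>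
    hie (D.chain.inj_b i e hi hin he1 hen (h'.trans hbe.symm))
  have hse : sign p q e • beta p q e = betaI p q y t := by rw [sign_smul_beta, htt, hyy]
  have C := D.chain.move he1 hen hf1 hfn (Ne.symm hfe) (by rwa [hbe])
  rw [hae, hbe] at C
  have hchanged : ∀ i, 1 ≤ i → i < p + q → a i = t → beta' p q i ≠ beta p q i :=
    fun i hi hin hai h' => htl i hi hin (hai.symm.trans (D.eq_of_beta' H hi hin h').1)
  refine H.conclusion_of_chain he1 hen C (fun i hi hin => ?_) (fun i hi hin hie => ?_)
    (fun i hi hin => ?_) ?_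
  · rw [betaStar2, beta'', if_neg (not_not.2 hc)]
    by_cases hie : i = e
    · subst hie
      have hfs : sign p q i = - sign p q f := sign_eq_neg (Ne.symm hLf)
      rw [if_pos rfl, hiota, hae, Equiv.swap_apply_right, Equiv.swap_apply_left, hfs, neg_smul_neg,
        smul_sub, D.prime_eq f hf1 hfn, sign_smul_beta, haf, hhf]
      simp only [betaI]
      abel
    by_cases hif : i = f
    · subst hif
      rw [if_neg hie, hf, if_pos rfl, Equiv.swap_apply_right,
        Equiv.swap_apply_of_ne_of_ne haft (hay i hi hin hie), hbe, sign_smul_beta, hhf, haf]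
    rw [if_neg hie, hf, if_neg hif, Equiv.swap_apply_of_ne_of_ne hie hif]
    have hab := D.ne hi hin
    have ham := D.chain.mem_a i hi hin
    have hbm := D.chain.mem_b i hi hin
    by_cases hat : a i = t
    -- With opposite signs, subtracting `β_e` prepends `y → t` to `t → b i` and leaves the root `y →
    -- b i`.
    · have hsi : sign p q i = - sign p q e := sign_eq_neg (hside i hi hin hat)
      have hval : sign p q i • (beta' p q i - beta p q e) = betaI p q y (b i) := by
        rw [smul_sub, D.prime_eq i hi hin, hsi, neg_smul, hse, hat]
        simp only [betaI]
        abel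
      have hyb : y ≠ b i := by
        intro h'
        have l1 := D.chain.lt e he1 hen
        have l2 := D.chain.lt i hi hin
        rw [hae, hbe] at l1
        rw [hat, ← h'] at l2
        exact lt_asymm l1 l2
      rw [if_pos ⟨hchanged i hi hin hat, (sign_smul_mem_roots i).1
        (hval ▸ H.betaI_mem_roots hym hbm hyb)⟩, hval, hat, Equiv.swap_apply_left]
    · rw [Equiv.swap_apply_of_ne_of_ne hat (hay i hi hin hie), if_neg, D.prime_eq i hi hin]
      -- The index to be corrected is unique. For any other changed edge a root would need a common
      -- vertex: a shared tail or head contradicts injectivity, and `b i = y` would force the sign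
      -- of `i` to equal that of `e`, as `y` is not a turning point.
      rintro ⟨hch, hroot⟩
      rw [← sign_smul_mem_roots i, smul_sub, D.prime_eq i hi hin] at hroot
      by_cases hL : label p q i % 2 = label p q e % 2
      · rw [sign_eq hL, hse, sub_eq_add_neg, show -betaI p q y t = betaI p q t y from neg_sub _ _]
          at hroot
        exact H.betaI_add_betaI_notMem_roots ham hbm htm hym hab (hay i hi hin hie)
          (hbt i hi hin hie).symm hty hroot
      · rw [sign_eq_neg hL, neg_smul, hse, sub_neg_eq_add] at hroot
        refine H.betaI_add_betaI_notMem_roots ham hbm hym htm hab hat ?_ hty.symm hroot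
        intro hyb
        rcases D.kind i hi hin with hk | hk | hk
        · exact hch (D.beta'_eq hi hin hk)
        · have hyh := hyb.trans hk.2.2.1
          have h3 := label_head (i := i) (by rwa [← hyh])
          rw [← hyh, hLy] at h3
          exact hL (by rw [h3])
        · exact hy (hyb ▸ hk.2.2.2.1)
  · have hti := htl i hi hin
    rw [if_neg hti.symm]
    by_cases hif : i = f
    · subst hif
      rw [hhf, if_pos rfl, Prod.Lex.toLex_lt_toLex, ← haf]
      -- The original edge `f` ends in `t`, which now has the height of `b f`; its tail is that of
      -- the changed edge, so the old inequality applies.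
      exact Or.inl (D.chain.lt i hi hin)
    · rw [if_neg (fun h' => (hefu i h').elim hie hif), Prod.Lex.toLex_lt_toLex]
      exact Or.inl (D.mono i hi hin)
  · by_cases hie : i = e
    · subst hie
      rw [hae, Equiv.swap_apply_right, Equiv.swap_apply_left]
      exact Or.inr ⟨hpt, (H.label_turning_odd_iff htbf).1 hLbf⟩
    by_cases hif : i = f
    · subst hif
      rw [Equiv.swap_apply_right, Equiv.swap_apply_of_ne_of_ne haft (hay i hi hin hie), hbe, hhf]
      exact Or.inl ⟨haf, rfl⟩
    rw [Equiv.swap_apply_of_ne_of_ne hie hif]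
    by_cases hat : a i = t
    · rw [hat, Equiv.swap_apply_left]
      rcases D.phi_of_changed H hi hin with hk | hk
      · exact absurd (hat.symm.trans hk.1) (htl i hi hin)
      · exact Or.inr ⟨hpy, hk.2⟩
    · rw [Equiv.swap_apply_of_ne_of_ne hat (hay i hi hin hie)]
      exact D.phi_of_changed H hi hin
  · rw [hae, Equiv.swap_apply_right, hyy]
    exact fun h' => hty h'.1

end PrimeData

/-- The theorem for `p = 1` if the exceptional value is the last one. -/
theorem conclusion_last (H : Admissible 1 q) {e : ℕ} (he : e + 1 = 1 + q)
    (hphi : 1 < phi 1 q (1 + q)) :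
    IsSimpleSystem (PiStar2 1 q e) ∧
      (∀ i : ℕ, 1 ≤ i → i < 1 + q → betaStar2 1 q e i ≠ signedBeta 1 q i →
        coeff (1 + q) 1 (betaStar2 1 q e i) = -1) ∧
      betaStar2 1 q e e ≠ signedBeta 1 q e ∧
      (∀ i : ℕ, 1 ≤ i → i < 1 + q → i ≠ e → signedBeta 1 q i ∈ natSpan (PiStar2 1 q e)) := by
  have Z := H.zigzag
  have hn := H.two_lt
  have hLn := H.label_n
  have hL1 := H.label_one
  -- For `p = 1` the two ends are the only turning points, so nothing is changed before the
  -- correction.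
  have hL : ∀ i, 1 ≤ i → i < 1 + q → label 1 q i = 1 := by
    intro i hi hin
    have h1 := Z.L_lt hi hin
    have h2 := Z.L_one_le hi hin.le
    have : numJ 1 = 1 := rfl
    omega
  have hint : ∀ i, ¬ IsInternal 1 q i := by
    rintro i ⟨ht, hi, hin⟩
    have h1 := H.label_succ_of_turning (t := i - 1) (by omega) (by rwa [Nat.sub_add_cancel hi.le])
    rw [Nat.sub_add_cancel hi.le, hL i hi.le hin, hL (i - 1) (by omega) (by omega)] at h1
    omega
  have hb' : ∀ i, beta' 1 q i = beta 1 q i := fun i => beta'_of_not (hint _) (hint _)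
  have hte : ¬ IsTurning 1 q e := fun h => hint e ⟨h, by omega, by omega⟩
  have htail : ∀ i, 1 ≤ i → i < 1 + q → tail (label 1 q) i = i := fun i hi hin => by
    rw [tail, hL i hi hin, if_pos rfl]
  have hhead : ∀ i, 1 ≤ i → i < 1 + q → head (label 1 q) i = i + 1 := fun i hi hin => by
    rw [head, hL i hi hin, if_pos rfl]
  have hsign : ∀ i, 1 ≤ i → i < 1 + q → sign 1 q i = 1 := fun i hi hin =>
    sign_of_odd (by rw [hL i hi hin])
  have hT1 : turn 1 q 1 = 1 := by
    have := turn_label H.isTurning_one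
    rwa [hL1] at this
  have hother : excOther 1 q e = 1 + q := by rw [excOther, if_neg hte, he]
  have hiota : excIota 1 q e = betaI 1 q 1 (1 + q) := by
    have h1 : excTurn 1 q e = 1 + q := by rw [excTurn, if_neg hte, he]
    have h2 : label 1 q (1 + q) - 1 = 1 := by rw [hLn]; rfl
    rw [excIota]
    simp only [h1, if_neg (hint _), if_neg (show ¬ 1 + q = 1 by omega), h2, hT1]
  -- The chain `1 → ⋯ → n` becomes `n → 1 → ⋯ → n - 1`; the height `0` puts `n` first.
  refine H.conclusion_of_chain (a := fun i => if i = e then 1 + q else i)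
    (b := fun i => if i = e then 1 else i + 1) (h := fun t => if t = 1 + q then 0 else t)
    (by omega) (by omega) ⟨?_, ?_, ?_, ?_, ?_⟩ (fun i hi hin => ?_) (fun i hi hin hie => ?_)
    (fun i hi hin => ?_) ?_
  · intro i hi hin
    split_ifs <;> omega
  · intro i hi hin
    split_ifs <;> omega
  · intro i j hi hin hj hjn hij
    split_ifs at hij <;> omega
  · intro i j hi hin hj hjn hij
    split_ifs at hij <;> omega
  · intro i hi hin
    split_ifs <;> omega
  · rw [betaStar2, beta'', if_neg (not_not.2 (hb' e)), hother, hsign i hi hin, one_smul, hiota]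
    by_cases hie : i = e
    · rw [if_pos hie, if_pos hie, if_pos hie]
      exact neg_sub _ _
    · rw [if_neg hie, if_neg hie, if_neg hie, if_neg (by omega), if_neg (fun h => h.1 (hb' i)), hb']
      rfl
  · rw [htail i hi hin, hhead i hi hin]
    split_ifs <;> omega
  · by_cases hie : i = e
    · rw [if_pos hie, if_pos hie]
      have h1 := H.label_turning_odd_iff H.isTurning_one
      exact Or.inr ⟨hphi, by omega⟩
    · rw [if_neg hie, if_neg hie, htail i hi hin, hhead i hi hin]
      exact Or.inl ⟨rfl, rfl⟩
  · rw [if_pos rfl, htail e (by omega) (by omega)]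
    omega

theorem conclusion (H : Admissible p q) {e : ℕ} (he : IsExceptional p q e) :
    IsSimpleSystem (PiStar2 p q e) ∧
      (∀ i : ℕ, 1 ≤ i → i < p + q → betaStar2 p q e i ≠ signedBeta p q i →
        coeff (p + q) p (betaStar2 p q e i) = -1) ∧
      betaStar2 p q e e ≠ signedBeta p q e ∧
      (∀ i : ℕ, 1 ≤ i → i < p + q → i ≠ e → signedBeta p q i ∈ natSpan (PiStar2 p q e)) := by
  obtain ⟨a, b, h, D⟩ := H.exists_primeData
  obtain ⟨he1, hen, -⟩ := id he
  by_cases hc : beta' p q e = beta p q e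
  · obtain ⟨hp, ht, -, hpt, -, hcase⟩ := D.exceptional_sink H he hc
    have hLt := trn_head H.zigzag he1 hen ht
    have hhm := head_mem (L := label p q) he1 hen
    have h1 : head (label p q) e ≠ 1 := by
      intro h1
      rw [h1, H.label_one] at hLt
      omega
    by_cases hn : head (label p q) e = p + q
    -- The end of the path is fixed by `σ` or `τ`, so `2φ(n)` is `p + q + 1` or `p + q + p + 1`
    -- according to the parity of `n`. Comparison with the position of the exceptional pair gives `p
    -- = 1`.
    · have hend := phi_succ (p := p) (q := q) (p + q) (by omega)
      rw [H.phi_end, sigma, tau] at hend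
      rw [hn] at hcase hpt
      have hen' : e + 1 = p + q := by
        rw [head] at hn
        split_ifs at hn <;> omega
      have hp1 : p = 1 := by
        split_ifs at hend <;> omega
      subst hp1
      exact H.conclusion_last hen' hpt
    · exact D.conclusion_internal H he hc (by omega) (by omega)
  · exact D.conclusion_of_ne H he1 hen hc

end Admissible
end Meander

theorem theorem3p8 (p q : ℕ) (hp : 0 < p) (hpq : p ≤ q) (hn : 2 < p + q) (hco : Nat.Coprime p q) :
    (∃! e : ℕ, Meander.IsExceptional p q e) ∧
    ∀ e : ℕ, Meander.IsExceptional p q e →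
      Meander.IsSimpleSystem (Meander.PiStar2 p q e) ∧
      (∀ i : ℕ, 1 ≤ i → i < p + q →
        Meander.betaStar2 p q e i ≠ Meander.signedBeta p q i →
        Meander.coeff (p + q) p (Meander.betaStar2 p q e i) = -1) ∧
      Meander.betaStar2 p q e e ≠ Meander.signedBeta p q e ∧
      (∀ i : ℕ, 1 ≤ i → i < p + q → i ≠ e →
        Meander.signedBeta p q i ∈ Meander.natSpan (Meander.PiStar2 p q e)) :=
  have H : Meander.Admissible p q := ⟨hp, hpq, hn, hco⟩
  ⟨H.existsUnique_exceptional, fun _ he => H.conclusion he⟩
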